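/- Let $\Delta\subset\mathbb C$ be an open disc around $0$ with coordinate $t$, and let $x$ be the coordinate of $\mathbb P^1$, $y=1/x$. Let $S_i$ ($i\in I$) and $\widetilde S_j$ ($j\in J$) be finitely many curves in $\Delta\times\mathbb P^1$, $$S_i:\ \mu_i(t)\,y=t^{q_i},\qquad \widetilde S_j:\ x=h_j(t),$$ where $q_i\ge 1$, $\mu_i,h_j$ are holomorphic on $\Delta$, $\mu_i(0)\ne 0$, for $i\neq i'$ one has $q_i\ne q_{i'}$ or $\mu_i(0)\neq\mu_{i'}(0)$, and the values $h_j(0)$ are pairwise distinct. Let either $\psi=0$ (put $q=0$), or $\psi(t)=\mu(t)t^{-q}$ with $q\ge 1$, $\mu$ holomorphic on $\Delta$ and $\mu(0)\ne0$. Put $N=\max(\{q\}\cup\{q_i\mid i\in I\})$. Let $e:Z\to\Delta\times\mathbb P^1$ be the following sequence of point blow-ups. First blow up $N$ times, starting with the point $t=y=0$ and then always the point of the last exceptional curve where $y/t^k=0$ (the $k$-th exceptional curve $E_k$ has the coordinate $y/t^k$; $E_0=\{t=0\}$). If $\psi\neq 0$, blow up the point $w=\mu(0)$ of $E_q$, where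 $w=t^q/y$, and then $q-1$ more times the intersection point of the last exceptional curve with the strict transform of the curve $w=\mu(t)$. Let $D'_Z=e^{-1}(\{t=0\}\cup\{y=0\})$, a normal crossing divisor, let $\widetilde Z$ be the real oriented blow-up of $Z$ along $D'_Z$ (polar coordinates in the local equations of the components of $D'_Z$), and let $F^\vartheta\subset\widetilde Z$ be the fibre over the direction $\vartheta\in\mathbb S^1$ at $t=0$ of the map from $\widetilde Z$ to the real oriented blow-up of $\Delta$ at $0$ induced by $t$. Let $$B_\psi^\vartheta=\{\zeta\in F^\vartheta\mid e^{1/y-\psi(t)}\text{ has moderate growth along }D'_Z\text{ near }\zeta\},$$ i.e. $|e^{1/y-\psi}|\le C|f|^{-M}$ near $\zeta$ off $D'_Z$ for some $C,M$, where $f$ is a local equation of $D'_Z$. Let $\mathcal P^\vartheta\subset F^\vartheta$ be the set of intersection points of $F^\vartheta$ with the strict transforms (the closures in $\widetilde Z$ of the parts outside $D'_Z$) of the $S_i$ and the $\widetilde S_j$, and $\mathcal P^\vartheta_\psi=\mathcal P^\vartheta\cap B^\vartheta_\psi$. Then, for every such $\psi$ (zero or not) and every $\vartheta$, the set $\mathcal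 P_\psi^\vartheta$ is finite, $B_\psi^\vartheta\setminus\mathcal P_\psi^\vartheta$ is (non-empty and) path connected, and for every base point the fundamental group $\pi_1\bigl(B_\psi^\vartheta\setminus\mathcal P_\psi^\vartheta\bigr)$ is a free group of rank $\#\mathcal P_\psi^\vartheta$. -/

import Mathlib

open scoped NNReal

namespace StokesFibre

/-- The real oriented blow-up of `ℂ` at `0` in polar coordinates `(r, e^{iθ})`; its boundary
`r = 0` is the circle of directions at `0`. Products, quotients and inverses are componentwise. -/
abbrev Polar : Type := ℝ≥0 × Circle

/-- The blow-down map `(r, e^{iθ}) ↦ r e^{iθ}`. -/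
noncomputable def toC (u : Polar) : ℂ := ((u.1 : ℝ) : ℂ) * (u.2 : ℂ)

/-- Points of the (real blown up) coordinate charts of the complex surface `Z` which is obtained
from `Δ × ℙ¹` (coordinates `t` and `x = 1 / y`) by the following point blow-ups.

* First `N` blow-ups over `t = y = 0`: the exceptional curve `E k` (`1 ≤ k ≤ N`) has the
  coordinate `y / t ^ k`, and `E (k + 1)` arises by blowing up the point `y / t ^ k = 0` of `E k`;
  here `E 0 = {t = 0}`. The chart `Sum.inl` has coordinates `(t, x)`. The `k`-th crossing chart
  (`k < N`) has coordinates `(u, v)` with `t = u v`, `y = u ^ k * v ^ (k + 1)`, and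
  `E k = {u = 0}`, `E (k + 1) = {v = 0}`. The end chart has coordinates `(t, v)` with
  `y = t ^ N * v`.
* If `1 ≤ q`, then `q` further blow-ups: with `w = t ^ q / y` (a coordinate on `E q`), one blows up
  the point `t = 0`, `w = μ 0` of `E q`, and then always the point where the last exceptional curve
  meets the strict transform of `{w = μ t}`. The exceptional curve `E' s` (`1 ≤ s ≤ q`) has the
  coordinate `(w - μ t) / t ^ s`. The `s`-th branch chart (`s < q`) has coordinates `(u, v)` with
  `t = u v`, `w - μ t = u ^ s * v ^ (s + 1)`, and `E' s = {u = 0}` (`E' 0 = E q`),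
  `E' (s + 1) = {v = 0}`. The last chart has coordinates `(t, z)` with `w - μ t = t ^ q * z`.

The divisor `D` is the preimage of `{t = 0} ∪ {y = 0}`. In the charts it is given by
`t = 0`, `u v = 0`, `t v = 0`, `u v = 0`, `t = 0`, respectively, and exactly the
coordinates occurring in these equations are replaced by polar coordinates. -/
abbrev Pre (N q : ℕ) : Type :=
  (Polar × ℂ) ⊕ (Fin N × Polar × Polar) ⊕ (Polar × Polar) ⊕ (Fin q × Polar × Polar) ⊕ (Polar × ℂ)

section charts

variable {N q : ℕ}

def base (t : Polar) (x : ℂ) : Pre N q := .inl (t, x)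
def crossing (k : Fin N) (u v : Polar) : Pre N q := .inr (.inl (k, u, v))
def endChart (t v : Polar) : Pre N q := .inr (.inr (.inl (t, v)))
def branch (s : Fin q) (u v : Polar) : Pre N q := .inr (.inr (.inr (.inl (s, u, v))))
def branchEnd (t : Polar) (z : ℂ) : Pre N q := .inr (.inr (.inr (.inr (t, z))))

/-- The coordinate `t` in polar form. -/
noncomputable def tPolar : Pre N q → Polar
  | .inl (t, _) => t
  | .inr (.inl (_, u, v)) => u * v
  | .inr (.inr (.inl (t, _))) => t
  | .inr (.inr (.inr (.inl (_, u, v)))) => u * v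
  | .inr (.inr (.inr (.inr (t, _)))) => t

/-- The coordinate `t`. -/
noncomputable def tCoord (p : Pre N q) : ℂ := toC (tPolar p)

/-- The absolute value of the equation of the divisor `D` in the chart. -/
noncomputable def divisorEq : Pre N q → ℝ≥0
  | .inl (t, _) => t.1
  | .inr (.inl (_, u, v)) => u.1 * v.1
  | .inr (.inr (.inl (t, v))) => t.1 * v.1
  | .inr (.inr (.inr (.inl (_, u, v)))) => u.1 * v.1
  | .inr (.inr (.inr (.inr (t, _)))) => t.1

/-- The function `x = 1 / y`, meaningful off the divisor `D`. -/
noncomputable def xCoord (μ : ℂ → ℂ) : Pre N q → ℂ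
  | .inl (_, x) => x
  | .inr (.inl (k, u, v)) => (toC u ^ (k : ℕ) * toC v ^ ((k : ℕ) + 1))⁻¹
  | .inr (.inr (.inl (t, v))) => (toC t ^ N * toC v)⁻¹
  | .inr (.inr (.inr (.inl (s, u, v)))) =>
      (μ (toC (u * v)) + toC u ^ (s : ℕ) * toC v ^ ((s : ℕ) + 1)) / toC (u * v) ^ q
  | .inr (.inr (.inr (.inr (t, z)))) => (μ (toC t) + toC t ^ q * z) / toC t ^ q

/-- The domains of the charts: `t` lies in the disc `Δ` of radius `R`; from the first three kinds of
charts the centre `t = 0`, `w = μ 0` on `E q` is removed if `1 ≤ q`; on the branch charts (absent if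
`q = 0`) one has `w ≠ 0`. -/
def InChart (R : ℝ) (μ : ℂ → ℂ) : Pre N q → Prop
  | .inl (t, _) => (t.1 : ℝ) < R
  | .inr (.inl (k, u, v)) => ((u.1 * v.1 : ℝ≥0) : ℝ) < R ∧
      ¬ (1 ≤ q ∧ (k : ℕ) + 1 = q ∧ v.1 = 0 ∧ toC u = μ 0) ∧
      ¬ (1 ≤ q ∧ (k : ℕ) = q ∧ u.1 = 0 ∧ toC v * μ 0 = 1)
  | .inr (.inr (.inl (t, v))) => (t.1 : ℝ) < R ∧
      ¬ (1 ≤ q ∧ N = q ∧ t.1 = 0 ∧ toC v * μ 0 = 1)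
  | .inr (.inr (.inr (.inl (s, u, v)))) => ((u.1 * v.1 : ℝ≥0) : ℝ) < R ∧
      μ (toC (u * v)) + toC u ^ (s : ℕ) * toC v ^ ((s : ℕ) + 1) ≠ 0
  | .inr (.inr (.inr (.inr (t, z)))) => 1 ≤ q ∧ (t.1 : ℝ) < R ∧
      μ (toC t) + toC t ^ q * z ≠ 0

/-- The point near `E k` with coordinates `t` and `v = y / t ^ k ≠ 0, ∞`. -/
noncomputable def nearE (k : ℕ) (t v : Polar) : Pre N q :=
  if h : k < N then crossing ⟨k, h⟩ (t / v) v else endChart t v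

/-- The point near `E' s` with coordinates `t` and `z = (w - μ t) / t ^ s ≠ 0, ∞`. -/
noncomputable def nearE' (s : ℕ) (t z : Polar) : Pre N q :=
  if h : s < q then branch ⟨s, h⟩ (t / z) z else branchEnd t (toC z)

/-- The coordinate changes between the charts. -/
inductive Glue (μ : ℂ → ℂ) : Pre N q → Pre N q → Prop
  | base (t : Polar) (x : ℂ) (v : Polar) (hv : toC v * x = 1) :
      Glue μ (base t x) (nearE 0 t v)
  | crossing (k : Fin N) (u v : Polar) (hu : u.1 ≠ 0) :
      Glue μ (crossing k u v) (nearE ((k : ℕ) + 1) (u * v) u⁻¹)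
  | branch (s : Fin q) (u v : Polar) (hu : u.1 ≠ 0) :
      Glue μ (branch s u v) (nearE' ((s : ℕ) + 1) (u * v) u⁻¹)
  | branch_main (s : Fin q) (u v c : Polar)
      (h : u.1 * v.1 ≠ 0 ∨ toC u ^ (s : ℕ) * toC v ^ ((s : ℕ) + 1) ≠ 0)
      (hc : toC c * (μ (toC (u * v)) + toC u ^ (s : ℕ) * toC v ^ ((s : ℕ) + 1)) = 1) :
      Glue μ (branch s u v) (nearE q (u * v) c)
  | branchEnd_main (t : Polar) (z : ℂ) (c : Polar) (h : t.1 ≠ 0)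
      (hc : toC c * (μ (toC t) + toC t ^ q * z) = 1) :
      Glue μ (branchEnd t z) (nearE q t c)

theorem fst_ne_zero_of_toC_mul {c : Polar} {w : ℂ} (h : toC c * w = 1) : c.1 ≠ 0 := by
  intro h0
  simp [toC, h0] at h

theorem polar_div_mul (t : Polar) {v : Polar} (hv : v.1 ≠ 0) : t / v * v = t := by
  ext
  · simp [hv]
  · simp

theorem tPolar_nearE (k : ℕ) (t : Polar) {v : Polar} (hv : v.1 ≠ 0) :
    tPolar (nearE k t v : Pre N q) = t := by
  unfold nearE
  split_ifs
  · exact polar_div_mul t hv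
  · rfl

theorem tPolar_nearE' (s : ℕ) (t : Polar) {z : Polar} (hz : z.1 ≠ 0) :
    tPolar (nearE' s t z : Pre N q) = t := by
  unfold nearE'
  split_ifs
  · exact polar_div_mul t hz
  · rfl

theorem Glue.tPolar_eq {μ : ℂ → ℂ} {p p' : Pre N q} (h : Glue μ p p') :
    tPolar p = tPolar p' := by
  cases h with
  | base t x v hv => exact (tPolar_nearE 0 t (fst_ne_zero_of_toC_mul hv)).symm
  | crossing k u v hu => exact (tPolar_nearE _ (u * v) (v := u⁻¹) (inv_ne_zero hu)).symm
  | branch s u v hu => exact (tPolar_nearE' _ (u * v) (z := u⁻¹) (inv_ne_zero hu)).symm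
  | branch_main s u v c h hc =>
      exact (tPolar_nearE q (u * v) (fst_ne_zero_of_toC_mul hc)).symm
  | branchEnd_main t z c h hc => exact (tPolar_nearE q t (fst_ne_zero_of_toC_mul hc)).symm

end charts

section space

variable (R : ℝ) (N q : ℕ) (μ : ℂ → ℂ)

/-- The real oriented blow-up of `Z` along `D`: its charts glued by the coordinate changes, with
the quotient topology. -/
def BlowUp : Type :=
  Quot (fun p p' : {p : Pre N q // InChart R μ p} => Glue μ p.1 p'.1)

instance : TopologicalSpace (BlowUp R N q μ) :=
  inferInstanceAs (TopologicalSpace (Quot _))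

variable {R N q μ}

/-- The point of the real blow-up with given coordinates in a chart. -/
def BlowUp.mk (p : {p : Pre N q // InChart R μ p}) : BlowUp R N q μ := Quot.mk _ p

/-- The projection of the real blow-up of `Z` to the real blow-up of the `t`-plane at `0`. -/
noncomputable def BlowUp.proj : BlowUp R N q μ → Polar :=
  Quot.lift (fun p => tPolar p.1) (fun _ _ h => Glue.tPolar_eq h)

variable (R N q μ)

/-- The fibre over the direction `ϑ` at `t = 0`. -/
def fibre (ϑ : Circle) : Set (BlowUp R N q μ) := {ζ | ζ.proj = (0, ϑ)}

/-- `exp (1 / y - ψ)`, `ψ = μ t / t ^ q`, has moderate growth along `D` near `ζ`: in a chart around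
`ζ`, off `D`, it is bounded by a power of the inverse of the equation of `D`. -/
def ModerateAt (ζ : BlowUp R N q μ) : Prop :=
  ∃ p : {p : Pre N q // InChart R μ p}, BlowUp.mk p = ζ ∧
    ∃ (C : ℝ) (M : ℕ), ∀ᶠ p' in nhds p, divisorEq p'.1 ≠ 0 →
      ‖Complex.exp (xCoord μ p'.1 - μ (tCoord p'.1) / tCoord p'.1 ^ q)‖ ≤
        C * ((divisorEq p'.1 : ℝ)⁻¹) ^ M

/-- The set `B`: points of the fibre over `ϑ` near which `exp (1 / y - ψ)` is of moderate growth. -/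
def moderateSet (ϑ : Circle) : Set (BlowUp R N q μ) :=
  {ζ ∈ fibre R N q μ ϑ | ModerateAt R N q μ ζ}

/-- The strict transform in the real blow-up of the curve with equation `S t x`, `x = 1 / y`: the closure
of its part outside `D`. -/
def strictTransform (S : ℂ → ℂ → Prop) : Set (BlowUp R N q μ) :=
  closure {ζ | ∃ p : {p : Pre N q // InChart R μ p}, BlowUp.mk p = ζ ∧ divisorEq p.1 ≠ 0 ∧
    S (tCoord p.1) (xCoord μ p.1)}

/-- The marked points in the fibre over `ϑ`: its intersections with the strict transforms of the
curves `S i : m i (t) y = t ^ d i` and `S' j : x = h j (t)`. -/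
def markedPoints {I J : Type*} (d : I → ℕ) (m : I → ℂ → ℂ) (h : J → ℂ → ℂ) (ϑ : Circle) :
    Set (BlowUp R N q μ) :=
  fibre R N q μ ϑ ∩
    ((⋃ i, strictTransform R N q μ (fun t x => m i t = t ^ d i * x)) ∪
      ⋃ j, strictTransform R N q μ (fun t x => x = h j t))

end space

end StokesFibre

/-! The plan is to draw the fibre in the plane. Compactify `ℂ` by a circle of directions through `z
↦ z / (1 + |z|)` (`th`). In this compactification every function `x t ^ k` with `0 ≤ k ≤ N` extends
continuously to the real blow-up. At a point of `E j` with coordinate `v = y / t ^ j` over the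
direction `ϑ`, the value of `x t ^ k` is infinite for `k < j`, equal to `1 / v` for `k = j` and `0`
for `k > j`. After multiplication by `ϑ ^ (-k)` all non-zero values have the same direction, so
their sum `BlowUp.psi` puts `E j` onto the annulus `j ≤ |z| ≤ j + 1`. If `ψ = 0`, the fibre thus
becomes the closed disc of radius `N + 1`.

If `ψ ≠ 0`, put `m = μ 0 / ϑ ^ q`. Then `psi` collapses the curves over `w = μ 0` to one point. The
same construction with `x' = x - ψ` gives `BlowUp.psi'`, because on those curves `x'` has the shape
which `x` has on the first ones. In turn, `psi'` collapses everything below `E q`, is `W ↦ W - m` on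
the common part `E q` in the coordinate `W` of `1 / (v ϑ ^ q)`, and agrees with `psi` beyond `E q`.
The pair separates the points of a fibre (`fibre_injective`).

The function `exp x'` is of moderate growth near a point exactly when the compactified `x'` is
finite there or is an infinite point with negative real part. An infinite point with real part `0`
fails, because a small rotation makes the real part positive. Hence `B` is the preimage under `psi'`
of the union `discHalf` of the open unit disc and the open left half plane (`mem_moderateSet_iff`).

It follows that `B` is homeomorphic to the intersection of `discHalf` with the closed disc of radius
`N + 1`. For `ψ = 0` the map is `psi`. For `m.re ≤ 0` it is `psi'`, since the part which it
collapses lies outside `B`. For `0 < m.re` the collapsed disc lies in `B`, and `psi'` is modified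
there so that the disc is spread out again (`isFreeSpace_of_re_pos`). Since the fibre is compact
(`isCompact_fibre`), these continuous bijections are homeomorphisms.

Each marked curve is a graph `x = X t`, so `psi` has a limit along it in each direction; where `psi`
does not separate points, `psi'` does. So each curve meets the fibre in at most one point, and this
point stays off the outer circle (`markedPoints_finite`).

It remains to remove finitely many interior points from a star-shaped region
(`RadialCuts.free_of_starConvex`). Cut along the rays which run outwards from the points. The slit
region is star-shaped, and thin cones around the pieces of the rays restore what was removed. A
covering with fibre the free group, whose sheets are permuted at each cut by left multiplication
with a generator, shows that the loops through the cuts satisfy no relation; that they generate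
follows by subdividing paths (`CutCover.free`). -/

open Topology

/-! ### Homotopy classes of paths inside a subset -/

section PathClasses

variable {X : Type*} [TopologicalSpace X]

/-- The homotopy class of a path which stays in `S`. -/
def IsClassIn (S : Set X) {x y : X} (σ : Path.Homotopic.Quotient x y) : Prop :=
  ∃ p : Path x y, (∀ t, p t ∈ S) ∧ Path.Homotopic.Quotient.mk p = σ

theorem IsClassIn.mono {S T : Set X} (h : S ⊆ T) {x y : X} {σ : Path.Homotopic.Quotient x y}
    (hσ : IsClassIn S σ) : IsClassIn T σ := by
  obtain ⟨p, hp, rfl⟩ := hσ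
  exact ⟨p, fun t => h (hp t), rfl⟩

theorem IsClassIn.trans {S : Set X} {x y z : X} {σ : Path.Homotopic.Quotient x y}
    {τ : Path.Homotopic.Quotient y z} (hσ : IsClassIn S σ) (hτ : IsClassIn S τ) :
    IsClassIn S (σ.trans τ) := by
  obtain ⟨p, hp, rfl⟩ := hσ
  obtain ⟨r, hr, rfl⟩ := hτ
  refine ⟨p.trans r, fun t => ?_, rfl⟩
  have : p.trans r t ∈ Set.range (p.trans r) := ⟨t, rfl⟩
  rw [Path.trans_range] at this
  rcases this with ⟨s, hs⟩ | ⟨s, hs⟩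
  · exact hs ▸ hp s
  · exact hs ▸ hr s

namespace Path.Homotopic.Quotient

theorem symm_trans_cancel_left {x y z : X} (σ : Path.Homotopic.Quotient x y)
    (τ : Path.Homotopic.Quotient y z) : σ.symm.trans (σ.trans τ) = τ := by
  rw [← trans_assoc, symm_trans, refl_trans]

theorem symm_trans_rev {x y z : X} (σ : Path.Homotopic.Quotient x y)
    (τ : Path.Homotopic.Quotient y z) : (σ.trans τ).symm = τ.symm.trans σ.symm := by
  induction σ with | mk p =>
  induction τ with | mk r =>
  rw [← mk_trans, ← mk_symm, Path.trans_symm, mk_trans, mk_symm, mk_symm]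

theorem symm_symm' {x y : X} (σ : Path.Homotopic.Quotient x y) : σ.symm.symm = σ := by
  induction σ with | mk p =>
  rw [← mk_symm, ← mk_symm, Path.symm_symm]

end Path.Homotopic.Quotient

/-- Both paths can be restricted to the subspace, where they are homotopic; the inclusion carries
the homotopy back to `X`. -/
theorem IsSimplyConnected.class_eq {S : Set X} (hS : IsSimplyConnected S) {x y : X}
    {σ τ : Path.Homotopic.Quotient x y} (hσ : IsClassIn S σ) (hτ : IsClassIn S τ) : σ = τ := by
  obtain ⟨p, hp, rfl⟩ := hσ
  obtain ⟨r, hr, rfl⟩ := hτ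
  have := hS.simplyConnectedSpace
  have hx : x ∈ S := by simpa using hp 0
  have hy : y ∈ S := by simpa using hp 1
  let p' : Path (⟨x, hx⟩ : S) ⟨y, hy⟩ :=
    ⟨⟨fun t => ⟨p t, hp t⟩, by fun_prop⟩, by simp, by simp⟩
  let r' : Path (⟨x, hx⟩ : S) ⟨y, hy⟩ :=
    ⟨⟨fun t => ⟨r t, hr t⟩, by fun_prop⟩, by simp, by simp⟩
  have h := (SimplyConnectedSpace.paths_homotopic p' r').map
    (⟨Subtype.val, continuous_subtype_val⟩ : C(S, X))
  exact Path.Homotopic.Quotient.eq.2 h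

theorem IsPathConnected.exists_isClassIn {S : Set X} (hS : IsPathConnected S) {x y : X}
    (hx : x ∈ S) (hy : y ∈ S) : ∃ σ : Path.Homotopic.Quotient x y, IsClassIn S σ := by
  obtain ⟨p, hp⟩ := hS.joinedIn x hx y hy
  exact ⟨_, p, hp, rfl⟩

/-- A property of homotopy classes of paths which is stable under composition holds in general if
it holds for the paths inside the members of an open cover. -/
theorem Path.Homotopic.Quotient.induction_cover {ι : Type*} {U : ι → Set X}
    (hU : ∀ i, IsOpen (U i)) (hcov : ∀ x, ∃ i, x ∈ U i)
    {Q : ∀ {x y : X}, Path.Homotopic.Quotient x y → Prop}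
    (htrans : ∀ {x y z : X} (σ : Path.Homotopic.Quotient x y) (τ : Path.Homotopic.Quotient y z),
      Q σ → Q τ → Q (σ.trans τ))
    (hloc : ∀ i {x y : X} (σ : Path.Homotopic.Quotient x y), IsClassIn (U i) σ → Q σ)
    {x y : X} (σ : Path.Homotopic.Quotient x y) : Q σ := by
  obtain ⟨γ, rfl⟩ := Path.Homotopic.Quotient.mk_surjective σ
  obtain ⟨t, ht0, htm, ⟨n, hn⟩, ht⟩ := exists_monotone_Icc_subset_open_cover_unitInterval
    (c := fun i => γ ⁻¹' U i) (fun i => (hU i).preimage γ.continuous)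
    (fun s _ => by simpa using hcov (γ s))
  -- The subdivision is fine enough for each piece to lie in one member of the cover, and it is
  -- eventually constant with value `1`. The induction runs over initial pieces of `γ`.
  have key : ∀ k, Q (Path.Homotopic.Quotient.mk (γ.subpath (t 0) (t k))) := by
    intro k
    induction k with
    | zero =>
      obtain ⟨i, hi⟩ := ht 0
      refine hloc i _ ⟨_, fun s => ?_, rfl⟩
      rw [Path.subpath_self]
      exact hi ⟨le_rfl, htm (Nat.zero_le _)⟩
    | succ k ih =>
      rw [← Path.Homotopic.Quotient.eq.2 ⟨Path.Homotopy.subpathTransSubpath γ (t 0) (t k) (t (k+1))⟩,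
        Path.Homotopic.Quotient.mk_trans]
      refine htrans _ _ ih ?_
      obtain ⟨i, hi⟩ := ht k
      refine hloc i _ ⟨_, fun s => ?_, rfl⟩
      have : γ.subpath (t k) (t (k+1)) s ∈ Set.range (γ.subpath (t k) (t (k+1))) := ⟨s, rfl⟩
      rw [Path.range_subpath_of_le _ _ _ (htm (Nat.le_succ k))] at this
      obtain ⟨s', hs', hs''⟩ := this
      rw [← hs'']
      exact hi hs'
  have h1 := key n
  rw [hn n le_rfl, ht0, Path.subpath_zero_one] at h1
  -- The subpath over the whole interval is a cast of `γ`, with endpoints `γ 0` and `γ 1` in place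
  -- of `x` and `y`.
  have hcast : ∀ {a b : X} (ha : a = x) (hb : b = y),
      Q (Path.Homotopic.Quotient.mk (γ.cast ha hb)) → Q (Path.Homotopic.Quotient.mk γ) := by
    rintro a b rfl rfl h
    exact h
  exact hcast _ _ h1

end PathClasses

/-! ### Free fundamental groups from cuts -/

section Cuts

variable {X ι : Type*} [TopologicalSpace X]

/-- An open cover of `X` by a set `A` and disjoint sets `C i`, where `A ∩ C i` is the disjoint union
of the two open sets `L i` and `R i`. -/
structure CutCover (A : Set X) (C L R : ι → Set X) : Prop where
  openA : IsOpen A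
  openC : ∀ i, IsOpen (C i)
  openL : ∀ i, IsOpen (L i)
  openR : ∀ i, IsOpen (R i)
  cover : ∀ x, x ∈ A ∨ ∃ i, x ∈ C i
  disj : ∀ i j x, x ∈ C i → x ∈ C j → i = j
  inter : ∀ i, A ∩ C i = L i ∪ R i
  disjLR : ∀ i, Disjoint (L i) (R i)

namespace CutCover

variable {A : Set X} {C L R : ι → Set X}

theorem L_subset (h : CutCover A C L R) (i : ι) : L i ⊆ A ∩ C i := by
  rw [h.inter]; exact Set.subset_union_left

theorem R_subset (h : CutCover A C L R) (i : ι) : R i ⊆ A ∩ C i := by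
  rw [h.inter]; exact Set.subset_union_right

/-- The generator `i` on `R i`, and `1` elsewhere. -/
noncomputable def jump (R : ι → Set X) (i : ι) (x : X) : FreeGroup ι :=
  open Classical in if x ∈ R i then FreeGroup.of i else 1

/-- Over `A ∩ C i` the sets `L i` and `R i` are open, disjoint and exhaustive. This local constancy
makes the transition functions continuous. -/
theorem jump_eventually (h : CutCover A C L R) (i : ι) {x : X} (hx : x ∈ A ∩ C i) :
    ∀ᶠ y in 𝓝 x, jump R i y = jump R i x := by
  have hx' := hx
  rw [h.inter] at hx'
  rcases hx' with hx' | hx'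
  · filter_upwards [(h.openL i).mem_nhds hx'] with y hy
    simp [jump, (h.disjLR i).notMem_of_mem_left hx', (h.disjLR i).notMem_of_mem_left hy]
  · filter_upwards [(h.openR i).mem_nhds hx'] with y hy
    simp [jump, hx', hy]

/-- The transition functions of the covering of `X` with fibre `FreeGroup ι` which is trivial over
`A` and over the `C i`, with transition `i` on `R i`. -/
noncomputable def change (R : ι → Set X) : Option ι → Option ι → X → FreeGroup ι → FreeGroup ι
  | none, none, _, v => v
  | none, some i, x, v => (jump R i x)⁻¹ * v
  | some i, none, x, v => jump R i x * v
  | some _, some _, _, v => v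

/-- The members of the cover. -/
def piece (A : Set X) (C : ι → Set X) : Option ι → Set X
  | none => A
  | some i => C i

-- With a discrete fibre the bundle built below is a covering.
local instance : TopologicalSpace (FreeGroup ι) := ⊥
local instance : DiscreteTopology (FreeGroup ι) := ⟨rfl⟩

theorem continuousOn_of_locally_left {s : Set X} {f : X → FreeGroup ι → FreeGroup ι}
    (h : ∀ x ∈ s, ∀ᶠ y in 𝓝 x, f y = f x) :
    ContinuousOn (fun p : X × FreeGroup ι => f p.1 p.2) (s ×ˢ Set.univ) := by
  rintro ⟨x, v⟩ ⟨hx, -⟩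
  refine ContinuousAt.continuousWithinAt ?_
  have h1 : ∀ᶠ p : X × FreeGroup ι in 𝓝 (x, v), f p.1 p.2 = f x v := by
    rw [nhds_prod_eq]
    have hv : ∀ᶠ w in 𝓝 v, w = v := by simp [nhds_discrete]
    filter_upwards [(h x hx).prod_mk hv] with p hp
    rw [hp.1, hp.2]
  exact (tendsto_const_nhds (x := f x v)).congr' (h1.mono fun p hp => hp.symm)

/-- The covering of `X` with fibre `FreeGroup ι` attached to the cuts. -/
noncomputable def core (h : CutCover A C L R) : FiberBundleCore (Option ι) X (FreeGroup ι) where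
  baseSet := piece A C
  isOpen_baseSet i := by
    cases i with
    | none => exact h.openA
    | some i => exact h.openC i
  indexAt x := open Classical in
    if hx : ∃ i, x ∈ C i then some hx.choose else none
  mem_baseSet_at x := by
    split_ifs with hx
    · exact hx.choose_spec
    · exact (h.cover x).resolve_right hx
  coordChange := change R
  coordChange_self i x hx v := by cases i <;> rfl
  continuousOn_coordChange i j := by
    refine continuousOn_of_locally_left (f := change R i j) ?_
    rintro x ⟨hi, hj⟩
    cases i with
    | none =>
      cases j with
      | none => exact .of_forall fun _ => rfl
      | some j =>
        filter_upwards [h.jump_eventually j ⟨hi, hj⟩] with y hy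
        funext v
        simp [change, hy]
    | some i =>
      cases j with
      | none =>
        filter_upwards [h.jump_eventually i ⟨hj, hi⟩] with y hy
        funext v
        simp [change, hy]
      | some j => exact .of_forall fun _ => rfl
  coordChange_comp i j k x hx v := by
    obtain ⟨⟨hi, hj⟩, hk⟩ := hx
    -- Two different sets `C i` are disjoint, so at most one cut is involved at `x`, and the cocycle
    -- condition reduces to cancelling a jump against its inverse.
    rcases i with _ | i <;> rcases j with _ | j <;> rcases k with _ | k <;>
      simp only [change, mul_inv_cancel_left]
    · rw [h.disj j k x hj hk]
    · rw [h.disj i k x hi hk]; simp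
    · rw [h.disj i j x hi hj]

variable (h : CutCover A C L R)

theorem isCoveringMap_core : IsCoveringMap h.core.proj :=
  FiberBundle.isCoveringMap (F := FreeGroup ι) (E := h.core.Fiber)

/-- The point over `x` with coordinate `v` in the trivialization over the piece `o`. -/
noncomputable def pt (o : Option ι) (x : X) (v : FreeGroup ι) : h.core.proj ⁻¹' {x} :=
  ⟨⟨x, h.core.coordChange o (h.core.indexAt x) x v⟩, rfl⟩

theorem pt_injective {o : Option ι} {x : X} (hx : x ∈ piece A C o) :
    Function.Injective (h.pt o x) := by
  intro v w hvw
  have h1 : h.core.coordChange o (h.core.indexAt x) x v =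
      h.core.coordChange o (h.core.indexAt x) x w := by
    have := congrArg Subtype.val hvw
    simp only [pt] at this
    exact eq_of_heq (Bundle.TotalSpace.mk.inj this).2
  have h2 := congrArg (h.core.coordChange (h.core.indexAt x) o x) h1
  rwa [h.core.coordChange_comp _ _ _ x ⟨⟨hx, h.core.mem_baseSet_at x⟩, hx⟩,
    h.core.coordChange_comp _ _ _ x ⟨⟨hx, h.core.mem_baseSet_at x⟩, hx⟩,
    h.core.coordChange_self _ x hx, h.core.coordChange_self _ x hx] at h2

theorem pt_change {o o' : Option ι} {x : X} (hx : x ∈ piece A C o) (hx' : x ∈ piece A C o')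
    (v : FreeGroup ι) : h.pt o' x (change R o o' x v) = h.pt o x v := by
  refine Subtype.ext ?_
  simp only [pt]
  congr 1
  exact h.core.coordChange_comp _ _ _ x ⟨⟨hx, hx'⟩, h.core.mem_baseSet_at x⟩ v

/-- Over one piece the points with constant coordinate `v` form a continuous lift of the path. Lifts
are unique, so the coordinate changes only when the piece is changed. -/
theorem monodromy_pt {o : Option ι} {x y : X} {σ : Path.Homotopic.Quotient x y}
    (hσ : IsClassIn (piece A C o) σ) (v : FreeGroup ι) :
    h.isCoveringMap_core.monodromy σ (h.pt o x v) = h.pt o y v := by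
  obtain ⟨p, hp, rfl⟩ := hσ
  have hcont : Continuous fun t : unitInterval => (h.pt o (p t) v : h.core.TotalSpace) := by
    have h1 : Continuous fun t : unitInterval => (h.core.localTriv o).toOpenPartialHomeomorph.symm (p t, v) := by
      refine (h.core.localTriv o).toOpenPartialHomeomorph.continuousOn_symm.comp_continuous
        (by fun_prop) (fun t => ?_)
      rw [(h.core.localTriv o).target_eq]
      exact ⟨hp t, trivial⟩
    exact h1
  have hpt : ∀ {x' y' : X}, x' = y' →
      (h.pt o x' v : h.core.TotalSpace) = h.pt o y' v := by
    rintro x' y' rfl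
    rfl
  refine Subtype.ext ?_
  have := (h.isCoveringMap_core.eq_liftPath_iff' (γ := (p : C(unitInterval, X))) (e := (h.pt o x v).1)
    (γ_0 := p.source.trans (h.pt o x v).2.symm)
    (Γ := ⟨fun t => (h.pt o (p t) v : h.core.TotalSpace), hcont⟩)).2
    ⟨rfl, hpt p.source⟩
  have h2 := congrArg (fun f : C(unitInterval, h.core.TotalSpace) => f 1) this
  exact h2.symm.trans (hpt p.target)

-- The loop `ℓ i` goes through `A` to `L i`, crosses `C i` to `R i` and returns through `A`. The `ℓ
-- i` are free generators. There is no relation, because the monodromy of `φ w` multiplies the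
-- coordinate by `w` from the left. They generate, because reference paths `κ x` turn every path
-- from `x` to `y` into a loop at `b`, and the cover induction shows that this loop lies in the
-- image of `φ`.
open Path.Homotopic.Quotient in
theorem nonempty_mulEquiv_of_mem (h : CutCover A C L R) (hA : IsSimplyConnected A) (hC : ∀ i, IsSimplyConnected (C i))
    (hL : ∀ i, IsPathConnected (L i)) (hR : ∀ i, IsPathConnected (R i)) {b : X} (hb : b ∈ A) :
    Nonempty (FreeGroup ι ≃* FundamentalGroup X b) := by
  choose yL hyL using fun i => (hL i).nonempty
  choose yR hyR using fun i => (hR i).nonempty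
  have hyLA := fun i => (h.L_subset i (hyL i)).1
  have hyLC := fun i => (h.L_subset i (hyL i)).2
  have hyRA := fun i => (h.R_subset i (hyR i)).1
  have hyRC := fun i => (h.R_subset i (hyR i)).2
  choose aL haL using fun i => hA.isPathConnected.exists_isClassIn hb (hyLA i)
  choose aR haR using fun i => hA.isPathConnected.exists_isClassIn (hyRA i) hb
  choose c hc using fun i => (hC i).isPathConnected.exists_isClassIn (hyLC i) (hyRC i)
  let ℓ : ι → FundamentalGroup X b := fun i => ((aL i).trans (c i)).trans (aR i)
  let φ : FreeGroup ι →* FundamentalGroup X b := FreeGroup.lift ℓ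
  -- Entering `C i` over `L i` leaves the coordinate alone; leaving it over `R i` multiplies by the
  -- generator.
  have hgen : ∀ i v, h.isCoveringMap_core.monodromyPerm b (ℓ i) (h.pt none b v) =
      h.pt none b (FreeGroup.of i * v) := by
    intro i v
    have e1 : h.isCoveringMap_core.monodromyPerm b (ℓ i) (h.pt none b v) =
      h.isCoveringMap_core.monodromy (((aL i).trans (c i)).trans (aR i)) (h.pt none b v) := rfl
    rw [e1, h.isCoveringMap_core.monodromy_trans_apply, h.isCoveringMap_core.monodromy_trans_apply,
      h.monodromy_pt (o := none) (haL i)]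
    have j1 : jump R i (yL i) = 1 := by
      simp [jump, (h.disjLR i).notMem_of_mem_left (hyL i)]
    have j2 : jump R i (yR i) = FreeGroup.of i := by
      simp [jump, hyR i]
    rw [← h.pt_change (o := none) (o' := some i) (hyLA i) (hyLC i),
      h.monodromy_pt (o := some i) (hc i),
      ← h.pt_change (o := some i) (o' := none) (hyRC i) (hyRA i), h.monodromy_pt (o := none) (haR i)]
    simp [change, j1, j2]
  have hact : ∀ w v, h.isCoveringMap_core.monodromyPerm b (φ w) (h.pt none b v) =
      h.pt none b (w * v) := by
    intro w
    induction w using FreeGroup.induction_on with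
    | C1 => intro v; rw [map_one, map_one, Equiv.Perm.one_apply, one_mul]
    | of i => intro v; simpa [φ] using hgen i v
    | inv_of i _ =>
      intro v
      rw [map_inv, map_inv, Equiv.Perm.inv_eq_iff_eq]
      have := hgen i ((FreeGroup.of i)⁻¹ * v)
      simpa [φ] using this.symm
    | mul x y hx hy =>
      intro v
      rw [map_mul, map_mul, Equiv.Perm.mul_apply, hy, hx, mul_assoc]
  have hinj : Function.Injective φ := by
    rw [injective_iff_map_eq_one]
    intro w hw
    have := hact w 1
    rw [hw, map_one, Equiv.Perm.one_apply, mul_one] at this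
    exact (h.pt_injective (o := none) hb this).symm
  -- The reference path stays in `A` if it can, and otherwise enters the cut from the `L` side. With
  -- this choice it picks up no generator.
  have hkap : ∀ x, ∃ κ : Path.Homotopic.Quotient b x, (x ∈ A → IsClassIn A κ) ∧
      (x ∉ A → ∀ i, x ∈ C i → ∃ τ : Path.Homotopic.Quotient (yL i) x,
        IsClassIn (C i) τ ∧ κ = (aL i).trans τ) := by
    intro x
    by_cases hx : x ∈ A
    · obtain ⟨κ, hκ⟩ := hA.isPathConnected.exists_isClassIn hb hx
      exact ⟨κ, fun _ => hκ, fun h => absurd hx h⟩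
    · obtain ⟨i, hi⟩ := (h.cover x).resolve_left hx
      obtain ⟨τ, hτ⟩ := (hC i).isPathConnected.exists_isClassIn (hyLC i) hi
      refine ⟨(aL i).trans τ, fun h => absurd h hx, fun _ j hj => ?_⟩
      obtain rfl := h.disj i j x hi hj
      exact ⟨τ, hτ, rfl⟩
  choose κ hκA hκC using hkap
  have hκb : κ b = Path.Homotopic.Quotient.refl b :=
    hA.class_eq (hκA b hb) ⟨Path.refl b, fun _ => hb, rfl⟩
  -- Compared with the reference path, entering `C i` from `L i` gives the generator if the path
  -- ends in `R i`, and the trivial loop otherwise.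
  have key : ∀ i {x : X} (τ : Path.Homotopic.Quotient (yL i) x), x ∈ C i → IsClassIn (C i) τ →
      FundamentalGroup.fromPath (((aL i).trans τ).trans (κ x).symm) ∈ φ.range := by
    intro i x τ hx hτ
    by_cases hxA : x ∈ A
    · have hx' : x ∈ L i ∪ R i := by rw [← h.inter]; exact ⟨hxA, hx⟩
      rcases hx' with hx' | hx'
      · obtain ⟨ρ, hρ⟩ := (hL i).exists_isClassIn (hyL i) hx'
        have e1 : τ = ρ := (hC i).class_eq hτ (hρ.mono fun z hz => (h.L_subset i hz).2)
        have e2 : κ x = (aL i).trans ρ :=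
          hA.class_eq (hκA x hxA) ((haL i).trans (hρ.mono fun z hz => (h.L_subset i hz).1))
        rw [e1, e2, trans_symm]
        exact one_mem _
      · obtain ⟨ρ, hρ⟩ := (hR i).exists_isClassIn (hyR i) hx'
        have e1 : τ = (c i).trans ρ :=
          (hC i).class_eq hτ ((hc i).trans (hρ.mono fun z hz => (h.R_subset i hz).2))
        have e2 : ρ = (aR i).trans (κ x) :=
          hA.class_eq (hρ.mono fun z hz => (h.R_subset i hz).1) ((haR i).trans (hκA x hxA))
        refine ⟨FreeGroup.of i, ?_⟩
        rw [e1, e2]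
        simp only [φ, FreeGroup.lift_apply_of, ℓ]
        simp only [trans_assoc, trans_symm, trans_refl]
    · obtain ⟨τ', hτ', e⟩ := hκC x hxA i hx
      rw [e, (hC i).class_eq hτ hτ', trans_symm]
      exact one_mem _
  have hall : ∀ {x y : X} (σ : Path.Homotopic.Quotient x y),
      FundamentalGroup.fromPath (((κ x).trans σ).trans (κ y).symm) ∈ φ.range := by
    intro x y σ
    refine Path.Homotopic.Quotient.induction_cover (U := piece A C)
      (Q := fun {x y} σ => FundamentalGroup.fromPath (((κ x).trans σ).trans (κ y).symm) ∈ φ.range)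
      h.core.isOpen_baseSet ?_ ?_ ?_ σ
    · intro x
      exact ⟨_, h.core.mem_baseSet_at x⟩
    · intro x y z σ τ hσ hτ
      -- In a product in the fundamental group the right factor is traversed first.
      have := mul_mem hτ hσ
      rw [FundamentalGroup.mul_def] at this
      convert this using 1
      simp only [trans_assoc, symm_trans_cancel_left]
    · intro o x y σ hσ
      obtain ⟨p, hp, rfl⟩ := hσ
      have hx : x ∈ piece A C o := by simpa using hp 0
      have hy : y ∈ piece A C o := by simpa using hp 1
      cases o with
      | none =>
        rw [hA.class_eq (hκA y hy) ((hκA x hx).trans ⟨p, hp, rfl⟩), trans_symm]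
        exact one_mem _
      | some i =>
        obtain ⟨τ, hτ⟩ := (hC i).isPathConnected.exists_isClassIn (hyLC i) hx
        have h1 := key i τ hx hτ
        have h2 := key i _ hy (hτ.trans ⟨p, hp, rfl⟩)
        have := mul_mem h2 (inv_mem h1)
        rw [FundamentalGroup.mul_def, FundamentalGroup.inv_def] at this
        convert this using 1
        simp only [trans_assoc, symm_trans_rev, symm_symm', symm_trans_cancel_left]
  refine ⟨MulEquiv.ofBijective φ ⟨hinj, fun g => ?_⟩⟩
  have := hall (FundamentalGroup.toPath g)
  have hr : (Path.Homotopic.Quotient.refl b).symm = Path.Homotopic.Quotient.refl b := by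
    rw [← mk_refl, ← mk_symm, Path.refl_symm]
  rw [hκb, hr, refl_trans, trans_refl] at this
  exact this

/-- A space with a cut cover by simply connected pieces has a free fundamental group, with one
generator for each cut. -/
theorem free (h : CutCover A C L R) (hA : IsSimplyConnected A) (hC : ∀ i, IsSimplyConnected (C i))
    (hL : ∀ i, IsPathConnected (L i)) (hR : ∀ i, IsPathConnected (R i)) :
    PathConnectedSpace X ∧ ∀ b : X, Nonempty (FundamentalGroup X b ≃* FreeGroup ι) := by
  obtain ⟨a, ha⟩ := hA.nonempty
  have hj : ∀ x, Joined a x := by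
    intro x
    rcases h.cover x with hx | ⟨i, hx⟩
    · exact (hA.isPathConnected.joinedIn a ha x hx).joined
    · obtain ⟨y, hy⟩ := (hL i).nonempty
      have hy' := h.L_subset i hy
      exact (hA.isPathConnected.joinedIn a ha y hy'.1).joined.trans
        ((hC i).isPathConnected.joinedIn y hy'.2 x hx).joined
  have : PathConnectedSpace X := ⟨⟨a⟩, fun x y => (hj x).symm.trans (hj y)⟩
  refine ⟨this, fun b => ?_⟩
  obtain ⟨e⟩ := h.nonempty_mulEquiv_of_mem hA hC hL hR ha
  exact ⟨(FundamentalGroup.fundamentalGroupMulEquivOfPathConnected b a).trans e.symm⟩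

end CutCover

end Cuts

/-! ### A contractibility criterion -/

section Retraction

variable {E : Type*} [NormedAddCommGroup E] [NormedSpace ℝ E]

/-- A set which can be moved along segments in itself into a convex subset is contractible. -/
theorem contractibleSpace_of_segment_subset {S T : Set E} (hTS : T ⊆ S) (hT : Convex ℝ T)
    (hne : T.Nonempty) {f : E → E} (hf : ContinuousOn f S) (hfT : Set.MapsTo f S T)
    (hseg : ∀ x ∈ S, segment ℝ x (f x) ⊆ S) : ContractibleSpace S := by
  obtain ⟨c, hc⟩ := hne
  rw [contractible_iff_id_nullhomotopic]
  have hf' : Continuous fun x : S => f x := continuousOn_iff_continuous_domRestrict.1 hf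
  let f₁ : C(S, S) := ⟨fun x => ⟨f x, hTS (hfT x.2)⟩, hf'.subtype_mk _⟩
  let H₁ : ContinuousMap.Homotopy (ContinuousMap.id S) f₁ :=
    { toFun := fun p => ⟨AffineMap.lineMap (p.2 : E) (f p.2) (p.1 : ℝ),
        hseg _ p.2.2 (by
          rw [segment_eq_image_lineMap]
          exact ⟨_, p.1.2, rfl⟩)⟩
      continuous_toFun := by
        simp only [AffineMap.lineMap_apply_module]
        refine Continuous.subtype_mk ?_ _
        have h₁ : Continuous fun p : unitInterval × S => f p.2 := hf'.comp continuous_snd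
        have h₂ : Continuous fun p : unitInterval × S => (p.1 : ℝ) := by fun_prop
        exact ((continuous_const.sub h₂).smul (by fun_prop)).add (h₂.smul h₁)
      map_zero_left := fun x => by simp
      map_one_left := fun x => by simp [f₁] }
  let H₂ : ContinuousMap.Homotopy f₁ (ContinuousMap.const S ⟨c, hTS hc⟩) :=
    { toFun := fun p => ⟨AffineMap.lineMap (f p.2) c (p.1 : ℝ),
        hTS (hT.segment_subset (hfT p.2.2) hc (by
          rw [segment_eq_image_lineMap]
          exact ⟨_, p.1.2, rfl⟩))⟩
      continuous_toFun := by
        simp only [AffineMap.lineMap_apply_module]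
        refine Continuous.subtype_mk ?_ _
        have h₁ : Continuous fun p : unitInterval × S => f p.2 := hf'.comp continuous_snd
        have h₂ : Continuous fun p : unitInterval × S => (p.1 : ℝ) := by fun_prop
        exact ((continuous_const.sub h₂).smul h₁).add (h₂.smul continuous_const)
      map_zero_left := fun x => by simp [f₁]
      map_one_left := fun x => by simp }
  exact ⟨_, ⟨H₁.trans H₂⟩⟩

end Retraction

/-! ### Radial cuts of a star-shaped plane set -/

namespace RadialCuts

/-- The ray from `p` away from `0`. -/
def ray (p : ℂ) : Set ℂ := {z | (z / p).im = 0 ∧ 1 ≤ (z / p).re}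

/-- The cone around the part of the ray from `p` before the next point of `P`. -/
def cone (Y P : Set ℂ) (η : ℝ) (p : ℂ) : Set ℂ :=
  {z | z ∈ Y ∧ 1 < (z / p).re ∧ |(z / p).im| < η * (z / p).re ∧
    ∀ q ∈ P, (q / p).im = 0 → 1 < (q / p).re → (z / p).re < (q / p).re}

/-- The complement of the rays. -/
def slit (Y P : Set ℂ) : Set ℂ := {z | z ∈ Y ∧ ∀ p ∈ P, z ∉ ray p}

/-- The aperture `η` is small enough for the cones to be disjoint. -/
structure Small (Y P : Set ℂ) (η : ℝ) : Prop where
  pos : 0 < η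
  le : η ≤ 1 / 2
  angle : ∀ p ∈ P, ∀ q ∈ P, |(q / p).im| ≤ 3 * η * (q / p).re → (q / p).im = 0
  gap : ∀ p ∈ P, ∀ q ∈ P, 1 < (q / p).re → 1 + η < (q / p).re
  near : ∀ p ∈ P, ∀ w : ℂ, ‖w - 1‖ < 4 * η → w * p ∈ Y

/-- Each condition concerns finitely many points and holds for all small positive `η`. The factors
`3` and `4` are what `angle_le` and `contractible_cone` need. -/
theorem exists_small {Y P : Set ℂ} (hP : P.Finite) (hPY : P ⊆ interior Y) :
    ∃ η, Small Y P η := by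
  have h0 : Filter.Tendsto (fun η : ℝ => η) (𝓝[>] 0) (𝓝 0) := nhdsWithin_le_nhds
  have h1 : ∀ᶠ η : ℝ in 𝓝[>] 0, ∀ p ∈ P, ∀ q ∈ P,
      |(q / p).im| ≤ 3 * η * (q / p).re → (q / p).im = 0 := by
    rw [Filter.eventually_all_finite hP]
    intro p _
    rw [Filter.eventually_all_finite hP]
    intro q _
    by_cases hi : (q / p).im = 0
    · exact .of_forall fun _ _ => hi
    · have : Filter.Tendsto (fun η : ℝ => 3 * η * (q / p).re) (𝓝[>] 0) (𝓝 0) := by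
        simpa using (h0.const_mul 3).mul_const (q / p).re
      filter_upwards [this.eventually_lt_const (abs_pos.2 hi)] with η hη h
      exact absurd h (not_le.2 hη)
  have h2 : ∀ᶠ η : ℝ in 𝓝[>] 0, ∀ p ∈ P, ∀ q ∈ P, 1 < (q / p).re → 1 + η < (q / p).re := by
    rw [Filter.eventually_all_finite hP]
    intro p _
    rw [Filter.eventually_all_finite hP]
    intro q _
    by_cases hi : 1 < (q / p).re
    · have : Filter.Tendsto (fun η : ℝ => 1 + η) (𝓝[>] 0) (𝓝 1) := by
        simpa using h0.const_add 1
      filter_upwards [this.eventually_lt_const hi] with η hη _ using hη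
    · exact .of_forall fun _ h => absurd h hi
  have h3 : ∀ᶠ η : ℝ in 𝓝[>] 0, ∀ p ∈ P, ∀ w : ℂ, ‖w - 1‖ < 4 * η → w * p ∈ Y := by
    rw [Filter.eventually_all_finite hP]
    intro p hp
    have hY : Y ∈ 𝓝 ((1 : ℂ) * p) := by rw [one_mul]; exact mem_interior_iff_mem_nhds.1 (hPY hp)
    have hc : ContinuousAt (fun w : ℂ => w * p) 1 := by fun_prop
    obtain ⟨r, hr, hb⟩ := Metric.mem_nhds_iff.1 (hc hY)
    have : Filter.Tendsto (fun η : ℝ => 4 * η) (𝓝[>] 0) (𝓝 0) := by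
      simpa using h0.const_mul 4
    filter_upwards [this.eventually_lt_const hr] with η hη w hw
    exact hb (by rw [Metric.mem_ball, dist_eq_norm]; linarith)
  have h4 : ∀ᶠ η : ℝ in 𝓝[>] 0, η ≤ 1 / 2 := by
    filter_upwards [h0.eventually_lt_const (show (0 : ℝ) < 1 / 2 by norm_num)] with η hη using hη.le
  obtain ⟨η, h⟩ := (h1.and (h2.and (h3.and (h4.and self_mem_nhdsWithin)))).exists
  exact ⟨η, h.2.2.2.2, h.2.2.2.1, h.1, h.2.1, h.2.2.1⟩

/-- If `z` lies in the cones around `p` and `q`, the angle between `p` and `q` is small. -/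
theorem angle_le {η : ℝ} (h0 : 0 < η) (h1 : η ≤ 1 / 2) {r w : ℂ} (hw : |w.im| < η * w.re)
    (hrw : |(r * w).im| < η * (r * w).re) : |r.im| ≤ 3 * η * r.re ∧ 0 < r.re := by
  obtain ⟨a, b⟩ := r
  obtain ⟨x, y⟩ := w
  simp only [Complex.mul_im, Complex.mul_re] at *
  have hx : 0 < x := by
    have := (abs_nonneg y).trans_lt hw
    exact (pos_iff_pos_of_mul_pos this).1 h0
  have hX : 0 < a * x - b * y := by
    have := (abs_nonneg _).trans_lt hrw
    exact (pos_iff_pos_of_mul_pos this).1 h0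
  set X := a * x - b * y with hXd
  set V := a * y + b * x with hVd
  have hD : 0 < x ^ 2 + y ^ 2 := by positivity
  -- These are the real and imaginary parts of `r = (r * w) / w`, multiplied by `‖w‖ ^ 2`. Bounding
  -- the first below by `3/4 * (X * x)` and the second by `2 * η * (X * x)` gives slope at most `8/3
  -- * η`, hence the constant `3`.
  have eb : b * (x ^ 2 + y ^ 2) = V * x - X * y := by rw [hXd, hVd]; ring
  have ea : a * (x ^ 2 + y ^ 2) = X * x + V * y := by rw [hXd, hVd]; ring
  have hXx : 0 < X * x := mul_pos hX hx
  have e1 : |V * x| ≤ η * (X * x) := by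
    rw [abs_mul, abs_of_pos hx]
    nlinarith
  have e2 : |X * y| ≤ η * (X * x) := by
    rw [abs_mul, abs_of_pos hX]
    nlinarith
  have e3 : |V * y| ≤ 1 / 4 * (X * x) := by
    rw [abs_mul]
    have i1 : |V| ≤ 1 / 2 * X := by nlinarith
    have i2 : |y| ≤ 1 / 2 * x := by nlinarith
    have := mul_le_mul i1 i2 (abs_nonneg _) (by positivity)
    linarith
  have ha : 3 / 4 * (X * x) ≤ a * (x ^ 2 + y ^ 2) := by
    rw [ea]; linarith [neg_abs_le (V * y)]
  have hb : |b| * (x ^ 2 + y ^ 2) ≤ 2 * η * (X * x) := by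
    rw [← abs_of_pos hD, ← abs_mul, eb]
    exact (abs_sub _ _).trans (by linarith)
  constructor
  · refine le_of_mul_le_mul_right ?_ hD
    nlinarith
  · exact pos_of_mul_pos_left (b := x ^ 2 + y ^ 2) (by linarith) hD.le

variable {Y P : Set ℂ} {η : ℝ}

theorem isClosed_ray (p : ℂ) : IsClosed (ray p) := by
  have : Continuous fun z : ℂ => z / p := by fun_prop
  exact (isClosed_eq (Complex.continuous_im.comp this) continuous_const).inter
    (isClosed_le continuous_const (Complex.continuous_re.comp this))

theorem zero_notMem_ray (p : ℂ) : (0 : ℂ) ∉ ray p := by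
  simp [ray]

theorem smul_div_re (s : ℝ) (z p : ℂ) : ((s • z) / p).re = s * (z / p).re := by
  rw [smul_div_assoc, Complex.smul_re, smul_eq_mul]

theorem smul_div_im (s : ℝ) (z p : ℂ) : ((s • z) / p).im = s * (z / p).im := by
  rw [smul_div_assoc, Complex.smul_im, smul_eq_mul]

/-- With each of its points a ray contains everything further out in the same direction, so moving
towards `0` cannot lead into a ray. -/
theorem starConvex_slit (hY : StarConvex ℝ 0 Y) : StarConvex ℝ 0 (slit Y P) := by
  rw [starConvex_zero_iff] at hY ⊢
  intro z hz s hs0 hs1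
  refine ⟨hY hz.1 hs0 hs1, fun p hp hr => hz.2 p hp ?_⟩
  obtain ⟨h1, h2⟩ := hr
  rw [smul_div_im] at h1
  rw [smul_div_re] at h2
  have hs : 0 < s := lt_of_le_of_ne hs0 (by rintro rfl; norm_num at h2)
  refine ⟨by simpa [hs.ne'] using h1, ?_⟩
  have hre : 0 < (z / p).re := pos_of_mul_pos_right (a := s) (by linarith) hs0
  nlinarith

/-- Scaling towards `0` pulls the cone into its part with real part of `z / p` at most `1 + η`. That
part is convex, it lies in `Y` as `p` is an interior point, and it ends before the next point of
`P`. The set `D` prescribes the sign of the imaginary part, so that one argument serves the whole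
cone and its two halves. -/
theorem contractible_cone (hs : Small Y P η) (hY : StarConvex ℝ 0 Y) {p : ℂ} (hp : p ∈ P)
    (hp0 : p ≠ 0) {D : Set ℝ} (hD : Convex ℝ D) (hDc : ∀ s : ℝ, 0 < s → ∀ x ∈ D, s * x ∈ D)
    {d : ℝ} (hd : d ∈ D) (hd1 : |d| ≤ 1) :
    ContractibleSpace {z | z ∈ cone Y P η p ∧ (z / p).im ∈ D} := by
  have hη := hs.pos
  have hη' := hs.le
  rw [starConvex_zero_iff] at hY
  have hseg : ∀ z, z ∈ cone Y P η p ∧ (z / p).im ∈ D → ∀ s : ℝ, 0 < s → s ≤ 1 →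
      1 < s * (z / p).re → s • z ∈ cone Y P η p ∧ (s • z / p).im ∈ D := by
    rintro z ⟨⟨h1, h2, h3, h4⟩, h5⟩ s hs0 hs1 hs2
    refine ⟨⟨hY h1 hs0.le hs1, ?_, ?_, ?_⟩, ?_⟩
    · rwa [smul_div_re]
    · rw [smul_div_re, smul_div_im, abs_mul, abs_of_pos hs0]; nlinarith
    · intro q hq hq1 hq2
      rw [smul_div_re]
      have := h4 q hq hq1 hq2
      nlinarith
    · rw [smul_div_im]; exact hDc s hs0 _ h5
  -- This factor replaces the real part of `z / p` by its minimum with `1 + η`, which is still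
  -- greater than `1`.
  let c : ℂ → ℝ := fun z => min 1 ((1 + η) / (z / p).re)
  have hc : ∀ z, z ∈ cone Y P η p → 0 < c z ∧ c z ≤ 1 ∧ 1 < c z * (z / p).re ∧
      c z * (z / p).re ≤ 1 + η := by
    rintro z ⟨h1, h2, h3, h4⟩
    have hre : 0 < (z / p).re := by linarith
    have e : c z * (z / p).re = min ((z / p).re) (1 + η) := by
      simp only [c]
      rw [min_mul_of_nonneg _ _ hre.le, one_mul, div_mul_cancel₀ _ hre.ne']
    refine ⟨lt_min one_pos (by positivity), min_le_left _ _, ?_, ?_⟩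
    · rw [e]; exact lt_min h2 (by linarith)
    · rw [e]; exact min_le_right _ _
  refine contractibleSpace_of_segment_subset
    (T := {z | (1 < (z / p).re ∧ (z / p).re ≤ 1 + η ∧ |(z / p).im| < η * (z / p).re) ∧
      (z / p).im ∈ D}) (f := fun z => c z • z) ?_ ?_ ?_ ?_ ?_ ?_
  · rintro z ⟨⟨h1, h2, h3⟩, h4⟩
    refine ⟨⟨?_, h1, h3, fun q hq _ hq2 => h2.trans_lt (hs.gap p hp q hq hq2)⟩, h4⟩
    have : ‖z / p - 1‖ < 4 * η := by
      refine (Complex.norm_le_abs_re_add_abs_im _).trans_lt ?_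
      simp only [Complex.sub_re, Complex.one_re, Complex.sub_im, Complex.one_im, sub_zero]
      rw [abs_of_pos (by linarith)]
      nlinarith
    simpa [hp0] using hs.near p hp _ this
  · rintro z ⟨⟨h1, h2, h3⟩, h4⟩ z' ⟨⟨h1', h2', h3'⟩, h4'⟩ a b ha hb hab
    have er : ((a • z + b • z') / p).re = a * (z / p).re + b * (z' / p).re := by
      rw [add_div, Complex.add_re, smul_div_re, smul_div_re]
    have ei : ((a • z + b • z') / p).im = a * (z / p).im + b * (z' / p).im := by
      rw [add_div, Complex.add_im, smul_div_im, smul_div_im]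
    refine ⟨⟨?_, ?_, ?_⟩, ?_⟩
    · rw [er]; exact convex_Ioi (1 : ℝ) h1 h1' ha hb hab
    · rw [er]; exact convex_Iic (1 + η) h2 h2' ha hb hab
    · rw [er, ei]
      rw [abs_lt] at *
      have i1 := convex_Ioi (0 : ℝ) (x := η * (z / p).re - (z / p).im)
        (y := η * (z' / p).re - (z' / p).im) (sub_pos.2 h3.2) (sub_pos.2 h3'.2) ha hb hab
      have i2 := convex_Ioi (0 : ℝ) (x := η * (z / p).re + (z / p).im)
        (y := η * (z' / p).re + (z' / p).im) (Set.mem_Ioi.2 (by linarith [h3.1]))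
        (Set.mem_Ioi.2 (by linarith [h3'.1])) ha hb hab
      simp only [smul_eq_mul, Set.mem_Ioi] at i1 i2
      constructor <;> linarith
    · rw [ei]; exact hD h4 h4' ha hb hab
  · refine ⟨(⟨1 + η / 2, η / 2 * d⟩ : ℂ) * p, ?_⟩
    simp only [Set.mem_ofPred_eq, mul_div_cancel_right₀ _ hp0]
    refine ⟨⟨by linarith, by linarith, ?_⟩, hDc _ (by positivity) _ hd⟩
    rw [abs_mul, abs_of_pos (by positivity)]
    nlinarith
  · refine ContinuousOn.smul (f := c) (g := fun z => z) ?_ continuousOn_id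
    refine continuous_min.comp_continuousOn (continuousOn_const.prodMk (continuousOn_const.div ?_ ?_))
    · have : Continuous fun z : ℂ => z / p := by fun_prop
      exact (Complex.continuous_re.comp this).continuousOn
    · rintro z ⟨⟨-, h, -⟩, -⟩
      linarith
  · rintro z hz
    obtain ⟨h1, h2, h3, h4⟩ := hc z hz.1
    have := hseg z hz _ h1 h2 h3
    exact ⟨⟨this.1.2.1, by rw [smul_div_re]; exact h4, this.1.2.2.1⟩, this.2⟩
  · rintro z hz y ⟨a, b, ha, hb, hab, rfl⟩
    obtain ⟨h1, h2, h3, h4⟩ := hc z hz.1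
    have hz1 := hz.1.2.1
    rw [smul_smul, ← add_smul]
    refine hseg z hz _ ?_ ?_ ?_
    · exact convex_Ioi (0 : ℝ) one_pos h1 ha hb hab |>.trans_eq (by simp)
    · nlinarith
    · have := convex_Ioi (1 : ℝ) hz1 h3 ha hb hab
      simp only [smul_eq_mul, Set.mem_Ioi] at this
      linarith

/-- If the cones around `p` and `q` meet, the choice of the aperture makes `q / p` a positive real
number. On a common ray the cones are separated, because each ends at the next point. For the same
reason a half cone meets no ray. -/
theorem cutCover (hP : P.Finite) (h0 : (0 : ℂ) ∉ P) (hs : Small Y P η) :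
    CutCover (X := ↥(Y \ P)) (ι := ↥P) {z | (z : ℂ) ∈ slit Y P}
      (fun p => {z | (z : ℂ) ∈ cone Y P η p})
      (fun p => {z | (z : ℂ) ∈ cone Y P η p ∧ ((z : ℂ) / (p : ℂ)).im ∈ Set.Ioi 0})
      (fun p => {z | (z : ℂ) ∈ cone Y P η p ∧ ((z : ℂ) / (p : ℂ)).im ∈ Set.Iio 0}) := by
  have hη := hs.pos
  have hdiv : ∀ p : ℂ, Continuous fun z : ↥(Y \ P) => (z : ℂ) / p := fun p => by fun_prop
  have hre : ∀ p : ℂ, Continuous fun z : ↥(Y \ P) => ((z : ℂ) / p).re := fun p =>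
    Complex.continuous_re.comp (hdiv p)
  have him : ∀ p : ℂ, Continuous fun z : ↥(Y \ P) => ((z : ℂ) / p).im := fun p =>
    Complex.continuous_im.comp (hdiv p)
  have hcone : ∀ p : ℂ, IsOpen {z : ↥(Y \ P) | (z : ℂ) ∈ cone Y P η p} := by
    intro p
    have e : {z : ↥(Y \ P) | (z : ℂ) ∈ cone Y P η p} =
        {z : ↥(Y \ P) | 1 < ((z : ℂ) / p).re} ∩
        ({z : ↥(Y \ P) | |((z : ℂ) / p).im| < η * ((z : ℂ) / p).re} ∩
        ⋂ q ∈ P, {z : ↥(Y \ P) | (q / p).im = 0 → 1 < (q / p).re → ((z : ℂ) / p).re < (q / p).re}) := by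
      ext z
      simp [cone, z.2.1]
    rw [e]
    refine (isOpen_lt continuous_const (hre p)).inter ((isOpen_lt (him p).abs
      (continuous_const.mul (hre p))).inter (hP.isOpen_biInter fun q _ => ?_))
    by_cases h1 : (q / p).im = 0
    · by_cases h2 : 1 < (q / p).re
      · simpa [h1, h2] using isOpen_lt (hre p) continuous_const
      · simp [h2]
    · simp [h1]
  have hne : ∀ p ∈ P, p ≠ 0 := fun p hp h => h0 (h ▸ hp)
  have hang : ∀ p ∈ P, ∀ q ∈ P, ∀ z : ℂ, |(z / p).im| < η * (z / p).re →
      |(z / q).im| < η * (z / q).re → (q / p).im = 0 ∧ 0 < (q / p).re := by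
    intro p hp q hq z hzp hzq
    have e : q / p * (z / q) = z / p := by
      have := hne p hp; have := hne q hq; field_simp
    obtain ⟨h1, h2⟩ := angle_le hη hs.le hzq (r := q / p) (by rwa [e])
    exact ⟨hs.angle p hp q hq h1, h2⟩
  have hmul : ∀ p ∈ P, ∀ q ∈ P, ∀ z : ℂ, (q / p).im = 0 →
      (z / p).im = (q / p).re * (z / q).im ∧ (z / p).re = (q / p).re * (z / q).re := by
    intro p hp q hq z hi
    have e : z / p = q / p * (z / q) := by
      have := hne p hp; have := hne q hq; field_simp
    rw [e, Complex.mul_im, Complex.mul_re, hi]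
    constructor <;> ring
  have hslit : ∀ p ∈ P, ∀ z ∈ cone Y P η p, (z / p).im ≠ 0 → z ∈ slit Y P := by
    intro p hp z hz hi
    refine ⟨hz.1, fun q hq hr => hi ?_⟩
    have h1 := hang p hp q hq z hz.2.2.1 (by
      rw [hr.1, abs_zero]; have := hr.2; positivity)
    rw [(hmul p hp q hq z h1.1).1, hr.1, mul_zero]
  have heq : ∀ p ∈ P, ∀ z, (z / p).im = 0 → (z / p).re = 1 → z = p := by
    intro p hp z h1 h2
    have : z / p = 1 := Complex.ext h2 h1
    exact (div_eq_one_iff_eq (hne p hp)).1 this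
  refine ⟨?_, fun p => hcone p, fun p => ?_, fun p => ?_, ?_, ?_, ?_, ?_⟩
  · have e : {z : ↥(Y \ P) | (z : ℂ) ∈ slit Y P} = ⋂ p ∈ P, {z : ↥(Y \ P) | (z : ℂ) ∈ (ray p)ᶜ} := by
      ext z
      simp [slit, z.2.1]
    rw [e]
    exact hP.isOpen_biInter fun p _ => (isClosed_ray p).isOpen_compl.preimage continuous_subtype_val
  · exact (hcone p).inter (isOpen_Ioi.preimage (him p))
  · exact (hcone p).inter (isOpen_Iio.preimage (him p))
  · intro z
    by_cases hz : (z : ℂ) ∈ slit Y P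
    · exact .inl hz
    right
    have hz' : {p | p ∈ P ∧ (z : ℂ) ∈ ray p}.Nonempty := by
      simp only [slit, Set.mem_ofPred_eq, not_and, not_forall, not_not] at hz
      obtain ⟨p, hp, hr⟩ := hz z.2.1
      exact ⟨p, hp, hr⟩
    -- Among the points whose ray contains `z`, the one farthest from `0` is the last before `z`,
    -- and `z` lies in its cone.
    obtain ⟨p, ⟨hp, hr⟩, hmax⟩ := Set.exists_max_image _ (fun p : ℂ => ‖p‖)
      (hP.subset fun p hp => hp.1) hz'
    refine ⟨⟨p, hp⟩, z.2.1, ?_, ?_, ?_⟩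
    · refine lt_of_le_of_ne hr.2 fun h => z.2.2 ?_
      rw [heq p hp z hr.1 h.symm]
      exact hp
    · rw [hr.1, abs_zero]
      have := hr.2
      positivity
    · intro q hq hq1 hq2
      by_contra hlt
      obtain ⟨e1, e2⟩ := hmul p hp q hq z hq1
      have hq0 : 0 < (q / p).re := by linarith
      have : (z : ℂ) ∈ ray q := by
        constructor
        · have := hr.1
          rw [e1] at this
          exact (mul_eq_zero.1 this).resolve_left hq0.ne'
        · change ¬ ((z : ℂ) / p).re < (q / p).re at hlt
          rw [e2] at hlt
          nlinarith
      have h1 := hmax q ⟨hq, this⟩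
      have h2 : q / p = ((q / p).re : ℂ) := Complex.ext rfl (by simpa using hq1)
      have h3 : ‖q‖ = (q / p).re * ‖p‖ := by
        have h5 : ‖q / p‖ = (q / p).re := by
          rw [h2, Complex.norm_real, Complex.ofReal_re, Real.norm_of_nonneg hq0.le]
        rw [← h5, norm_div, div_mul_cancel₀ _ (norm_ne_zero_iff.2 (hne p hp))]
      have h4 : 0 < ‖p‖ := norm_pos_iff.2 (hne p hp)
      have h6 : 1 < (q / p).re := hq2
      nlinarith
  · rintro ⟨p, hp⟩ ⟨q, hq⟩ z hz hz'
    obtain ⟨h1, h2⟩ := hang p hp q hq z hz.2.2.1 hz'.2.2.1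
    obtain ⟨h1', h2'⟩ := hang q hq p hp z hz'.2.2.1 hz.2.2.1
    refine Subtype.ext ?_
    rcases lt_trichotomy (q / p).re 1 with h | h | h
    · have e := (hmul q hq p hp p h1').2
      have e0 := (hmul q hq p hp q h1').2
      rw [div_self (hne q hq)] at e0
      have h3 : 1 < (p / q).re := by
        simp only [Complex.one_re] at e0
        nlinarith
      have h4 := hz'.2.2.2 p hp h1' h3
      simp only at h4
      rw [(hmul q hq p hp z h1').2] at h4
      have := hz.2.1
      simp only at this
      nlinarith
    · exact (heq p hp q h1 h).symm
    · have h4 := hz.2.2.2 q hq h1 h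
      simp only at h4
      rw [(hmul p hp q hq z h1).2] at h4
      have := hz'.2.1
      simp only at this
      nlinarith
  · rintro ⟨p, hp⟩
    ext z
    simp only [Set.mem_inter_iff, Set.mem_ofPred_eq, Set.mem_union, Set.mem_Ioi, Set.mem_Iio]
    constructor
    · rintro ⟨h1, h2⟩
      have : ((z : ℂ) / p).im ≠ 0 := fun h => h1.2 p hp ⟨h, h2.2.1.le⟩
      rcases lt_or_gt_of_ne this with h | h
      · exact .inr ⟨h2, h⟩
      · exact .inl ⟨h2, h⟩
    · rintro (⟨h1, h2⟩ | ⟨h1, h2⟩)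
      · exact ⟨hslit p hp z h1 h2.ne', h1⟩
      · exact ⟨hslit p hp z h1 h2.ne, h1⟩
  · rintro ⟨p, hp⟩
    rw [Set.disjoint_left]
    rintro z ⟨_, h1⟩ ⟨_, h2⟩
    exact lt_asymm (Set.mem_Ioi.1 h1) (Set.mem_Iio.1 h2)

theorem cone_disjoint (h0 : (0 : ℂ) ∉ P) (hs : Small Y P η) {p : ℂ} (hp : p ∈ P) :
    cone Y P η p ⊆ Y \ P := by
  intro z hz
  refine ⟨hz.1, fun hzP => ?_⟩
  have hp0 : p ≠ 0 := fun h => h0 (h ▸ hp)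
  have hre : 0 < (z / p).re := by linarith [hz.2.1]
  have h1 : (z / p).im = 0 := hs.angle p hp z hzP (by nlinarith [hz.2.2.1, hs.pos])
  -- The condition that the cone ends before the next point of `P` is applied to `z` itself.
  exact lt_irrefl _ (hz.2.2.2 z hzP h1 hz.2.1)

/-- The complement of finitely many interior points in a star-shaped plane set has a free
fundamental group, with one generator for each point. -/
theorem free_of_starConvex (hY : StarConvex ℝ 0 Y) (hY0 : (0 : ℂ) ∈ Y) (hP : P.Finite)
    (hPY : P ⊆ interior Y) (h0 : (0 : ℂ) ∉ P) :
    PathConnectedSpace ↥(Y \ P) ∧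
      ∀ b : ↥(Y \ P), Nonempty (FundamentalGroup ↥(Y \ P) b ≃* FreeGroup ↥P) := by
  obtain ⟨η, hs⟩ := exists_small hP hPY
  have hne : ∀ p ∈ P, p ≠ 0 := fun p hp h => h0 (h ▸ hp)
  have hsc : ∀ S : Set ℂ, S ⊆ Y \ P → ContractibleSpace S →
      IsSimplyConnected {z : ↥(Y \ P) | (z : ℂ) ∈ S} := by
    intro S hS hc
    have : IsSimplyConnected S := SimplyConnectedSpace.ofContractible S
    rw [← Topology.IsEmbedding.subtypeVal.isSimplyConnected_image]
    convert this
    ext z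
    simp only [Set.mem_image, Set.mem_ofPred_eq]
    constructor
    · rintro ⟨w, hw, rfl⟩
      exact hw
    · intro hz
      exact ⟨⟨z, hS hz⟩, hz, rfl⟩
  have hcone := fun (p : ↥P) => cone_disjoint h0 hs p.2
  refine (cutCover hP h0 hs).free ?_ (fun p => ?_) (fun p => ?_) (fun p => ?_)
  · refine hsc _ (fun z hz => ⟨hz.1, fun hzP => hz.2 z hzP ?_⟩) ?_
    · simp [ray, div_self (hne z hzP)]
    · exact (starConvex_slit hY).contractibleSpace ⟨0, hY0, fun p _ => zero_notMem_ray p⟩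
  · have := contractible_cone hs hY p.2 (hne p p.2) (D := Set.univ) convex_univ (by simp)
      (d := 0) trivial (by simp)
    refine hsc _ (hcone p) ?_
    have e : {z | z ∈ cone Y P η p ∧ (z / p).im ∈ Set.univ} = cone Y P η p := by
      ext z
      simp
    rwa [e] at this
  · exact (hsc _ (fun z hz => hcone p hz.1) (contractible_cone hs hY p.2 (hne p p.2)
      (D := Set.Ioi 0) (convex_Ioi 0) (fun s hs x hx => mul_pos hs hx)
      (d := 1) (by simp) (by simp))).isPathConnected
  · exact (hsc _ (fun z hz => hcone p hz.1) (contractible_cone hs hY p.2 (hne p p.2)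
      (D := Set.Iio 0) (convex_Iio 0) (fun s hs x hx => mul_neg_of_pos_of_neg hs hx)
      (d := -1) (by simp) (by simp))).isPathConnected

end RadialCuts

/-! ### The model region -/

/-- The fundamental group is invariant under homeomorphisms. -/
theorem Homeomorph.nonempty_fundamentalGroup_mulEquiv {X Y : Type*} [TopologicalSpace X]
    [TopologicalSpace Y] (e : X ≃ₜ Y) (x : X) :
    Nonempty (FundamentalGroup X x ≃* FundamentalGroup Y (e x)) :=
  ⟨(FundamentalGroupoidFunctor.equivOfHomotopyEquiv
    e.toHomotopyEquiv).fullyFaithfulFunctor.mulEquivEnd (FundamentalGroupoid.mk x)⟩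

/-- Path connected with free fundamental group, with generators indexed by `ι`. -/
def IsFreeSpace (X : Type*) [TopologicalSpace X] (ι : Type*) : Prop :=
  PathConnectedSpace X ∧ ∀ b : X, Nonempty (FundamentalGroup X b ≃* FreeGroup ι)

theorem IsFreeSpace.of_homeomorph {X Y ι κ : Type*} [TopologicalSpace X] [TopologicalSpace Y]
    (h : IsFreeSpace Y κ) (e : X ≃ₜ Y) (f : κ ≃ ι) : IsFreeSpace X ι := by
  obtain ⟨h1, h2⟩ := h
  refine ⟨e.symm.surjective.pathConnectedSpace e.symm.continuous, fun b => ?_⟩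
  obtain ⟨e1⟩ := e.nonempty_fundamentalGroup_mulEquiv b
  obtain ⟨e2⟩ := h2 (e b)
  exact ⟨(e1.trans e2).trans (FreeGroup.freeGroupCongr f)⟩

/-- The union of the open unit disc and the open left half plane. -/
def discHalf : Set ℂ := {z | ‖z‖ < 1 ∨ z.re < 0}

theorem isOpen_discHalf : IsOpen discHalf :=
  (isOpen_lt continuous_norm continuous_const).union
    (isOpen_lt Complex.continuous_re continuous_const)

/-- The centre lies in both convex sets, the disc and the half plane. Since there is a whole
interval of such centres, one of them avoids any given finite set. -/
theorem starConvex_discHalf {a : ℝ} (ha : 0 < a) (ha1 : a < 1) :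
    StarConvex ℝ (-a : ℂ) discHalf := by
  rintro z (hz | hz) s t hs ht hst
  · left
    have := convex_ball (0 : ℂ) 1 (x := (-a : ℂ)) (by simp [abs_of_pos ha, ha1]) (y := z)
      (by simpa using hz) hs ht hst
    simpa using this
  · rcases eq_or_lt_of_le ht with rfl | ht
    · left
      have : s = 1 := by linarith
      simp [this, abs_of_pos ha, ha1]
    · right
      simp only [Complex.add_re, Complex.smul_re, Complex.neg_re, Complex.ofReal_re, smul_eq_mul]
      nlinarith

/-- The intersection of `discHalf` and a closed disc, minus finitely many interior points, has a
free fundamental group with one generator for each of these points. -/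
theorem isFreeSpace_discHalf {K : ℝ} (hK : 1 ≤ K) {P : Set ℂ} (hP : P.Finite)
    (hPY : P ⊆ discHalf ∩ Metric.ball 0 K) :
    IsFreeSpace ↥((discHalf ∩ Metric.closedBall 0 K) \ P) ↥P := by
  have hinf : (Set.Ioo (0 : ℝ) 1).Infinite := Set.Ioo_infinite one_pos
  obtain ⟨a, ha, haP⟩ : ∃ a ∈ Set.Ioo (0 : ℝ) 1, (-a : ℂ) ∉ P := by
    by_contra! hcon
    refine hinf ((hP.preimage (f := fun a : ℝ => (-a : ℂ)) ?_).subset hcon)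
    intro x _ y _ hxy
    simpa using hxy
  let e : ℂ ≃ₜ ℂ := Homeomorph.addRight (a : ℂ)
  have he : ∀ z, e z = z + a := fun z => rfl
  have hstar : StarConvex ℝ (-a : ℂ) (discHalf ∩ Metric.closedBall 0 K) :=
    (starConvex_discHalf ha.1 ha.2).inter ((convex_closedBall _ _).starConvex
      (by simp [abs_of_pos ha.1, ha.2.le.trans hK]))
  have hstar' : StarConvex ℝ 0 (e '' (discHalf ∩ Metric.closedBall 0 K)) := by
    have := hstar.add_right (a : ℂ)
    simpa [he] using this
  have hmem : (-a : ℂ) ∈ discHalf ∩ Metric.closedBall 0 K :=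
    ⟨.inl (by simp [abs_of_pos ha.1, ha.2]), by simp [abs_of_pos ha.1, ha.2.le.trans hK]⟩
  have h := RadialCuts.free_of_starConvex hstar' ⟨_, hmem, by simp [he]⟩ (hP.image e) ?_ ?_
  · rw [← Set.image_sdiff e.injective] at h
    exact IsFreeSpace.of_homeomorph (ι := P) h (e.image _)
      (Equiv.Set.image e P e.injective).symm
  · rw [← e.image_interior]
    refine Set.image_mono (hPY.trans ?_)
    exact interior_maximal (Set.inter_subset_inter_right _ Metric.ball_subset_closedBall)
      (isOpen_discHalf.inter Metric.isOpen_ball)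
  · rintro ⟨z, hz, h⟩
    rw [he] at h
    exact haP (by rwa [← eq_neg_of_add_eq_zero_left h])

namespace StokesFibre

/-! ### Polar coordinates -/

section polar

theorem toC_mul (u v : Polar) : toC (u * v) = toC u * toC v := by
  simp [toC]; ring

@[simp] theorem toC_one : toC 1 = 1 := by simp [toC]

theorem toC_pow (u : Polar) (n : ℕ) : toC (u ^ n) = toC u ^ n := by
  induction n with
  | zero => simp
  | succ n ih => rw [pow_succ, toC_mul, ih, pow_succ]

theorem norm_toC (u : Polar) : ‖toC u‖ = u.1 := by
  rw [toC, norm_mul, Circle.norm_coe, mul_one, Complex.norm_real, Real.norm_of_nonneg u.1.coe_nonneg]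

theorem toC_eq_zero {u : Polar} : toC u = 0 ↔ u.1 = 0 := by
  rw [← norm_eq_zero, norm_toC, NNReal.coe_eq_zero]

theorem toC_ne_zero {u : Polar} : toC u ≠ 0 ↔ u.1 ≠ 0 := toC_eq_zero.not

theorem toC_inv (u : Polar) : toC u⁻¹ = (toC u)⁻¹ := by
  simp [toC, mul_comm]

theorem continuous_toC : Continuous toC := by
  unfold toC
  fun_prop

theorem exists_toC (z : ℂ) : ∃ c : Polar, toC c = z :=
  ⟨(‖z‖₊, Circle.exp (Complex.arg z)), by
    rw [toC, Circle.coe_exp]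
    exact Complex.norm_mul_exp_arg_mul_I _⟩

theorem polar_mul_inv {u : Polar} (hu : u.1 ≠ 0) : u * u⁻¹ = 1 := by
  ext
  · simp [hu]
  · simp

theorem polar_inv_mul {u : Polar} (hu : u.1 ≠ 0) : u⁻¹ * u = 1 := by
  rw [mul_comm, polar_mul_inv hu]

end polar

/-! ### Quotients with values in the compactified plane -/

section compactification

/-- The quotient `A / B`, with `ℂ` compactified by a circle to the closed unit disc by
`z ↦ z / (1 + |z|)`. -/
noncomputable def th (A : ℂ) (B : Polar) : ℂ :=
  A * (starRingEnd ℂ (B.2 : ℂ)) / ((‖A‖ + B.1 : ℝ) : ℂ)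

/-- Only the quotient matters. This is how different charts, which write one function as different
fractions, produce the same value. -/
theorem th_mul {l : Polar} (hl : l.1 ≠ 0) (A : ℂ) (B : Polar) : th (A * toC l) (B * l) = th A B := by
  have hl' : ((l.1 : ℝ) : ℂ) ≠ 0 := by exact_mod_cast hl
  have h1 : (l.2 : ℂ) * (starRingEnd ℂ (l.2 : ℂ)) = 1 := by
    rw [Complex.mul_conj, Circle.normSq_coe, Complex.ofReal_one]
  unfold th
  rw [norm_mul, norm_toC]
  have e1 : ((‖A‖ * l.1 + ((B * l).1 : ℝ≥0) : ℝ) : ℂ) = ((‖A‖ + B.1 : ℝ) : ℂ) * (l.1 : ℝ) := by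
    simp; ring
  have e2 : A * toC l * (starRingEnd ℂ ((B * l).2 : ℂ)) = A * (starRingEnd ℂ (B.2 : ℂ)) * (l.1 : ℝ) := by
    simp only [Prod.snd_mul, Circle.coe_mul, map_mul, toC]
    linear_combination A * (l.1 : ℝ) * (starRingEnd ℂ (B.2 : ℂ)) * h1
  rw [e1, e2, mul_div_mul_right _ _ hl']

theorem th_eq {l : Polar} (hl : l.1 ≠ 0) {A A' : ℂ} {B B' : Polar} (hA : A' = A * toC l)
    (hB : B' = B * l) : th A B = th A' B' := by
  rw [hA, hB, th_mul hl]

theorem th_div {B : Polar} (hB : B.1 ≠ 0) (A : ℂ) : th A B = th (A / toC B) 1 := by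
  refine (th_eq hB (l := B) ?_ ?_).symm
  · rw [div_mul_cancel₀ _ (toC_ne_zero.2 hB)]
  · rw [one_mul]

theorem norm_th (A : ℂ) (B : Polar) : ‖th A B‖ = ‖A‖ / (‖A‖ + B.1) := by
  unfold th
  rw [norm_div, norm_mul, RCLike.norm_conj, Circle.norm_coe, mul_one, Complex.norm_real,
    Real.norm_of_nonneg (by positivity)]

theorem norm_th_le (A : ℂ) (B : Polar) : ‖th A B‖ ≤ 1 := by
  rw [norm_th]
  exact div_le_one_of_le₀ (by simp) (by positivity)

/-- Where the radius of `B` vanishes, only the direction of `A / B` is retained. The formula is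
continuous unless numerator and radius vanish together, since its denominator is `‖A‖` plus this
radius. -/
theorem continuousAt_th {α : Type*} [TopologicalSpace α] {A : α → ℂ} {B : α → Polar} {a : α}
    (hA : ContinuousAt A a) (hB : ContinuousAt B a) (h : A a ≠ 0 ∨ (B a).1 ≠ 0) :
    ContinuousAt (fun x => th (A x) (B x)) a := by
  unfold th
  have h1 : ContinuousAt (fun x => (B x).1) a := continuous_fst.continuousAt.comp hB
  have h2 : ContinuousAt (fun x => (B x).2) a := continuous_snd.continuousAt.comp hB
  refine ContinuousAt.div ?_ ?_ ?_
  · refine hA.mul ?_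
    have hc : Continuous fun x : Circle => (x : ℂ) := by fun_prop
    exact (Complex.continuous_conj.comp hc).continuousAt.comp h2
  · refine Complex.continuous_ofReal.continuousAt.comp ?_
    exact hA.norm.add (NNReal.continuous_coe.continuousAt.comp h1)
  · rw [Complex.ofReal_ne_zero]
    rcases h with h | h
    · have := norm_pos_iff.2 h
      positivity
    · have : 0 < (B a).1 := pos_iff_ne_zero.2 h
      positivity

/-- `X t ^ k` for `X = A / t ^ n`. -/
noncomputable def thW (n k : ℕ) (A : ℂ) (t : Polar) : ℂ :=
  if k < n then th A (t ^ (n - k)) else th (A * toC (t ^ (k - n))) 1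

/-- `X t ^ k` for `X = A / (u ^ j v ^ (j + 1))`, `t = u v`. -/
noncomputable def thE (j k : ℕ) (A : ℂ) (u v : Polar) : ℂ :=
  if k ≤ j then th A (u ^ (j - k) * v ^ (j + 1 - k))
  else th (A * toC (u ^ (k - j) * v ^ (k - j - 1))) 1

/-- `X t ^ k` for `X = A / (t ^ j v)`. -/
noncomputable def thN (j k : ℕ) (A : ℂ) (t v : Polar) : ℂ :=
  if k ≤ j then th A (t ^ (j - k) * v) else th (A * toC (t ^ (k - j) * v⁻¹)) 1

theorem pow_fst_ne_zero {t : Polar} (ht : t.1 ≠ 0) (n : ℕ) : (t ^ n).1 ≠ 0 := by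
  rw [Prod.pow_fst]; exact pow_ne_zero n ht

theorem mul_fst_ne_zero {t u : Polar} (ht : t.1 ≠ 0) (hu : u.1 ≠ 0) : (t * u).1 ≠ 0 :=
  mul_ne_zero ht hu

theorem thW_off (n k : ℕ) (A : ℂ) {t : Polar} (ht : t.1 ≠ 0) :
    thW n k A t = th (A / toC t ^ n * toC t ^ k) 1 := by
  have ht' := toC_ne_zero.2 ht
  unfold thW
  split_ifs with h
  · rw [th_div (pow_fst_ne_zero ht _), toC_pow]
    congr 1
    obtain ⟨m, rfl⟩ := Nat.exists_eq_add_of_lt h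
    rw [show k + m + 1 - k = m + 1 by omega]
    field_simp
    ring
  · obtain ⟨m, rfl⟩ := Nat.exists_eq_add_of_le (not_lt.1 h)
    rw [toC_pow, Nat.add_sub_cancel_left]
    congr 1
    field_simp
    ring

/-- Away from `v = 0` one may use `t = u v` and the coordinate `v = y / t ^ j` of `E j`. -/
theorem thE_eq_thN_right {j k : ℕ} {A : ℂ} {u v : Polar} (hv : v.1 ≠ 0) :
    thE j k A u v = thN j k A (u * v) v := by
  unfold thE thN
  split_ifs with h
  · rw [mul_pow, mul_assoc, ← pow_succ, Nat.sub_add_comm h]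
  · obtain ⟨m, rfl⟩ := Nat.exists_eq_add_of_lt (not_le.1 h)
    rw [show j + m + 1 - j = m + 1 by omega, Nat.add_sub_cancel, mul_pow, pow_succ v, mul_assoc,
      mul_assoc (v ^ m), polar_mul_inv hv, mul_one]

/-- Away from `u = 0` one may use `t = u v` and the coordinate `u⁻¹ = y / t ^ (j + 1)` of the next
curve. -/
theorem thE_eq_thN_left {j k : ℕ} {A : ℂ} {u v : Polar} (hu : u.1 ≠ 0) :
    thE j k A u v = thN (j + 1) k A (u * v) u⁻¹ := by
  unfold thE thN
  rcases lt_trichotomy k (j + 1) with h | rfl | h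
  · rw [if_pos (by omega), if_pos (by omega)]
    obtain ⟨m, rfl⟩ := Nat.exists_eq_add_of_le (Nat.lt_succ_iff.1 h)
    rw [show k + m - k = m by omega, show k + m + 1 - k = m + 1 by omega, mul_pow, pow_succ u,
      mul_right_comm, mul_assoc (u ^ m), polar_mul_inv hu, mul_one]
  · rw [if_neg (by omega), if_pos le_rfl]
    simp only [Nat.add_sub_cancel_left, pow_one, Nat.sub_self, pow_zero, mul_one, one_mul]
    exact (th_eq hu rfl (polar_inv_mul hu).symm).symm
  · rw [if_neg (by omega), if_neg (by omega)]
    obtain ⟨m, rfl⟩ := Nat.exists_eq_add_of_lt h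
    rw [show j + 1 + m + 1 - j = m + 2 by omega, show j + 1 + m + 1 - (j + 1) = m + 1 by omega,
      show m + 2 - 1 = m + 1 by omega, inv_inv, mul_pow, pow_succ u (m + 1), mul_right_comm]

theorem thN_eq_thW {j k : ℕ} {A : ℂ} {t v : Polar} (hv : v.1 ≠ 0) :
    thN j k A t v = thW j k (A * toC v⁻¹) t := by
  have hv' := toC_ne_zero.2 hv
  unfold thN thW
  rcases lt_trichotomy k j with h | rfl | h
  · rw [if_pos h.le, if_pos h]
    refine (th_eq hv ?_ rfl).symm
    rw [toC_inv, inv_mul_cancel_right₀ hv']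
  · rw [if_pos le_rfl, if_neg (lt_irrefl _)]
    simp only [Nat.sub_self, pow_zero, one_mul, toC_one, mul_one]
    refine (th_eq hv ?_ ?_).symm
    · rw [toC_inv, inv_mul_cancel_right₀ hv']
    · rw [one_mul]
  · rw [if_neg (by omega), if_neg (by omega), toC_mul, mul_assoc, mul_comm (toC v⁻¹)]

theorem thE_off (j k : ℕ) (A : ℂ) {u v : Polar} (hu : u.1 ≠ 0) (hv : v.1 ≠ 0) :
    thE j k A u v = th (A / (toC u ^ j * toC v ^ (j + 1)) * toC (u * v) ^ k) 1 := by
  have hu' := toC_ne_zero.2 hu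
  have hv' := toC_ne_zero.2 hv
  rw [thE_eq_thN_right hv, thN_eq_thW hv, thW_off _ _ _ (mul_fst_ne_zero hu hv)]
  congr 1
  rw [toC_inv, toC_mul]
  field_simp
  ring

theorem continuousAt_thW {α : Type*} [TopologicalSpace α] {A : α → ℂ} {t : α → Polar} {a : α}
    {n k : ℕ} (hA : ContinuousAt A a) (ht : ContinuousAt t a)
    (h : n ≤ k ∨ A a ≠ 0 ∨ (t a).1 ≠ 0) :
    ContinuousAt (fun x => thW n k (A x) (t x)) a := by
  unfold thW
  split_ifs with hk
  · refine continuousAt_th hA (ht.pow _) ?_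
    rcases h with h | h | h
    · omega
    · exact .inl h
    · exact .inr (pow_fst_ne_zero h _)
  · exact continuousAt_th (hA.mul (continuous_toC.continuousAt.comp (ht.pow _))) continuousAt_const
      (.inr one_ne_zero)

theorem continuousAt_thE {α : Type*} [TopologicalSpace α] {A : α → ℂ} {u v : α → Polar} {a : α}
    {j k : ℕ} (hA : ContinuousAt A a) (hu : ContinuousAt u a) (hv : ContinuousAt v a)
    (h : A a ≠ 0 ∨ ((u a).1 ≠ 0 ∧ (v a).1 ≠ 0)) :
    ContinuousAt (fun x => thE j k (A x) (u x) (v x)) a := by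
  unfold thE
  split_ifs with hk
  · refine continuousAt_th hA ((hu.pow _).mul (hv.pow _)) ?_
    rcases h with h | h
    · exact .inl h
    · exact .inr (mul_fst_ne_zero (pow_fst_ne_zero h.1 _) (pow_fst_ne_zero h.2 _))
  · exact continuousAt_th (hA.mul (continuous_toC.continuousAt.comp ((hu.pow _).mul (hv.pow _))))
      continuousAt_const (.inr one_ne_zero)

/-- For `k > j` the formula involves `v⁻¹`, whose radius has the default value `0` at `v.1 = 0`. In
the end chart `j = N`, so powers up to `t ^ N` are harmless. -/
theorem continuousAt_thN {α : Type*} [TopologicalSpace α] {A : α → ℂ} {t v : α → Polar} {a : α}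
    {j k : ℕ} (hk : k ≤ j) (hA : ContinuousAt A a) (ht : ContinuousAt t a) (hv : ContinuousAt v a)
    (h : A a ≠ 0 ∨ ((t a).1 ≠ 0 ∧ (v a).1 ≠ 0)) :
    ContinuousAt (fun x => thN j k (A x) (t x) (v x)) a := by
  unfold thN
  simp only [if_pos hk]
  refine continuousAt_th hA ((ht.pow _).mul hv) ?_
  rcases h with h | h
  · exact .inl h
  · exact .inr (mul_fst_ne_zero (pow_fst_ne_zero h.1 _) h.2)

end compactification

/-! ### The functions `x t ^ k` and `x' t ^ k` in the charts -/

section charts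

variable {N q : ℕ}

/-- `x t ^ k` in the charts, with values in the compactification of `ℂ`. -/
noncomputable def xPow (μ : ℂ → ℂ) (k : ℕ) : Pre N q → ℂ
  | .inl (t, x) => thW 0 k x t
  | .inr (.inl (j, u, v)) => thE j k 1 u v
  | .inr (.inr (.inl (t, v))) => thN N k 1 t v
  | .inr (.inr (.inr (.inl (s, u, v)))) =>
      thW q k (μ (toC (u * v)) + toC u ^ (s : ℕ) * toC v ^ ((s : ℕ) + 1)) (u * v)
  | .inr (.inr (.inr (.inr (t, z)))) => thW q k (μ (toC t) + toC t ^ q * z) t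

/-- `(x - μ t / t ^ q) t ^ k` in the charts, with values in the compactification of `ℂ`. -/
noncomputable def xPow' (μ : ℂ → ℂ) (k : ℕ) : Pre N q → ℂ
  | .inl (t, x) => thW q k (x * toC (t ^ q) - μ (toC t)) t
  | .inr (.inl (j, u, v)) =>
      if q ≤ (j : ℕ) then
        thE j k (1 - μ (toC (u * v)) * toC (u ^ (j - q : ℕ) * v ^ (j + 1 - q : ℕ))) u v
      else thW q k (toC (u ^ (q - j : ℕ) * v ^ (q - j - 1 : ℕ)) - μ (toC (u * v))) (u * v)
  | .inr (.inr (.inl (t, v))) => thN N k (1 - μ (toC t) * toC (t ^ (N - q) * v)) t v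
  | .inr (.inr (.inr (.inl (s, u, v)))) => thE (q - s - 1) k 1 v u
  | .inr (.inr (.inr (.inr (t, z)))) => thW 0 k z t

theorem xPow_nearE {μ : ℂ → ℂ} {j k : ℕ} (hj : j ≤ N) {t v : Polar} (hv : v.1 ≠ 0) :
    xPow μ k (nearE j t v : Pre N q) = thN j k 1 t v := by
  unfold nearE
  split_ifs with h
  · change thE j k 1 (t / v) v = _
    rw [thE_eq_thN_right hv, polar_div_mul t hv]
  · obtain rfl : j = N := by omega
    rfl

theorem xPow'_nearE {μ : ℂ → ℂ} {j k : ℕ} (hj : j ≤ N) (hq : q ≤ N) {t v : Polar} (hv : v.1 ≠ 0) :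
    xPow' μ k (nearE j t v : Pre N q) =
      if q ≤ j then thN j k (1 - μ (toC t) * toC (t ^ (j - q) * v)) t v
      else thW q k (toC (t ^ (q - j) * v⁻¹) - μ (toC t)) t := by
  have hd := polar_div_mul t hv
  unfold nearE
  split_ifs with h h' h'
  · change (if q ≤ j then
        thE j k (1 - μ (toC (t / v * v)) * toC ((t / v) ^ (j - q : ℕ) * v ^ (j + 1 - q : ℕ))) (t / v) v
      else thW q k (toC ((t / v) ^ (q - j : ℕ) * v ^ (q - j - 1 : ℕ)) - μ (toC (t / v * v)))
        (t / v * v)) = _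
    rw [if_pos h', thE_eq_thN_right hv, Nat.sub_add_comm h', pow_succ, ← mul_assoc, ← mul_pow, hd]
  · change (if q ≤ j then
        thE j k (1 - μ (toC (t / v * v)) * toC ((t / v) ^ (j - q : ℕ) * v ^ (j + 1 - q : ℕ))) (t / v) v
      else thW q k (toC ((t / v) ^ (q - j : ℕ) * v ^ (q - j - 1 : ℕ)) - μ (toC (t / v * v)))
        (t / v * v)) = _
    rw [if_neg h', hd]
    obtain ⟨m, rfl⟩ := Nat.exists_eq_add_of_lt (not_le.1 h')
    rw [show j + m + 1 - j = m + 1 by omega, Nat.add_sub_cancel]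
    have e : (t / v) ^ (m + 1) * v ^ m = t ^ (m + 1) * v⁻¹ := by
      conv_rhs => rw [← hd, mul_pow, pow_succ v, mul_assoc, mul_assoc, polar_mul_inv hv, mul_one]
    rw [e]
  · obtain rfl : j = N := by omega
    rfl
  · omega

theorem mul_fst (u v : Polar) : (u * v).1 = u.1 * v.1 := rfl

theorem toC_eq_inv {c : Polar} {w : ℂ} (h : toC c * w = 1) : toC c⁻¹ = w := by
  rw [toC_inv]
  exact inv_eq_of_mul_eq_one_right h

/-- This lets the functions descend to the glued space. Boundary points are glued too, so the
identity has to hold between the fractions themselves and not only off the divisor. -/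
theorem Glue.xPow_eq {μ : ℂ → ℂ} {k : ℕ} (hq : q ≤ N) {p p' : Pre N q} (h : Glue μ p p') :
    xPow μ k p = xPow μ k p' := by
  cases h with
  | base t x v hv =>
    have hv0 := fst_ne_zero_of_toC_mul hv
    rw [xPow_nearE (Nat.zero_le _) hv0, thN_eq_thW hv0, toC_eq_inv hv, one_mul]
    rfl
  | crossing j u v hu =>
    rw [xPow_nearE (by omega) (by exact inv_ne_zero hu), ← thE_eq_thN_left hu]
    rfl
  | branch s u v hu =>
    have hz : (u⁻¹ : Polar).1 ≠ 0 := inv_ne_zero hu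
    have e0 : toC (u * v) ^ ((s : ℕ) + 1) * toC u⁻¹ = toC u ^ (s : ℕ) * toC v ^ ((s : ℕ) + 1) := by
      have := toC_ne_zero.2 hu
      rw [toC_mul, toC_inv]
      field_simp
      ring
    unfold nearE'
    split_ifs with h
    · change thW q k (μ (toC (u * v)) + toC u ^ (s : ℕ) * toC v ^ ((s : ℕ) + 1)) (u * v) =
        thW q k (μ (toC (u * v / u⁻¹ * u⁻¹)) +
          toC (u * v / u⁻¹) ^ ((s : ℕ) + 1) * toC u⁻¹ ^ ((s : ℕ) + 1 + 1)) (u * v / u⁻¹ * u⁻¹)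
      rw [pow_succ (toC u⁻¹), ← mul_assoc, ← mul_pow, ← toC_mul, polar_div_mul _ hz, e0]
    · change thW q k (μ (toC (u * v)) + toC u ^ (s : ℕ) * toC v ^ ((s : ℕ) + 1)) (u * v) =
        thW q k (μ (toC (u * v)) + toC (u * v) ^ q * toC u⁻¹) (u * v)
      have e1 : toC (u * v) ^ q = toC (u * v) ^ ((s : ℕ) + 1) := by
        congr 1
        omega
      rw [e1, e0]
  | branch_main s u v c h hc =>
    have hc0 := fst_ne_zero_of_toC_mul hc
    rw [xPow_nearE hq hc0, thN_eq_thW hc0, toC_eq_inv hc, one_mul]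
    rfl
  | branchEnd_main t z c h hc =>
    have hc0 := fst_ne_zero_of_toC_mul hc
    rw [xPow_nearE hq hc0, thN_eq_thW hc0, toC_eq_inv hc, one_mul]
    rfl

theorem xPow'_nearE_q {μ : ℂ → ℂ} {k : ℕ} (hq : q ≤ N) {t c : Polar} {w : ℂ}
    (hc : toC c * w = 1) :
    xPow' μ k (nearE q t c : Pre N q) = thW q k (w - μ (toC t)) t := by
  have hc0 := fst_ne_zero_of_toC_mul hc
  rw [xPow'_nearE hq hq hc0, if_pos le_rfl, thN_eq_thW hc0, toC_eq_inv hc, Nat.sub_self, pow_zero,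
    one_mul, sub_mul, mul_assoc, hc, mul_one, one_mul]

/-- On a branch chart `x' = 1 / (v ^ (q - s - 1) * u ^ (q - s))`. With `u` and `v` exchanged, this
is the form of `x` in a crossing chart with index `q - s - 1`; so the branch is a second copy of the
first chain, run through in the opposite order. -/
theorem Glue.xPow'_eq {μ : ℂ → ℂ} {k : ℕ} (hq : q ≤ N) {p p' : Pre N q} (h : Glue μ p p') :
    xPow' μ k p = xPow' μ k p' := by
  cases h with
  | base t x v hv =>
    have hv0 := fst_ne_zero_of_toC_mul hv
    rw [xPow'_nearE (Nat.zero_le _) hq hv0]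
    change thW q k (x * toC (t ^ q) - μ (toC t)) t = _
    split_ifs with h
    · obtain rfl : q = 0 := by omega
      rw [thN_eq_thW hv0, toC_eq_inv hv, Nat.sub_self, pow_zero, one_mul, sub_mul, mul_assoc, hv,
        toC_one, mul_one, mul_one, one_mul]
    · rw [toC_mul, toC_eq_inv hv, Nat.sub_zero, mul_comm]
  | crossing j u v hu =>
    have hz : (u⁻¹ : Polar).1 ≠ 0 := inv_ne_zero hu
    rw [xPow'_nearE (by omega) hq hz]
    change (if q ≤ (j : ℕ) then
        thE j k (1 - μ (toC (u * v)) * toC (u ^ (j - q : ℕ) * v ^ (j + 1 - q : ℕ))) u v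
      else thW q k (toC (u ^ (q - j : ℕ) * v ^ (q - j - 1 : ℕ)) - μ (toC (u * v))) (u * v)) = _
    rcases lt_trichotomy q (j + 1) with h | h | h
    · rw [if_pos (by omega), if_pos (by omega), thE_eq_thN_left hu]
      congr 4
      rw [Nat.sub_add_comm (by omega : q ≤ (j : ℕ)), mul_pow, pow_succ u]
      rw [mul_right_comm, mul_assoc (u ^ _), polar_mul_inv hu, mul_one]
    · rw [if_neg (by omega), if_pos (by omega), thN_eq_thW hz, ← h, Nat.sub_self, pow_zero, one_mul,
        show q - (j : ℕ) - 1 = 0 by omega, show q - (j : ℕ) = 1 by omega, pow_one, pow_zero, mul_one,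
        inv_inv, sub_mul, mul_assoc, ← toC_mul, polar_inv_mul hu, toC_one, mul_one, one_mul]
    · rw [if_neg (by omega), if_neg (by omega), inv_inv]
      obtain ⟨m, rfl⟩ := Nat.exists_eq_add_of_lt h
      rw [show j + 1 + m + 1 - (j : ℕ) = m + 2 by omega,
        show j + 1 + m + 1 - ((j : ℕ) + 1) = m + 1 by omega, show m + 2 - 1 = m + 1 by omega, mul_pow,
        pow_succ u (m + 1), mul_right_comm]
  | branch s u v hu =>
    have hz : (u⁻¹ : Polar).1 ≠ 0 := inv_ne_zero hu
    change thE (q - s - 1) k 1 v u = _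
    unfold nearE'
    rw [thE_eq_thN_right hu, mul_comm v u]
    split_ifs with h
    · change _ = thE (q - ((s : ℕ) + 1) - 1) k 1 u⁻¹ (u * v / u⁻¹)
      rw [thE_eq_thN_left hz, mul_comm u⁻¹, polar_div_mul _ hz, inv_inv]
      congr 1
      omega
    · change _ = thW 0 k (toC u⁻¹) (u * v)
      rw [show q - (s : ℕ) - 1 = 0 by omega, thN_eq_thW hu, one_mul]
  | branch_main s u v c h hc =>
    have hc0 := fst_ne_zero_of_toC_mul hc
    rw [xPow'_nearE_q hq hc, add_sub_cancel_left]
    change thE (q - s - 1) k 1 v u = _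
    by_cases huv : u.1 * v.1 ≠ 0
    · have hu := left_ne_zero_of_mul huv
      have hv := right_ne_zero_of_mul huv
      rw [thE_off _ _ _ hv hu, thW_off _ _ _ huv, mul_comm v u]
      congr 2
      have hu' := toC_ne_zero.2 hu
      have hv' := toC_ne_zero.2 hv
      obtain ⟨m, hm⟩ := Nat.exists_eq_add_of_lt s.2
      have e1 : toC (u * v) ^ q = toC (u * v) ^ ((s : ℕ) + m + 1) := by rw [← hm]
      rw [show q - (s : ℕ) - 1 = m by omega, e1, toC_mul]
      field_simp
      ring
    -- On the divisor this gluing occurs only where `w ≠ μ`. That leaves `u = 0`, `v ≠ 0` and `s =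
    -- 0`, the points of `E q` seen in the first branch chart.
    · have h' := h.resolve_left huv
      have hv : v.1 ≠ 0 := by
        rintro h0
        rw [toC_eq_zero.2 h0] at h'
        simp at h'
      have hu : u.1 = 0 := by
        by_contra h0
        exact huv (mul_ne_zero h0 hv)
      have hs : (s : ℕ) = 0 := by
        by_contra h0
        rw [toC_eq_zero.2 hu, zero_pow h0, zero_mul] at h'
        exact h' rfl
      have hq1 : q - 1 + 1 = q := by have := s.2; omega
      have hz : (v⁻¹ : Polar).1 ≠ 0 := inv_ne_zero hv
      rw [thE_eq_thN_left hv, thN_eq_thW hz, inv_inv, hs, Nat.sub_zero, hq1, mul_comm v u]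
      simp
  | branchEnd_main t z c h hc =>
    rw [xPow'_nearE_q hq hc, add_sub_cancel_left, thW_off _ _ _ h]
    change thW 0 k z t = _
    rw [thW_off _ _ _ h]
    have := toC_ne_zero.2 h
    congr 2
    rw [pow_zero, div_one, mul_div_cancel_left₀ _ (pow_ne_zero _ this)]

theorem xPow_off {μ : ℂ → ℂ} {k : ℕ} {p : Pre N q} (hp : divisorEq p ≠ 0) :
    xPow μ k p = th (xCoord μ p * tCoord p ^ k) 1 := by
  rcases p with ⟨t, x⟩ | ⟨j, u, v⟩ | ⟨t, v⟩ | ⟨s, u, v⟩ | ⟨t, z⟩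
  · change thW 0 k x t = th (x * toC t ^ k) 1
    rw [thW_off _ _ _ hp, pow_zero, div_one]
  · change thE j k 1 u v = th ((toC u ^ (j : ℕ) * toC v ^ ((j : ℕ) + 1))⁻¹ * toC (u * v) ^ k) 1
    rw [thE_off _ _ _ (left_ne_zero_of_mul hp) (right_ne_zero_of_mul hp), one_div]
  · change thN N k 1 t v = th ((toC t ^ N * toC v)⁻¹ * toC t ^ k) 1
    rw [thN_eq_thW (right_ne_zero_of_mul hp), thW_off _ _ _ (left_ne_zero_of_mul hp), one_mul,
      toC_inv, mul_inv_rev]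
    rfl
  · exact thW_off _ _ _ hp
  · exact thW_off _ _ _ hp

theorem xPow'_off {μ : ℂ → ℂ} {k : ℕ} (hq : q ≤ N) {p : Pre N q}
    (hp : divisorEq p ≠ 0) :
    xPow' μ k p = th ((xCoord μ p - μ (tCoord p) / tCoord p ^ q) * tCoord p ^ k) 1 := by
  rcases p with ⟨t, x⟩ | ⟨j, u, v⟩ | ⟨t, v⟩ | ⟨s, u, v⟩ | ⟨t, z⟩
  · change thW q k (x * toC (t ^ q) - μ (toC t)) t = th ((x - μ (toC t) / toC t ^ q) * toC t ^ k) 1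
    rw [thW_off _ _ _ hp, toC_pow, sub_div, mul_div_cancel_right₀]
    exact pow_ne_zero _ (toC_ne_zero.2 hp)
  · have hu := left_ne_zero_of_mul hp
    have hv := right_ne_zero_of_mul hp
    have hu' := toC_ne_zero.2 hu
    have hv' := toC_ne_zero.2 hv
    change (if q ≤ (j : ℕ) then
        thE j k (1 - μ (toC (u * v)) * toC (u ^ (j - q : ℕ) * v ^ (j + 1 - q : ℕ))) u v
      else thW q k (toC (u ^ (q - j : ℕ) * v ^ (q - j - 1 : ℕ)) - μ (toC (u * v))) (u * v)) =
      th (((toC u ^ (j : ℕ) * toC v ^ ((j : ℕ) + 1))⁻¹ - μ (toC (u * v)) / toC (u * v) ^ q) *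
        toC (u * v) ^ k) 1
    split_ifs with h
    · rw [thE_off _ _ _ hu hv]
      obtain ⟨m, hm⟩ := Nat.exists_eq_add_of_le h
      rw [hm, show q + m - q = m by omega, show q + m + 1 - q = m + 1 by omega]
      congr 2
      generalize μ (toC (u * v)) = μ'
      rw [toC_mul, toC_mul, toC_pow, toC_pow]
      field_simp
      ring
    · rw [thW_off _ _ _ hp]
      obtain ⟨m, hm⟩ := Nat.exists_eq_add_of_lt (not_le.1 h)
      rw [show q - (j : ℕ) = m + 1 by omega, Nat.add_sub_cancel, hm]
      congr 2
      generalize μ (toC (u * v)) = μ'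
      rw [toC_mul, toC_mul, toC_pow, toC_pow]
      field_simp
      ring
  · have ht := left_ne_zero_of_mul hp
    have hv := right_ne_zero_of_mul hp
    have ht' := toC_ne_zero.2 ht
    have hv' := toC_ne_zero.2 hv
    change thN N k (1 - μ (toC t) * toC (t ^ (N - q) * v)) t v =
      th (((toC t ^ N * toC v)⁻¹ - μ (toC t) / toC t ^ q) * toC t ^ k) 1
    rw [thN_eq_thW hv, thW_off _ _ _ ht]
    obtain ⟨m, rfl⟩ := Nat.exists_eq_add_of_le hq
    rw [Nat.add_sub_cancel_left, toC_inv, toC_mul, toC_pow]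
    congr 2
    field_simp
    ring
  · have hu := left_ne_zero_of_mul hp
    have hv := right_ne_zero_of_mul hp
    have hu' := toC_ne_zero.2 hu
    have hv' := toC_ne_zero.2 hv
    change thE (q - s - 1) k 1 v u = th (((μ (toC (u * v)) + toC u ^ (s : ℕ) *
      toC v ^ ((s : ℕ) + 1)) / toC (u * v) ^ q - μ (toC (u * v)) / toC (u * v) ^ q) *
      toC (u * v) ^ k) 1
    rw [thE_off _ _ _ hv hu, ← sub_div, add_sub_cancel_left, mul_comm v u]
    obtain ⟨m, hm⟩ := Nat.exists_eq_add_of_lt s.2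
    have e1 : toC (u * v) ^ q = toC (u * v) ^ ((s : ℕ) + m + 1) := by rw [← hm]
    rw [show q - (s : ℕ) - 1 = m by omega, e1]
    congr 2
    rw [toC_mul]
    field_simp
    ring
  · have ht' := toC_ne_zero.2 hp
    change thW 0 k z t = th (((μ (toC t) + toC t ^ q * z) / toC t ^ q - μ (toC t) / toC t ^ q) *
      toC t ^ k) 1
    rw [thW_off _ _ _ hp, ← sub_div, add_sub_cancel_left,
      mul_div_cancel_left₀ _ (pow_ne_zero _ ht'), pow_zero, div_one]

end charts

/-! ### Continuity in the charts -/

/-- The assumptions on `ψ = μ t / t ^ q`. -/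
structure PolarPart (R : ℝ) (N q : ℕ) (μ : ℂ → ℂ) : Prop where
  pos : 0 < R
  le : q ≤ N
  cont : ContinuousOn μ (Metric.ball 0 R)
  cases : (q = 0 ∧ μ = 0) ∨ (1 ≤ q ∧ μ 0 ≠ 0)

section continuity

variable {R : ℝ} {N q : ℕ} {μ : ℂ → ℂ}

theorem PolarPart.continuousAt (h : PolarPart R N q μ) {t : Polar} (ht : (t.1 : ℝ) < R) :
    ContinuousAt μ (toC t) := by
  refine h.cont.continuousAt (Metric.isOpen_ball.mem_nhds ?_)
  rwa [mem_ball_zero_iff, norm_toC]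

theorem PolarPart.continuousAt_comp (h : PolarPart R N q μ) {α : Type*} [TopologicalSpace α]
    {t : α → Polar} {a : α} (ht : ContinuousAt t a) (ha : ((t a).1 : ℝ) < R) :
    ContinuousAt (fun x => μ (toC (t x))) a :=
  ContinuousAt.comp (f := fun x => toC (t x)) (h.continuousAt ha)
    (continuous_toC.continuousAt.comp ht)

theorem PolarPart.ne_zero (h : PolarPart R N q μ) (hq : q ≠ 0) : μ 0 ≠ 0 := by
  rcases h.cases with h | h
  · exact absurd h.1 hq
  · exact h.2

theorem continuousAt_chart {X : Type*} [TopologicalSpace X] {f : Pre N q → X} {p : Pre N q}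
    (h : match p with
      | .inl a => ContinuousAt (fun a : Polar × ℂ => f (.inl a)) a
      | .inr (.inl (j, a)) => ContinuousAt (fun a : Polar × Polar => f (.inr (.inl (j, a)))) a
      | .inr (.inr (.inl a)) => ContinuousAt (fun a : Polar × Polar => f (.inr (.inr (.inl a)))) a
      | .inr (.inr (.inr (.inl (s, a)))) =>
          ContinuousAt (fun a : Polar × Polar => f (.inr (.inr (.inr (.inl (s, a)))))) a
      | .inr (.inr (.inr (.inr a))) =>
          ContinuousAt (fun a : Polar × ℂ => f (.inr (.inr (.inr (.inr a))))) a) :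
    ContinuousAt f p := by
  rcases p with a | ⟨j, a⟩ | a | ⟨s, a⟩ | a
  · exact IsOpenEmbedding.inl.continuousAt_iff.1 h
  · refine IsOpenEmbedding.inr.continuousAt_iff.1 (IsOpenEmbedding.inl.continuousAt_iff.1 ?_)
    exact continuousAt_prod_of_discrete_left.2 h
  · exact IsOpenEmbedding.inr.continuousAt_iff.1 (IsOpenEmbedding.inr.continuousAt_iff.1
      (IsOpenEmbedding.inl.continuousAt_iff.1 h))
  · refine IsOpenEmbedding.inr.continuousAt_iff.1 (IsOpenEmbedding.inr.continuousAt_iff.1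
      (IsOpenEmbedding.inr.continuousAt_iff.1 (IsOpenEmbedding.inl.continuousAt_iff.1 ?_)))
    exact continuousAt_prod_of_discrete_left.2 h
  · exact IsOpenEmbedding.inr.continuousAt_iff.1 (IsOpenEmbedding.inr.continuousAt_iff.1
      (IsOpenEmbedding.inr.continuousAt_iff.1 (IsOpenEmbedding.inr.continuousAt_iff.1 h)))

/-- The base chart has no denominator. The numerator of `x` is `1` on the crossing and end charts,
and it is `w` on the branch charts, where `InChart` keeps it away from `0`. -/
theorem continuousAt_xPow (h : PolarPart R N q μ) {k : ℕ} (hk : k ≤ N) {p : Pre N q}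
    (hp : InChart R μ p) : ContinuousAt (xPow μ k) p := by
  have hc := continuous_toC
  refine continuousAt_chart ?_
  rcases p with ⟨t, x⟩ | ⟨j, u, v⟩ | ⟨t, v⟩ | ⟨s, u, v⟩ | ⟨t, z⟩
  · exact continuousAt_thW (A := fun a : Polar × ℂ => a.2) (t := fun a => a.1) (by fun_prop)
      (by fun_prop) (.inl (Nat.zero_le _))
  · exact continuousAt_thE (A := fun a : Polar × Polar => 1) (u := fun a => a.1)
      (v := fun a => a.2) (by fun_prop) (by fun_prop) (by fun_prop) (.inl one_ne_zero)
  · exact continuousAt_thN hk (A := fun a : Polar × Polar => 1) (t := fun a => a.1)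
      (v := fun a => a.2) (by fun_prop) (by fun_prop) (by fun_prop) (.inl one_ne_zero)
  · have h1 := h.continuousAt_comp (t := fun a : Polar × Polar => a.1 * a.2) (a := (u, v))
      (by fun_prop) hp.1
    exact continuousAt_thW (A := fun a : Polar × Polar =>
      μ (toC (a.1 * a.2)) + toC a.1 ^ (s : ℕ) * toC a.2 ^ ((s : ℕ) + 1)) (t := fun a => a.1 * a.2)
      (h1.add (by fun_prop)) (by fun_prop) (.inr (.inl hp.2))
  · have h1 := h.continuousAt_comp (t := fun a : Polar × ℂ => a.1) (a := (t, z))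
      (by fun_prop) hp.2.1
    exact continuousAt_thW (A := fun a : Polar × ℂ => μ (toC a.1) + toC a.1 ^ q * a.2)
      (t := fun a => a.1) (h1.add (by fun_prop)) (by fun_prop) (.inr (.inl hp.2.2))

theorem PolarPart.base_ne_zero (h : PolarPart R N q μ) (hq : q ≠ 0) {t : Polar} (ht : t.1 = 0)
    (x : ℂ) : x * toC (t ^ q) - μ (toC t) ≠ 0 := by
  rw [toC_pow, toC_eq_zero.2 ht, zero_pow hq, mul_zero, zero_sub, neg_ne_zero]
  exact h.ne_zero hq

/-- On the divisor the numerator of `x'` could vanish only at the point `w = μ 0` of `E q`, which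
`InChart` removes from these charts. -/
theorem PolarPart.crossing_ne_zero (h : PolarPart R N q μ) {j : Fin N} (hj : q ≤ j) {u v : Polar}
    (hp : InChart R μ (crossing j u v : Pre N q)) (huv : u.1 = 0 ∨ v.1 = 0) :
    1 - μ (toC (u * v)) * toC (u ^ (j - q : ℕ) * v ^ (j + 1 - q : ℕ)) ≠ 0 := by
  rw [toC_mul, toC_mul, toC_pow, toC_pow]
  rcases huv with hu | hv
  · rw [toC_eq_zero.2 hu, zero_mul]
    rcases eq_or_lt_of_le hj with hj | hj
    · rcases h.cases with hq | hq
      · simp [hq.2]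
      · rw [← hj, Nat.sub_self, pow_zero, one_mul, Nat.add_sub_cancel_left, pow_one, sub_ne_zero]
        intro h1
        exact hp.2.2 ⟨hq.1, hj.symm, hu, by rw [mul_comm, ← h1]⟩
    · rw [zero_pow (by omega), zero_mul, mul_zero, sub_zero]
      exact one_ne_zero
  · rw [toC_eq_zero.2 hv, zero_pow (by omega), mul_zero, mul_zero, mul_zero, sub_zero]
    exact one_ne_zero

theorem PolarPart.crossing_ne_zero' (h : PolarPart R N q μ) {j : Fin N} (hj : ¬ q ≤ j)
    {u v : Polar} (hp : InChart R μ (crossing j u v : Pre N q)) (huv : u.1 = 0 ∨ v.1 = 0) :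
    toC (u ^ (q - j : ℕ) * v ^ (q - j - 1 : ℕ)) - μ (toC (u * v)) ≠ 0 := by
  have hq0 : q ≠ 0 := by omega
  have hm := h.ne_zero hq0
  rw [toC_mul, toC_mul, toC_pow, toC_pow]
  rcases huv with hu | hv
  · rw [toC_eq_zero.2 hu, zero_mul, zero_pow (by omega), zero_mul, zero_sub, neg_ne_zero]
    exact hm
  · rw [toC_eq_zero.2 hv, mul_zero]
    rcases Nat.eq_or_lt_of_le (not_le.1 hj) with hj | hj
    · rw [show q - (j : ℕ) - 1 = 0 by omega, show q - (j : ℕ) = 1 by omega, pow_one, pow_zero,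
        mul_one, sub_ne_zero]
      intro h1
      exact hp.2.1 ⟨by omega, hj, hv, h1⟩
    · rw [zero_pow (n := q - (j : ℕ) - 1) (by omega), mul_zero, zero_sub, neg_ne_zero]
      exact hm

theorem PolarPart.end_ne_zero (h : PolarPart R N q μ) {t v : Polar}
    (hp : InChart R μ (endChart t v : Pre N q)) (htv : t.1 = 0 ∨ v.1 = 0) :
    1 - μ (toC t) * toC (t ^ (N - q) * v) ≠ 0 := by
  rw [toC_mul, toC_pow]
  rcases htv with ht | hv
  · rw [toC_eq_zero.2 ht]
    rcases eq_or_lt_of_le h.le with hN | hN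
    · rcases h.cases with hq | hq
      · simp [hq.2]
      · rw [hN, Nat.sub_self, pow_zero, one_mul, sub_ne_zero]
        intro h1
        exact hp.2 ⟨hq.1, hN.symm, ht, by rw [mul_comm, ← h1]⟩
    · rw [zero_pow (by omega), zero_mul, mul_zero, sub_zero]
      exact one_ne_zero
  · rw [toC_eq_zero.2 hv, mul_zero, mul_zero, sub_zero]
    exact one_ne_zero

theorem continuousAt_xPow' (h : PolarPart R N q μ) {k : ℕ} (hk : k ≤ N) {p : Pre N q}
    (hp : InChart R μ p) : ContinuousAt (xPow' μ k) p := by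
  have hc := continuous_toC
  refine continuousAt_chart ?_
  rcases p with ⟨t, x⟩ | ⟨j, u, v⟩ | ⟨t, v⟩ | ⟨s, u, v⟩ | ⟨t, z⟩
  · have h1 := h.continuousAt_comp (t := fun a : Polar × ℂ => a.1) (a := (t, x)) (by fun_prop) hp
    refine continuousAt_thW (A := fun a : Polar × ℂ => a.2 * toC (a.1 ^ q) - μ (toC a.1))
      (t := fun a => a.1) (ContinuousAt.sub (by fun_prop) h1) (by fun_prop) ?_
    rcases eq_or_ne q 0 with hq | hq
    · exact .inl (hq ▸ Nat.zero_le _)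
    · by_cases ht : t.1 = 0
      · exact .inr (.inl (h.base_ne_zero hq ht x))
      · exact .inr (.inr ht)
  · have h1 := h.continuousAt_comp (t := fun a : Polar × Polar => a.1 * a.2) (a := (u, v))
      (by fun_prop) hp.1
    by_cases hj : q ≤ j
    · simp only [xPow', if_pos hj]
      refine continuousAt_thE (A := fun a : Polar × Polar =>
        1 - μ (toC (a.1 * a.2)) * toC (a.1 ^ (j - q : ℕ) * a.2 ^ (j + 1 - q : ℕ)))
        (u := fun a => a.1) (v := fun a => a.2)
        (continuousAt_const.sub (h1.mul (by fun_prop))) (by fun_prop) (by fun_prop) ?_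
      by_cases huv : u.1 = 0 ∨ v.1 = 0
      · exact .inl (h.crossing_ne_zero hj hp huv)
      · exact .inr (not_or.1 huv)
    · simp only [xPow', if_neg hj]
      refine continuousAt_thW (A := fun a : Polar × Polar =>
        toC (a.1 ^ (q - j : ℕ) * a.2 ^ (q - j - 1 : ℕ)) - μ (toC (a.1 * a.2)))
        (t := fun a => a.1 * a.2) (ContinuousAt.sub (by fun_prop) h1) (by fun_prop) ?_
      by_cases huv : u.1 = 0 ∨ v.1 = 0
      · exact .inr (.inl (h.crossing_ne_zero' hj hp huv))
      · exact .inr (.inr (mul_ne_zero (not_or.1 huv).1 (not_or.1 huv).2))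
  · have h1 := h.continuousAt_comp (t := fun a : Polar × Polar => a.1) (a := (t, v))
      (by fun_prop) hp.1
    refine continuousAt_thN hk (A := fun a : Polar × Polar =>
        1 - μ (toC a.1) * toC (a.1 ^ (N - q) * a.2)) (t := fun a => a.1)
      (v := fun a => a.2) (continuousAt_const.sub (h1.mul (by fun_prop))) (by fun_prop)
      (by fun_prop) ?_
    by_cases htv : t.1 = 0 ∨ v.1 = 0
    · exact .inl (h.end_ne_zero hp htv)
    · exact .inr (not_or.1 htv)
  · exact continuousAt_thE (A := fun a : Polar × Polar => 1) (u := fun a => a.2)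
      (v := fun a => a.1) (by fun_prop) (by fun_prop) (by fun_prop) (.inl one_ne_zero)
  · exact continuousAt_thW (A := fun a : Polar × ℂ => a.2) (t := fun a => a.1) (by fun_prop)
      (by fun_prop) (.inl (Nat.zero_le _))

end continuity

/-! ### The maps `psi` and `psi'` on the real blow-up -/

section global

variable {R : ℝ} {N q : ℕ} {μ : ℂ → ℂ}

theorem continuous_tPolar : Continuous (tPolar : Pre N q → Polar) := by
  refine continuous_iff_continuousAt.2 fun p => continuousAt_chart ?_
  rcases p with ⟨t, x⟩ | ⟨j, u, v⟩ | ⟨t, v⟩ | ⟨s, u, v⟩ | ⟨t, z⟩ <;>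
    simp only [tPolar] <;> fun_prop

theorem BlowUp.continuous_proj : Continuous (BlowUp.proj : BlowUp R N q μ → Polar) :=
  continuous_quot_lift _ (continuous_tPolar.comp continuous_subtype_val)

theorem BlowUp.continuous_mk : Continuous (BlowUp.mk : _ → BlowUp R N q μ) := continuous_quot_mk

/-- The sum of the `f k / ϑ ^ k` for `k ≤ N`, where `ϑ` is the direction of `t`. -/
noncomputable def sumPow (t : Polar) (N : ℕ) (f : ℕ → ℂ) : ℂ :=
  ∑ k ∈ Finset.range (N + 1), ((t.2 : ℂ)⁻¹) ^ k * f k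

/-- The embedding of the fibres off the preimage of `w = μ 0`. -/
noncomputable def BlowUp.psi (h : PolarPart R N q μ) : BlowUp R N q μ → ℂ :=
  Quot.lift (fun p => sumPow (tPolar p.1) N (fun k => xPow μ k p.1)) (fun p p' hp => by
    simp only [hp.tPolar_eq, hp.xPow_eq h.le])

/-- The embedding of the fibres off the preimage of `w = 0`. -/
noncomputable def BlowUp.psi' (h : PolarPart R N q μ) : BlowUp R N q μ → ℂ :=
  Quot.lift (fun p => sumPow (tPolar p.1) N (fun k => xPow' μ k p.1)) (fun p p' hp => by
    simp only [hp.tPolar_eq, hp.xPow'_eq h.le])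

theorem BlowUp.psi_mk (h : PolarPart R N q μ) (p : {p : Pre N q // InChart R μ p}) :
    BlowUp.psi h (BlowUp.mk p) = sumPow (tPolar p.1) N (fun k => xPow μ k p.1) := rfl

theorem BlowUp.psi'_mk (h : PolarPart R N q μ) (p : {p : Pre N q // InChart R μ p}) :
    BlowUp.psi' h (BlowUp.mk p) = sumPow (tPolar p.1) N (fun k => xPow' μ k p.1) := rfl

theorem continuous_sumPow {α : Type*} [TopologicalSpace α] {t : α → Polar} {f : ℕ → α → ℂ}
    (ht : Continuous t) (hf : ∀ k ≤ N, Continuous (f k)) :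
    Continuous fun a => sumPow (t a) N (fun k => f k a) := by
  unfold sumPow
  refine continuous_finsetSum _ fun k hk => ?_
  have hk := hf k (by simpa [Nat.lt_succ_iff] using hk)
  have hc : Continuous fun a => ((t a).2 : ℂ) := by fun_prop
  exact ((hc.inv₀ fun a => Circle.coe_ne_zero _).pow k).mul hk

theorem BlowUp.continuous_psi (h : PolarPart R N q μ) : Continuous (BlowUp.psi h) :=
  continuous_quot_lift _ (continuous_sumPow (continuous_tPolar.comp continuous_subtype_val)
    fun _ hk => continuous_iff_continuousAt.2 fun p =>
      (continuousAt_xPow h hk p.2).comp continuous_subtype_val.continuousAt)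

theorem BlowUp.continuous_psi' (h : PolarPart R N q μ) : Continuous (BlowUp.psi' h) :=
  continuous_quot_lift _ (continuous_sumPow (continuous_tPolar.comp continuous_subtype_val)
    fun _ hk => continuous_iff_continuousAt.2 fun p =>
      (continuousAt_xPow' h hk p.2).comp continuous_subtype_val.continuousAt)

end global

/-! ### Polar pictures of the values -/

section values

/-- The point of the ray through `X` at distance `n + |X| / (1 + |X|)` from `0`. -/
noncomputable def shift (n : ℕ) (X : ℂ) : ℂ := X / (‖X‖ : ℂ) * ((n + ‖X‖ / (1 + ‖X‖) : ℝ) : ℂ)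

/-- The direction `1 / (ϑ ^ j v)` at distance `j + 1 / (1 + |v|)` from `0`. -/
noncomputable def level (ϑ : Circle) (j : ℕ) (v : Polar) : ℂ :=
  ((ϑ : ℂ) ^ j * (v.2 : ℂ))⁻¹ * ((j + 1 / (1 + v.1) : ℝ) : ℂ)

theorem norm_level (ϑ : Circle) (j : ℕ) (v : Polar) : ‖level ϑ j v‖ = j + 1 / (1 + (v.1 : ℝ)) := by
  rw [level, norm_mul, norm_inv, norm_mul, norm_pow, Circle.norm_coe, Circle.norm_coe, one_pow, mul_one,
    inv_one, one_mul, Complex.norm_real, Real.norm_of_nonneg (by positivity)]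

theorem norm_shift {n : ℕ} {X : ℂ} (h : n = 0 ∨ X ≠ 0) : ‖shift n X‖ = n + ‖X‖ / (1 + ‖X‖) := by
  rw [shift, norm_mul, norm_div, Complex.norm_real, Complex.norm_real, norm_norm,
    Real.norm_of_nonneg (by positivity)]
  by_cases hX : X = 0
  · obtain rfl := h.resolve_right (not_not.2 hX)
    simp [hX]
  · rw [div_self (norm_ne_zero_iff.2 hX), one_mul]

theorem frac_lt_one {a : ℝ} (ha : 0 ≤ a) : a / (1 + a) < 1 := by
  rw [div_lt_one (by positivity)]; linarith

theorem frac_inj {a b : ℝ} (ha : 0 ≤ a) (hb : 0 ≤ b) (h : a / (1 + a) = b / (1 + b)) : a = b := by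
  rw [div_eq_div_iff (by positivity) (by positivity)] at h
  linarith

theorem one_frac_inj {a b : ℝ} (ha : 0 ≤ a) (hb : 0 ≤ b) (h : 1 / (1 + a) = 1 / (1 + b)) :
    a = b := by
  rw [div_eq_div_iff (by positivity) (by positivity)] at h
  linarith

theorem frac_mono {a b : ℝ} (ha : 0 ≤ a) (h : a ≤ b) : a / (1 + a) ≤ b / (1 + b) := by
  have hb := ha.trans h
  rw [div_le_div_iff₀ (by positivity) (by positivity)]
  nlinarith

theorem norm_shift_lt {n : ℕ} {X : ℂ} (h : n = 0 ∨ X ≠ 0) : ‖shift n X‖ < n + 1 := by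
  rw [norm_shift h]
  linarith [frac_lt_one (norm_nonneg X)]

theorem le_norm_shift {n : ℕ} {X : ℂ} (h : n = 0 ∨ X ≠ 0) : n ≤ ‖shift n X‖ := by
  rw [norm_shift h]
  have : 0 ≤ ‖X‖ / (1 + ‖X‖) := by positivity
  linarith

theorem lt_norm_shift {n : ℕ} {X : ℂ} (h : X ≠ 0) : n < ‖shift n X‖ := by
  rw [norm_shift (.inr h)]
  have : 0 < ‖X‖ := norm_pos_iff.2 h
  have : 0 < ‖X‖ / (1 + ‖X‖) := by positivity
  linarith

theorem shift_inj {n : ℕ} {X Y : ℂ} (hX : n = 0 ∨ X ≠ 0) (hY : n = 0 ∨ Y ≠ 0)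
    (h : shift n X = shift n Y) : X = Y := by
  have h1 := congrArg norm h
  rw [norm_shift hX, norm_shift hY] at h1
  have h2 := frac_inj (norm_nonneg X) (norm_nonneg Y) (by linarith)
  unfold shift at h
  rw [h2] at h
  by_cases hX0 : X = 0
  · rw [hX0, norm_zero] at h2
    rw [hX0, norm_eq_zero.1 h2.symm]
  · have hX1 : ‖Y‖ ≠ 0 := h2 ▸ norm_ne_zero_iff.2 hX0
    have h3 : ((n + ‖Y‖ / (1 + ‖Y‖) : ℝ) : ℂ) ≠ 0 := by
      rw [Complex.ofReal_ne_zero]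
      have : 0 < ‖Y‖ := lt_of_le_of_ne (norm_nonneg _) hX1.symm
      positivity
    have h4 := mul_right_cancel₀ h3 h
    exact (div_left_inj' (Complex.ofReal_ne_zero.2 hX1)).1 h4

theorem shift_re_neg {n : ℕ} {X : ℂ} (hX : X ≠ 0) : (shift n X).re < 0 ↔ X.re < 0 := by
  have h0 : 0 < ‖X‖ := norm_pos_iff.2 hX
  have e : shift n X = (((n + ‖X‖ / (1 + ‖X‖)) / ‖X‖ : ℝ) : ℂ) * X := by
    unfold shift
    push_cast
    ring
  rw [e, Complex.re_ofReal_mul]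
  have : 0 < (n + ‖X‖ / (1 + ‖X‖)) / ‖X‖ := by positivity
  exact ⟨fun h => by by_contra h'; nlinarith, fun h => by nlinarith⟩

theorem toC_inv_eq {v : Polar} : toC v⁻¹ = (((v.1 : ℝ) : ℂ))⁻¹ * (v.2 : ℂ)⁻¹ := by
  rw [toC_inv, toC, mul_inv]

/-- For non-zero radius, the point of `E j` is also given by the finite number `1 / (v ϑ ^ j)`. In
this form `m` can be subtracted from it. -/
theorem level_eq_shift (ϑ : Circle) (j : ℕ) {v : Polar} (hv : v.1 ≠ 0) :
    level ϑ j v = shift j (toC v⁻¹ * ((ϑ : ℂ)⁻¹) ^ j) := by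
  have hv' : (0 : ℝ) < v.1 := NNReal.coe_pos.2 (pos_iff_ne_zero.2 hv)
  have hn : ‖toC v⁻¹ * ((ϑ : ℂ)⁻¹) ^ j‖ = (v.1 : ℝ)⁻¹ := by
    rw [norm_mul, norm_pow, norm_inv, Circle.norm_coe, inv_one, one_pow, mul_one, norm_toC]
    simp
  have e1 : (v.1 : ℝ)⁻¹ / (1 + (v.1 : ℝ)⁻¹) = 1 / (1 + v.1) := by
    field_simp
    ring
  have hv'' : ((v.1 : ℝ) : ℂ) ≠ 0 := by exact_mod_cast hv'.ne'
  rw [shift, level, hn, e1, toC_inv_eq]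
  congr 1
  rw [mul_inv, inv_pow, Complex.ofReal_inv]
  field_simp

/-- The norm lies in the interval `(j, j + 1]`, so it determines `j` and then the radius of `v`;
what remains is the direction. -/
theorem level_inj {ϑ : Circle} {j j' : ℕ} {v v' : Polar} (h : level ϑ j v = level ϑ j' v') :
    j = j' ∧ v = v' := by
  have h1 := congrArg norm h
  rw [norm_level, norm_level] at h1
  have b : ∀ w : Polar, 0 < 1 / (1 + (w.1 : ℝ)) ∧ 1 / (1 + (w.1 : ℝ)) ≤ 1 := by
    intro w
    refine ⟨by positivity, ?_⟩
    rw [div_le_one (by positivity)]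
    linarith [w.1.coe_nonneg]
  have hj : j = j' := by
    have h2 := b v
    have h3 := b v'
    have h4 : (j : ℝ) < j' + 1 := by linarith
    have h5 : (j' : ℝ) < j + 1 := by linarith
    norm_cast at h4 h5
    omega
  subst hj
  refine ⟨rfl, ?_⟩
  have h2 : (v.1 : ℝ) = v'.1 := one_frac_inj v.1.coe_nonneg v'.1.coe_nonneg (by linarith)
  unfold level at h
  rw [h2] at h
  have h3 : ((j + 1 / (1 + v'.1) : ℝ) : ℂ) ≠ 0 := by
    rw [Complex.ofReal_ne_zero]
    have := (b v').1
    positivity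
  have h4 := mul_right_cancel₀ h3 h
  have h5 := mul_left_cancel₀ (pow_ne_zero _ (Circle.coe_ne_zero ϑ)) (inv_injective h4)
  exact Prod.ext (NNReal.coe_injective h2) (Circle.coe_injective h5)

/-- The open unit disc and the annuli overlap only in the part of `E 0` which is glued to the base
chart. -/
theorem shift_zero_eq_level {ϑ : Circle} {j : ℕ} {v : Polar} {x : ℂ}
    (h : shift 0 x = level ϑ j v) : j = 0 ∧ v.1 ≠ 0 ∧ toC v * x = 1 := by
  have h1 := congrArg norm h
  rw [norm_level, norm_shift (.inl rfl)] at h1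
  have h2 := frac_lt_one (norm_nonneg x)
  have h3 : 0 < 1 / (1 + (v.1 : ℝ)) := by positivity
  have hj : j = 0 := by
    have : (j : ℝ) < 1 := by push_cast at h1; linarith
    norm_cast at this
    omega
  subst hj
  have hv : v.1 ≠ 0 := by
    intro h0
    rw [h0] at h1
    simp at h1
    linarith
  refine ⟨rfl, hv, ?_⟩
  rw [level_eq_shift ϑ 0 hv, pow_zero, mul_one] at h
  rw [shift_inj (.inl rfl) (.inl rfl) h, ← toC_mul, polar_mul_inv hv, toC_one]

/-- Every number is of the form `shift 0 x` or `level ϑ j v`. -/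
theorem exists_level (ϑ : Circle) (z : ℂ) :
    (∃ x, shift 0 x = z ∧ ‖z‖ < 1) ∨
      ∃ j v, level ϑ j v = z ∧ (j : ℝ) < ‖z‖ ∧ ‖z‖ ≤ j + 1 ∧ (v.1 = 0 ↔ ‖z‖ = j + 1) := by
  rcases lt_or_ge ‖z‖ 1 with hz | hz
  · left
    refine ⟨z / ((1 - ‖z‖ : ℝ) : ℂ), ?_, hz⟩
    have h1 : 0 < 1 - ‖z‖ := by linarith
    have hn : ‖z / ((1 - ‖z‖ : ℝ) : ℂ)‖ = ‖z‖ / (1 - ‖z‖) := by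
      rw [norm_div, Complex.norm_real, Real.norm_of_nonneg h1.le]
    unfold shift
    rw [hn]
    have e : ‖z‖ / (1 - ‖z‖) / (1 + ‖z‖ / (1 - ‖z‖)) = ‖z‖ := by
      field_simp
      ring
    rw [e]
    by_cases h0 : z = 0
    · simp [h0]
    · have h2 : (‖z‖ : ℂ) ≠ 0 := by exact_mod_cast norm_ne_zero_iff.2 h0
      have h3 : ((1 - ‖z‖ : ℝ) : ℂ) ≠ 0 := by exact_mod_cast h1.ne'
      push_cast at h3 ⊢
      field_simp
      simp
  · right
    have hz0 : z ≠ 0 := by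
      rintro rfl
      norm_num at hz
    obtain ⟨j, hj⟩ : ∃ j : ℕ, ⌈‖z‖⌉₊ = j + 1 :=
      Nat.exists_eq_succ_of_ne_zero (Nat.ceil_pos.2 (by linarith)).ne'
    have hj1 : ‖z‖ ≤ j + 1 := by
      have := Nat.le_ceil ‖z‖
      rw [hj] at this
      exact_mod_cast this
    have hj2 : (j : ℝ) < ‖z‖ := Nat.lt_ceil.1 (by omega)
    have h1 : 0 < ‖z‖ - j := by linarith
    have h2 : (0 : ℝ) ≤ (j + 1 - ‖z‖) / (‖z‖ - j) := div_nonneg (by linarith) h1.le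
    have h3 : ‖z / (‖z‖ : ℂ)‖ = 1 := by
      rw [norm_div, Complex.norm_real, norm_norm, div_self (norm_ne_zero_iff.2 hz0)]
    have h4 : (‖z‖ : ℂ) ≠ 0 := by exact_mod_cast norm_ne_zero_iff.2 hz0
    have h5 : ‖((ϑ : ℂ) ^ j * (z / (‖z‖ : ℂ)))⁻¹‖ = 1 := by
      rw [norm_inv, norm_mul, norm_pow, Circle.norm_coe, h3, one_pow, mul_one, inv_one]
    obtain ⟨e, he⟩ : ∃ e : Circle, (e : ℂ) = ((ϑ : ℂ) ^ j * (z / (‖z‖ : ℂ)))⁻¹ :=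
      ⟨⟨_, mem_sphere_zero_iff_norm.2 h5⟩, rfl⟩
    -- The radius solves `j + 1 / (1 + r) = ‖z‖`.
    obtain ⟨r, hr⟩ : ∃ r : ℝ≥0, (r : ℝ) = (j + 1 - ‖z‖) / (‖z‖ - j) := ⟨⟨_, h2⟩, rfl⟩
    refine ⟨j, (r, e), ?_, hj2, hj1, ?_⟩
    · have e1 : (j : ℝ) + 1 / (1 + (j + 1 - ‖z‖) / (‖z‖ - j)) = ‖z‖ := by
        field_simp
        ring
      have h6 := pow_ne_zero j (Circle.coe_ne_zero ϑ)
      rw [level, hr, e1, he]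
      field_simp
    · rw [← NNReal.coe_eq_zero, hr, div_eq_zero_iff]
      constructor
      · rintro (h | h) <;> linarith
      · intro h
        left
        linarith

theorem th_eq_inv (A : ℂ) (B : Polar) : th A B = A * (B.2 : ℂ)⁻¹ / ((‖A‖ + B.1 : ℝ) : ℂ) := by
  rw [th, ← Circle.coe_inv_eq_conj, Circle.coe_inv]

theorem thN_of_le {j k : ℕ} (h : k ≤ j) (A : ℂ) (t v : Polar) :
    thN j k A t v = th A (t ^ (j - k) * v) := if_pos h

theorem thN_of_lt {j k : ℕ} (h : j < k) (A : ℂ) (t v : Polar) :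
    thN j k A t v = th (A * toC (t ^ (k - j) * v⁻¹)) 1 := if_neg (not_le.2 h)

theorem coe_pow_mul_snd (t v : Polar) (n : ℕ) :
    (((t ^ n * v).2 : Circle) : ℂ) = (t.2 : ℂ) ^ n * (v.2 : ℂ) := by
  rw [Prod.snd_mul, Prod.pow_snd, Circle.coe_mul, Circle.coe_pow]

theorem inv_pow_mul_div (a b A n : ℂ) (k m : ℕ) :
    a⁻¹ ^ k * (A * (a ^ (m + 1) * b)⁻¹ / n) = A / n * (a ^ (k + m + 1) * b)⁻¹ := by
  rw [inv_pow, add_assoc, pow_add a k (m + 1), mul_assoc (a ^ k), mul_inv (a ^ k)]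
  ring

theorem thN_eq_of_lt {j k : ℕ} (h : k < j) {A : ℂ} {t : Polar} (ht : t.1 = 0) (v : Polar) :
    ((t.2 : ℂ)⁻¹) ^ k * thN j k A t v = A / (‖A‖ : ℂ) * ((t.2 : ℂ) ^ j * (v.2 : ℂ))⁻¹ := by
  obtain ⟨m, rfl⟩ := Nat.exists_eq_add_of_lt h
  rw [thN_of_le h.le, th_eq_inv, coe_pow_mul_snd, mul_fst, Prod.pow_fst, ht,
    show k + m + 1 - k = m + 1 by omega, zero_pow (by omega), zero_mul, NNReal.coe_zero, add_zero]
  exact inv_pow_mul_div _ _ _ _ _ _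

theorem thN_eq_of_gt {j k : ℕ} (h : j < k) {A : ℂ} {t : Polar} (ht : t.1 = 0) (v : Polar) :
    thN j k A t v = 0 := by
  rw [thN_of_lt h, show toC (t ^ (k - j) * v⁻¹) = 0 by
    rw [toC_eq_zero, mul_fst, Prod.pow_fst, ht, zero_pow (by omega), zero_mul]]
  simp [th]

/-- The `j` terms with `k < j` are infinite points, all equal to one unit vector after the twist by
`ϑ ^ (-k)`. The term `k = j` adds a fraction of this vector, and the terms with `k > j` vanish. -/
theorem sumPow_thN {N j : ℕ} (hj : j ≤ N) {A : ℂ} (hA : A ≠ 0) {t : Polar} (ht : t.1 = 0)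
    (v : Polar) :
    sumPow t N (fun k => thN j k A t v) =
      A / (‖A‖ : ℂ) * ((t.2 : ℂ) ^ j * (v.2 : ℂ))⁻¹ * ((j + ‖A‖ / (‖A‖ + v.1) : ℝ) : ℂ) := by
  have hA' : (‖A‖ : ℂ) ≠ 0 := by exact_mod_cast norm_ne_zero_iff.2 hA
  rw [sumPow, ← Finset.sum_subset (Finset.range_mono (Nat.succ_le_succ hj)), Finset.sum_range_succ]
  · rw [Finset.sum_congr rfl fun k hk => thN_eq_of_lt (Finset.mem_range.1 hk) ht v,
      Finset.sum_const, Finset.card_range, nsmul_eq_mul, thN_of_le le_rfl, Nat.sub_self, pow_zero,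
      one_mul, th_eq_inv]
    have h3 : ((‖A‖ + v.1 : ℝ) : ℂ) ≠ 0 := by
      rw [Complex.ofReal_ne_zero]
      have := norm_pos_iff.2 hA
      positivity
    have h1 := Circle.coe_ne_zero t.2
    have h2 := Circle.coe_ne_zero v.2
    push_cast at h3 ⊢
    generalize (t.2 : ℂ) = a at h1 ⊢
    generalize (v.2 : ℂ) = b at h2 ⊢
    rw [inv_pow]
    field_simp
  · intro k _ hk
    rw [Finset.mem_range, not_lt] at hk
    rw [thN_eq_of_gt (by omega) ht, mul_zero]

theorem sumPow_thN_one {N j : ℕ} (hj : j ≤ N) {t : Polar} (ht : t.1 = 0) (v : Polar) :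
    sumPow t N (fun k => thN j k 1 t v) = level t.2 j v := by
  rw [sumPow_thN hj one_ne_zero ht v, level]
  simp

theorem sumPow_thW {N n : ℕ} (hn : n ≤ N) {A : ℂ} (hA : n = 0 ∨ A ≠ 0) {t : Polar} (ht : t.1 = 0) :
    sumPow t N (fun k => thW n k A t) = shift n (A * ((t.2 : ℂ)⁻¹) ^ n) := by
  by_cases hA0 : A = 0
  · obtain rfl := hA.resolve_right (not_not.2 hA0)
    subst hA0
    simp [sumPow, thW, th, shift]
  · have e : (fun k => thW n k A t) = fun k => thN n k A t 1 := by
      ext k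
      rw [thN_eq_thW (by exact one_ne_zero), inv_one, toC_one, mul_one]
    rw [e, sumPow_thN hn hA0 ht, shift, norm_mul, norm_pow, norm_inv, Circle.norm_coe, inv_one,
      one_pow, mul_one, add_comm 1 ‖A‖, inv_pow]
    simp only [Prod.snd_one, Prod.fst_one, NNReal.coe_one, mul_one, Circle.coe_one]
    ring

/-- Here `v` may vanish too, so the corners are included: for `k > j` the radius `0` of `u` makes
both sides `0`. -/
theorem thE_eq_thN_of_fst {j k : ℕ} {A : ℂ} {u v : Polar} (hu : u.1 = 0) :
    thE j k A u v = thN j k A (u * v) v := by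
  unfold thE thN
  split_ifs with h
  · rw [mul_pow, mul_assoc, ← pow_succ, Nat.sub_add_comm h]
  · have e1 : toC (u ^ (k - j) * v ^ (k - j - 1)) = 0 := by
      rw [toC_eq_zero, mul_fst, Prod.pow_fst, hu, zero_pow (by omega), zero_mul]
    have e2 : toC ((u * v) ^ (k - j) * v⁻¹) = 0 := by
      rw [toC_eq_zero, mul_fst, Prod.pow_fst, mul_fst, hu, zero_mul, zero_pow (by omega), zero_mul]
    rw [e1, e2]

end values

/-! ### Coordinates on a fibre and the values there -/

section fibre

variable {R : ℝ} {N q : ℕ} {μ : ℂ → ℂ} {t : Polar}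

theorem div_fst_eq_zero (ht : t.1 = 0) (v : Polar) : (t / v).1 = 0 := by
  rw [Prod.fst_div, ht, zero_div]

/-- All radii involved are `0`, so a default value of the division does no harm, and the directions
cancel. -/
theorem polar_div_mul_of_fst (ht : t.1 = 0) (v : Polar) : t / v * v = t := by
  ext
  · simp [ht]
  · simp

theorem eq_mul_div {u v : Polar} (hv : v.1 = 0) : v = u * v / u := by
  ext
  · simp [hv]
  · simp

theorem inChart_base (h : PolarPart R N q μ) (ht : t.1 = 0) (x : ℂ) :
    InChart R μ (base t x : Pre N q) := by
  change ((t.1 : ℝ≥0) : ℝ) < R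
  rw [ht]
  exact h.pos

theorem inChart_branchEnd (h : PolarPart R N q μ) (ht : t.1 = 0) (hq : 1 ≤ q) (z : ℂ) :
    InChart R μ (branchEnd t z : Pre N q) := by
  refine ⟨hq, ?_, ?_⟩
  · rw [ht]
    exact h.pos
  · rw [toC_eq_zero.2 ht, zero_pow (by omega), zero_mul, add_zero]
    exact h.ne_zero (by omega)

theorem inChart_branch (h : PolarPart R N q μ) (ht : t.1 = 0) (s : Fin q) (u : Polar) :
    InChart R μ (branch s u (t / u) : Pre N q) := by
  have hs : q ≠ 0 := by have := s.2; omega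
  refine ⟨?_, ?_⟩
  · rw [div_fst_eq_zero ht, mul_zero]
    exact h.pos
  · rw [toC_mul, toC_eq_zero.2 (div_fst_eq_zero ht u), zero_pow (by omega), mul_zero, mul_zero,
      add_zero]
    exact h.ne_zero hs

theorem inChart_nearE (h : PolarPart R N q μ) (ht : t.1 = 0) {j : ℕ} (hj : j ≤ N) {v : Polar}
    (hv : 1 ≤ q → j = q → toC v * μ 0 ≠ 1) : InChart R μ (nearE j t v : Pre N q) := by
  unfold nearE
  split_ifs with hjN
  · refine ⟨?_, ?_, ?_⟩
    · rw [div_fst_eq_zero ht, zero_mul]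
      exact h.pos
    · rintro ⟨hq, -, -, h0⟩
      rw [toC_eq_zero.2 (div_fst_eq_zero ht v)] at h0
      exact h.ne_zero (by omega) h0.symm
    · rintro ⟨hq, h1, -, h2⟩
      exact hv hq h1 h2
  · refine ⟨by rw [ht]; exact h.pos, ?_⟩
    rintro ⟨hq, h1, -, h2⟩
    exact hv hq (by omega) h2

theorem InChart.nearE_q (ht : t.1 = 0) (hq : 1 ≤ q) (hqN : q ≤ N) {v : Polar}
    (hp : InChart R μ (nearE q t v : Pre N q)) : toC v * μ 0 ≠ 1 := by
  intro h1
  unfold nearE at hp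
  split_ifs at hp with h
  · exact hp.2.2 ⟨hq, rfl, div_fst_eq_zero ht v, h1⟩
  · exact hp.2 ⟨hq, by omega, ht, h1⟩

/-- A point of the fibre is given by a coordinate on one of the exceptional curves which do not
come from the blow-ups over `w = μ 0`. -/
def OnMain (R : ℝ) (N q : ℕ) (μ : ℂ → ℂ) (t : Polar) (ζ : BlowUp R N q μ) : Prop :=
  (∃ x hp, ζ = BlowUp.mk ⟨base t x, hp⟩) ∨ ∃ j ≤ N, ∃ v hp, ζ = BlowUp.mk ⟨nearE j t v, hp⟩

/-- A point of the fibre is given by a coordinate on one of the exceptional curves which come from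
the blow-ups over `w = μ 0`. -/
def OnBranch (R : ℝ) (N q : ℕ) (μ : ℂ → ℂ) (t : Polar) (ζ : BlowUp R N q μ) : Prop :=
  (∃ z hp, ζ = BlowUp.mk ⟨branchEnd t z, hp⟩) ∨ ∃ s u hp, ζ = BlowUp.mk ⟨branch s u (t / u), hp⟩

theorem BlowUp.mk_eq {p p' : Pre N q} (hp : InChart R μ p) (hp' : InChart R μ p')
    (h : Glue μ p p') : (BlowUp.mk ⟨p, hp⟩ : BlowUp R N q μ) = BlowUp.mk ⟨p', hp'⟩ :=
  Quot.sound h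

/-- If `u v` has radius `0`, one of the coordinates has radius `0` and the other one is a coordinate
on the curve. A point with `u = 0`, `v ≠ 0` of the branch chart `s` lies on `E' s`: for `s = 0` this
is the main curve `E q`, and for `s > 0` the chart `s - 1` describes it. -/
theorem onMain_or_onBranch (h : PolarPart R N q μ) (ht : t.1 = 0) {ζ : BlowUp R N q μ}
    (hζ : ζ.proj = t) : OnMain R N q μ t ζ ∨ OnBranch R N q μ t ζ := by
  induction ζ using Quot.ind with | mk a
  obtain ⟨p, hp⟩ := a
  have hζ : tPolar p = t := hζ
  rcases p with ⟨t', x⟩ | ⟨j, u, v⟩ | ⟨t', v⟩ | ⟨s, u, v⟩ | ⟨t', z⟩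
  · obtain rfl : t' = t := hζ
    exact .inl (.inl ⟨x, hp, rfl⟩)
  · have hζ : u * v = t := hζ
    by_cases hu : u.1 = 0
    · refine .inl (.inr ⟨j, j.2.le, v, ?_⟩)
      have e : (nearE j t v : Pre N q) = crossing j u v := by
        rw [nearE, dif_pos j.2, ← hζ, mul_comm u v, ← eq_mul_div hu]
      rw [e]
      exact ⟨hp, rfl⟩
    · have hv : v.1 = 0 := by
        rw [← hζ] at ht
        exact (mul_eq_zero.1 ht).resolve_left hu
      have hc : InChart R μ (nearE (j + 1) t u⁻¹ : Pre N q) := by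
        refine inChart_nearE h ht (by omega) fun hq hj h1 => ?_
        rw [toC_inv] at h1
        refine hp.2.1 ⟨hq, hj, hv, ?_⟩
        have := toC_ne_zero.2 hu
        field_simp at h1
        exact h1.symm
      refine .inl (.inr ⟨j + 1, by omega, u⁻¹, hc, ?_⟩)
      refine BlowUp.mk_eq hp hc ?_
      rw [← hζ]
      exact Glue.crossing j u v hu
  · obtain rfl : t' = t := hζ
    refine .inl (.inr ⟨N, le_rfl, v, ?_⟩)
    have e : (nearE N t' v : Pre N q) = endChart t' v := by
      rw [nearE, dif_neg (lt_irrefl _)]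
    rw [e]
    exact ⟨hp, rfl⟩
  · have hζ : u * v = t := hζ
    by_cases hv : v.1 = 0
    · refine .inr (.inr ⟨s, u, ?_⟩)
      rw [← hζ, ← eq_mul_div hv]
      exact ⟨hp, rfl⟩
    · have hu : u.1 = 0 := by
        rw [← hζ] at ht
        exact (mul_eq_zero.1 ht).resolve_right hv
      have hq : 1 ≤ q := by have := s.2; omega
      rcases Nat.eq_zero_or_eq_succ_pred (s : ℕ) with hs | hs
      · have hp2 := hp.2
        rw [hs, pow_zero, one_mul, zero_add, pow_one] at hp2
        obtain ⟨c, hc⟩ := exists_toC (μ (toC (u * v)) + toC v)⁻¹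
        have h1 : toC c * (μ (toC (u * v)) + toC v) = 1 := by rw [hc, inv_mul_cancel₀ hp2]
        have hcc : InChart R μ (nearE q t c : Pre N q) := by
          refine inChart_nearE h ht h.le fun _ _ h2 => ?_
          rw [hζ, toC_eq_zero.2 ht, mul_add, h2, add_eq_left] at h1
          exact mul_ne_zero (toC_ne_zero.2 (fst_ne_zero_of_toC_mul h2)) (toC_ne_zero.2 hv) h1
        refine .inl (.inr ⟨q, h.le, c, hcc, BlowUp.mk_eq hp hcc ?_⟩)
        rw [← hζ]
        refine Glue.branch_main s u v c (.inr ?_) ?_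
        · rw [hs, pow_zero, one_mul, zero_add, pow_one]
          exact toC_ne_zero.2 hv
        · rw [hs, pow_zero, one_mul, zero_add, pow_one]
          exact h1
      · have hs1 : (s : ℕ) - 1 < q := by have := s.2; omega
        have hb := inChart_branch h ht (N := N) ⟨s - 1, hs1⟩ v⁻¹
        refine .inr (.inr ⟨⟨s - 1, hs1⟩, v⁻¹, hb, (BlowUp.mk_eq hb hp ?_).symm⟩)
        have g := Glue.branch (N := N) (μ := μ) ⟨(s : ℕ) - 1, hs1⟩ v⁻¹ (t / v⁻¹) (inv_ne_zero hv)
        have e : (nearE' ((s : ℕ) - 1 + 1) (v⁻¹ * (t / v⁻¹)) v⁻¹⁻¹ : Pre N q) = branch s u v := by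
          have hlt : (s : ℕ) - 1 + 1 < q := by have := s.2; omega
          have hsf : (⟨(s : ℕ) - 1 + 1, hlt⟩ : Fin q) = s := Fin.ext hs.symm
          rw [nearE', dif_pos hlt, hsf, mul_comm v⁻¹, polar_div_mul_of_fst ht, inv_inv, ← hζ,
            mul_comm u v, ← eq_mul_div hu]
        change Glue μ (branch ⟨(s : ℕ) - 1, hs1⟩ v⁻¹ (t / v⁻¹)) (branch s u v)
        rw [← e]
        exact g
  · obtain rfl : t' = t := hζ
    exact .inr (.inl ⟨z, hp, rfl⟩)

theorem psi_base (h : PolarPart R N q μ) (ht : t.1 = 0) {x : ℂ} (hp) :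
    BlowUp.psi h (BlowUp.mk ⟨base t x, hp⟩) = shift 0 x := by
  refine (sumPow_thW (Nat.zero_le _) (.inl rfl) ht).trans ?_
  rw [pow_zero, mul_one]

theorem psi'_base (h : PolarPart R N q μ) (ht : t.1 = 0) (hq : 1 ≤ q) {x : ℂ} (hp) :
    BlowUp.psi' h (BlowUp.mk ⟨base t x, hp⟩) = shift q (-(μ 0 * ((t.2 : ℂ)⁻¹) ^ q)) := by
  refine (sumPow_thW h.le (.inr (h.base_ne_zero (by omega) ht x)) ht).trans ?_
  rw [toC_pow, toC_eq_zero.2 ht, zero_pow (by omega), mul_zero, zero_sub, neg_mul]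

theorem psi_nearE (h : PolarPart R N q μ) (ht : t.1 = 0) {j : ℕ} (hj : j ≤ N) {v : Polar} (hp) :
    BlowUp.psi h (BlowUp.mk ⟨nearE j t v, hp⟩) = level t.2 j v := by
  rw [BlowUp.psi_mk, ← sumPow_thN_one hj ht v]
  have e1 : tPolar (nearE j t v : Pre N q) = t := by
    unfold nearE
    split_ifs
    · exact polar_div_mul_of_fst ht v
    · rfl
  have e2 : (fun k => xPow μ k (nearE j t v : Pre N q)) = fun k => thN j k 1 t v := by
    ext k
    unfold nearE
    split_ifs with h
    · change thE j k 1 (t / v) v = _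
      rw [thE_eq_thN_of_fst (div_fst_eq_zero ht v), polar_div_mul_of_fst ht]
    · obtain rfl : j = N := by omega
      rfl
  simp only [e1, e2]

/-- Below `E q` the pole of `ψ` dominates that of `x`, so the leading term of `x'` is constant. -/
theorem psi'_nearE_lt (h : PolarPart R N q μ) (ht : t.1 = 0) {j : ℕ} (hj : j < q) {v : Polar} (hp) :
    BlowUp.psi' h (BlowUp.mk ⟨nearE j t v, hp⟩) = shift q (-(μ 0 * ((t.2 : ℂ)⁻¹) ^ q)) := by
  have hjN : j < N := hj.trans_le h.le
  have hm := h.ne_zero (by omega)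
  rw [BlowUp.psi'_mk, ← neg_mul, ← sumPow_thW h.le (.inr (neg_ne_zero.2 hm)) ht]
  have e1 : tPolar (nearE j t v : Pre N q) = t := by
    unfold nearE
    rw [dif_pos hjN]
    exact polar_div_mul_of_fst ht v
  have e2 : (fun k => xPow' μ k (nearE j t v : Pre N q)) = fun k => thW q k (-μ 0) t := by
    ext k
    unfold nearE
    rw [dif_pos hjN]
    change (if q ≤ j then _ else thW q k (toC ((t / v) ^ (q - j : ℕ) * v ^ (q - j - 1 : ℕ)) -
      μ (toC (t / v * v))) (t / v * v)) = _
    rw [if_neg (by omega), polar_div_mul_of_fst ht, toC_mul, toC_pow,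
      toC_eq_zero.2 (div_fst_eq_zero ht v), zero_pow (by omega), zero_mul, zero_sub,
      toC_eq_zero.2 ht]
  simp only [e1, e2]

theorem psi'_nearE_ge (h : PolarPart R N q μ) (ht : t.1 = 0) {j : ℕ} (hj : j ≤ N) (hqj : q ≤ j)
    {v : Polar} (hp) :
    BlowUp.psi' h (BlowUp.mk ⟨nearE j t v, hp⟩) =
      sumPow t N fun k => thN j k (1 - μ 0 * toC (t ^ (j - q) * v)) t v := by
  rw [BlowUp.psi'_mk]
  have e1 : tPolar (nearE j t v : Pre N q) = t := by
    unfold nearE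
    split_ifs
    · exact polar_div_mul_of_fst ht v
    · rfl
  have e2 : (fun k => xPow' μ k (nearE j t v : Pre N q)) =
      fun k => thN j k (1 - μ 0 * toC (t ^ (j - q) * v)) t v := by
    ext k
    rw [← toC_eq_zero.2 ht]
    unfold nearE
    split_ifs with h
    · change (if q ≤ j then
        thE j k (1 - μ (toC (t / v * v)) * toC ((t / v) ^ (j - q : ℕ) * v ^ (j + 1 - q : ℕ))) (t / v) v
        else _) = _
      rw [if_pos hqj, thE_eq_thN_of_fst (div_fst_eq_zero ht v), polar_div_mul_of_fst ht,
        Nat.sub_add_comm hqj, pow_succ, ← mul_assoc, ← mul_pow, polar_div_mul_of_fst ht]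
    · obtain rfl : j = N := by omega
      rfl
  simp only [e1, e2]

theorem psi'_nearE_gt (h : PolarPart R N q μ) (ht : t.1 = 0) {j : ℕ} (hj : j ≤ N) (hqj : q ≤ j)
    {v : Polar} (hp) (hv : μ 0 = 0 ∨ q < j ∨ v.1 = 0) :
    BlowUp.psi' h (BlowUp.mk ⟨nearE j t v, hp⟩) = level t.2 j v := by
  rw [psi'_nearE_ge h ht hj hqj, ← sumPow_thN_one hj ht v]
  have e : μ 0 * toC (t ^ (j - q) * v) = 0 := by
    rcases hv with h0 | h1 | h2
    · rw [h0, zero_mul]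
    · rw [toC_mul, toC_pow, toC_eq_zero.2 ht, zero_pow (by omega), zero_mul, mul_zero]
    · rw [toC_mul, toC_eq_zero.2 h2, mul_zero, mul_zero]
  rw [e, sub_zero]

theorem psi'_nearE_eq (h : PolarPart R N q μ) (ht : t.1 = 0) {v : Polar}
    (hv : v.1 ≠ 0) (hvm : toC v * μ 0 ≠ 1) (hp) :
    BlowUp.psi' h (BlowUp.mk ⟨nearE q t v, hp⟩) =
      shift q (toC v⁻¹ * ((t.2 : ℂ)⁻¹) ^ q - μ 0 * ((t.2 : ℂ)⁻¹) ^ q) := by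
  have hv' := toC_ne_zero.2 hv
  have e : toC v⁻¹ - μ 0 ≠ 0 := by
    rw [toC_inv, sub_ne_zero]
    intro h1
    rw [← h1, mul_inv_cancel₀ hv'] at hvm
    exact hvm rfl
  rw [psi'_nearE_ge h ht h.le le_rfl, ← sub_mul, ← sumPow_thW h.le (.inr e) ht]
  congr 1
  ext k
  rw [thN_eq_thW hv, Nat.sub_self, pow_zero, one_mul, sub_mul, one_mul, mul_assoc, toC_inv,
    mul_inv_cancel₀ hv', mul_one]

/-- Over the blown-up point `w = μ 0`, so `x` has the leading term of `ψ`, whatever `z` is. -/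
theorem psi_branchEnd (h : PolarPart R N q μ) (ht : t.1 = 0) {z : ℂ} (hp) :
    BlowUp.psi h (BlowUp.mk ⟨branchEnd t z, hp⟩) = shift q (μ 0 * ((t.2 : ℂ)⁻¹) ^ q) := by
  have hq : q ≠ 0 := by have := hp.1; omega
  refine (sumPow_thW h.le (.inr hp.2.2) ht).trans ?_
  rw [toC_eq_zero.2 ht, zero_pow hq, zero_mul, add_zero]

theorem psi'_branchEnd (h : PolarPart R N q μ) (ht : t.1 = 0) {z : ℂ} (hp) :
    BlowUp.psi' h (BlowUp.mk ⟨branchEnd t z, hp⟩) = shift 0 z := by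
  refine (sumPow_thW (Nat.zero_le _) (.inl rfl) ht).trans ?_
  rw [pow_zero, mul_one]

theorem psi_branch (h : PolarPart R N q μ) (ht : t.1 = 0) {s : Fin q} {u : Polar} (hp) :
    BlowUp.psi h (BlowUp.mk ⟨branch s u (t / u), hp⟩) = shift q (μ 0 * ((t.2 : ℂ)⁻¹) ^ q) := by
  have hm := h.ne_zero (by have := s.2; omega)
  rw [← sumPow_thW h.le (.inr hm) ht]
  change sumPow (u * (t / u)) N (fun k => thW q k (μ (toC (u * (t / u))) +
    toC u ^ (s : ℕ) * toC (t / u) ^ ((s : ℕ) + 1)) (u * (t / u))) = _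
  rw [mul_comm u, polar_div_mul_of_fst ht, toC_eq_zero.2 ht,
    toC_eq_zero.2 (div_fst_eq_zero ht u), zero_pow (by omega), mul_zero, add_zero]

theorem psi'_branch (h : PolarPart R N q μ) (ht : t.1 = 0) {s : Fin q} {u : Polar} (hp) :
    BlowUp.psi' h (BlowUp.mk ⟨branch s u (t / u), hp⟩) = level t.2 (q - s - 1) u := by
  have := h.le
  rw [← sumPow_thN_one (by omega : q - (s : ℕ) - 1 ≤ N) ht u]
  change sumPow (u * (t / u)) N (fun k => thE (q - s - 1) k 1 (t / u) u) = _
  rw [mul_comm u, polar_div_mul_of_fst ht]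
  congr 1
  ext k
  rw [thE_eq_thN_of_fst (div_fst_eq_zero ht u), polar_div_mul_of_fst ht]

end fibre

/-! ### The pair of maps on a fibre -/

section fibre

variable {R : ℝ} {N q : ℕ} {μ : ℂ → ℂ} {t : Polar}

/-- The four kinds of pairs of values of `psi` and `psi'` on a fibre, where `m = μ 0 / ϑ ^ q`. -/
inductive ValueKind (N q : ℕ) (m X Y : ℂ) : Prop
  | low (h1 : ‖X‖ ≤ q) (h2 : Y = shift q (-m))
  | mid (W : ℂ) (h0 : W ≠ 0) (h1 : W ≠ m) (h2 : X = shift q W) (h3 : Y = shift q (W - m))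
  | high (h1 : (q : ℝ) + 1 ≤ ‖X‖) (h2 : ‖X‖ ≤ N + 1) (h3 : Y = X)
  | branch (h1 : X = shift q m) (h2 : ‖Y‖ ≤ q)

theorem one_frac_le_one (v : Polar) : 1 / (1 + (v.1 : ℝ)) ≤ 1 := by
  rw [div_le_one (by positivity)]
  linarith [v.1.coe_nonneg]

theorem one_frac_pos (v : Polar) : 0 < 1 / (1 + (v.1 : ℝ)) := by positivity

theorem norm_level_le (ϑ : Circle) (j : ℕ) (v : Polar) : ‖level ϑ j v‖ ≤ j + 1 := by
  rw [norm_level]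
  linarith [one_frac_le_one v]

theorem lt_norm_level (ϑ : Circle) (j : ℕ) (v : Polar) : j < ‖level ϑ j v‖ := by
  rw [norm_level]
  linarith [one_frac_pos v]

theorem norm_level_eq_iff (ϑ : Circle) (j : ℕ) (v : Polar) :
    ‖level ϑ j v‖ = j + 1 ↔ v.1 = 0 := by
  rw [norm_level, ← NNReal.coe_eq_zero, add_right_inj, div_eq_one_iff_eq (by positivity)]
  constructor <;> intro h <;> linarith

theorem direction_ne_zero (c : Circle) (n : ℕ) : ((c : ℂ)⁻¹) ^ n ≠ 0 :=
  pow_ne_zero _ (inv_ne_zero (Circle.coe_ne_zero c))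

/-- The excluded value belongs to the point `w = μ 0` of `E q`, which the main charts omit. It is
therefore taken only on the branch, so `psi` tells the two kinds of points apart. -/
theorem psi_onMain_ne (h : PolarPart R N q μ) (ht : t.1 = 0) (hq : 1 ≤ q) {ζ : BlowUp R N q μ}
    (hζ : OnMain R N q μ t ζ) : BlowUp.psi h ζ ≠ shift q (μ 0 * ((t.2 : ℂ)⁻¹) ^ q) := by
  have hm : μ 0 * ((t.2 : ℂ)⁻¹) ^ q ≠ 0 :=
    mul_ne_zero (h.ne_zero (by omega)) (direction_ne_zero _ _)
  have hq' : (1 : ℝ) ≤ q := by exact_mod_cast hq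
  intro he
  rcases hζ with ⟨x, hp, rfl⟩ | ⟨j, hj, v, hp, rfl⟩
  · rw [psi_base h ht] at he
    have h1 := norm_shift_lt (n := 0) (X := x) (.inl rfl)
    rw [he] at h1
    have h2 := lt_norm_shift (n := q) hm
    push_cast at h1
    linarith
  · rw [psi_nearE h ht hj] at he
    have h1 := norm_level_le t.2 j v
    have h2 := lt_norm_level t.2 j v
    have h3 := lt_norm_shift (n := q) hm
    have h4 := norm_shift_lt (n := q) (.inr hm)
    rw [he] at h1 h2
    have h5 : (q : ℝ) < j + 1 := by linarith
    have h6 : (j : ℝ) < q + 1 := by linarith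
    norm_cast at h5 h6
    obtain rfl : j = q := by omega
    have hv : v.1 ≠ 0 := by
      intro h0
      rw [← norm_level_eq_iff t.2 j v, he] at h0
      linarith
    rw [level_eq_shift _ _ hv] at he
    have hv' : toC v⁻¹ ≠ 0 := toC_ne_zero.2 (inv_ne_zero hv)
    have h7 := shift_inj (.inr (mul_ne_zero hv' (direction_ne_zero _ _))) (.inr hm) he
    have h8 := mul_right_cancel₀ (direction_ne_zero _ _) h7
    refine hp.nearE_q ht hq h.le ?_
    rw [← h8, ← toC_mul, polar_mul_inv hv, toC_one]

theorem valueKind_onMain (h : PolarPart R N q μ) (ht : t.1 = 0) (hq : 1 ≤ q) {ζ : BlowUp R N q μ}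
    (hζ : OnMain R N q μ t ζ) :
    ValueKind N q (μ 0 * ((t.2 : ℂ)⁻¹) ^ q) (BlowUp.psi h ζ) (BlowUp.psi' h ζ) := by
  have hq' : (1 : ℝ) ≤ q := by exact_mod_cast hq
  rcases hζ with ⟨x, hp, rfl⟩ | ⟨j, hj, v, hp, rfl⟩
  · refine .low ?_ (psi'_base h ht hq hp)
    rw [psi_base h ht]
    have h1 := norm_shift_lt (n := 0) (X := x) (.inl rfl)
    push_cast at h1
    linarith
  · have hj1 := norm_level_le t.2 j v
    have hj2 := lt_norm_level t.2 j v
    have hj3 : (j : ℝ) ≤ N := by exact_mod_cast hj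
    rcases lt_trichotomy j q with hjq | rfl | hjq
    · refine .low ?_ (psi'_nearE_lt h ht hjq hp)
      rw [psi_nearE h ht hj]
      refine hj1.trans ?_
      exact_mod_cast hjq
    · by_cases hv : v.1 = 0
      · have hn := (norm_level_eq_iff t.2 j v).2 hv
        refine .high ?_ ?_ ?_
        · rw [psi_nearE h ht hj, hn]
        · rw [psi_nearE h ht hj, hn]
          linarith
        · rw [psi'_nearE_gt h ht hj le_rfl hp (.inr (.inr hv)), psi_nearE h ht hj]
      · have hv' : toC v⁻¹ ≠ 0 := toC_ne_zero.2 (inv_ne_zero hv)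
        have hd := direction_ne_zero t.2 j
        have hvm := hp.nearE_q ht hq hj
        refine .mid (toC v⁻¹ * ((t.2 : ℂ)⁻¹) ^ j) (mul_ne_zero hv' hd) ?_ ?_
          (psi'_nearE_eq h ht hv hvm hp)
        · intro h1
          have h8 := mul_right_cancel₀ hd h1
          apply hvm
          rw [← h8, ← toC_mul, polar_mul_inv hv, toC_one]
        · rw [psi_nearE h ht hj, level_eq_shift _ _ hv]
    · have hjq' : (q : ℝ) + 1 ≤ j := by exact_mod_cast hjq
      refine .high ?_ ?_ ?_
      · rw [psi_nearE h ht hj]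
        linarith
      · rw [psi_nearE h ht hj]
        linarith
      · rw [psi'_nearE_gt h ht hj hjq.le hp (.inr (.inl hjq)), psi_nearE h ht hj]

theorem onBranch_values (h : PolarPart R N q μ) (ht : t.1 = 0) {ζ : BlowUp R N q μ}
    (hζ : OnBranch R N q μ t ζ) : 1 ≤ q ∧
    BlowUp.psi h ζ = shift q (μ 0 * ((t.2 : ℂ)⁻¹) ^ q) ∧ ‖BlowUp.psi' h ζ‖ ≤ q := by
  rcases hζ with ⟨z, hp, rfl⟩ | ⟨s, u, hp, rfl⟩
  · refine ⟨hp.1, psi_branchEnd h ht hp, ?_⟩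
    rw [psi'_branchEnd h ht]
    have h1 := norm_shift_lt (n := 0) (X := z) (.inl rfl)
    have hq' : (1 : ℝ) ≤ q := by exact_mod_cast hp.1
    push_cast at h1
    linarith
  · refine ⟨by have := s.2; omega, psi_branch h ht hp, ?_⟩
    rw [psi'_branch h ht]
    refine (norm_level_le _ _ _).trans ?_
    have : q - (s : ℕ) - 1 + 1 ≤ q := by have := s.2; omega
    exact_mod_cast this

theorem valueKind (h : PolarPart R N q μ) (ht : t.1 = 0) (hq : 1 ≤ q) {ζ : BlowUp R N q μ}
    (hζ : ζ.proj = t) :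
    ValueKind N q (μ 0 * ((t.2 : ℂ)⁻¹) ^ q) (BlowUp.psi h ζ) (BlowUp.psi' h ζ) := by
  rcases onMain_or_onBranch h ht hζ with hζ | hζ
  · exact valueKind_onMain h ht hq hζ
  · exact .branch (onBranch_values h ht hζ).2.1 (onBranch_values h ht hζ).2.2

theorem values_of_eq_zero (h : PolarPart R N q μ) (ht : t.1 = 0) (hq : q = 0) {ζ : BlowUp R N q μ}
    (hζ : ζ.proj = t) : BlowUp.psi' h ζ = BlowUp.psi h ζ ∧ ‖BlowUp.psi h ζ‖ ≤ N + 1 := by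
  rcases onMain_or_onBranch h ht hζ with hζ | hζ
  · have hm : μ = 0 := by
      rcases h.cases with h | h
      · exact h.2
      · omega
    rcases hζ with ⟨x, hp, rfl⟩ | ⟨j, hj, v, hp, rfl⟩
    · constructor
      · rw [psi_base h ht]
        refine Eq.trans (b := sumPow t N fun k => thW 0 k x t) ?_ ?_
        · subst hq
          refine congrArg (sumPow t N) (funext fun k => ?_)
          change thW 0 k (x * toC (t ^ 0) - μ (toC t)) t = _
          rw [hm, pow_zero, toC_one, mul_one, Pi.zero_apply, sub_zero]
        · rw [sumPow_thW (Nat.zero_le _) (.inl rfl) ht, pow_zero, mul_one]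
      · rw [psi_base h ht]
        have h1 := norm_shift_lt (n := 0) (X := x) (.inl rfl)
        have : (0 : ℝ) ≤ N := Nat.cast_nonneg N
        push_cast at h1
        linarith
    · have hj3 : (j : ℝ) ≤ N := by exact_mod_cast hj
      rw [psi_nearE h ht hj, psi'_nearE_gt h ht hj (by omega) hp (.inl (by rw [hm]; rfl))]
      exact ⟨rfl, (norm_level_le _ _ _).trans (by linarith)⟩
  · have := (onBranch_values h ht hζ).1
    omega

theorem onMain_injective (h : PolarPart R N q μ) (ht : t.1 = 0) {ζ ζ' : BlowUp R N q μ}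
    (hζ : OnMain R N q μ t ζ) (hζ' : OnMain R N q μ t ζ') (he : BlowUp.psi h ζ = BlowUp.psi h ζ') :
    ζ = ζ' := by
  rcases hζ with ⟨x, hp, rfl⟩ | ⟨j, hj, v, hp, rfl⟩ <;>
  rcases hζ' with ⟨x', hp', rfl⟩ | ⟨j', hj', v', hp', rfl⟩
  · rw [psi_base h ht, psi_base h ht] at he
    obtain rfl := shift_inj (.inl rfl) (.inl rfl) he
    rfl
  · rw [psi_base h ht, psi_nearE h ht hj'] at he
    obtain ⟨rfl, -, h1⟩ := shift_zero_eq_level he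
    exact BlowUp.mk_eq _ _ (Glue.base t x v' h1)
  · rw [psi_base h ht, psi_nearE h ht hj] at he
    obtain ⟨rfl, -, h1⟩ := shift_zero_eq_level he.symm
    exact (BlowUp.mk_eq _ _ (Glue.base t x' v h1)).symm
  · rw [psi_nearE h ht hj, psi_nearE h ht hj'] at he
    obtain ⟨rfl, rfl⟩ := level_inj he
    rfl

theorem glue_branch_branchEnd (ht : t.1 = 0) {z : ℂ} {s : Fin q} {u : Polar} (hs : (s : ℕ) + 1 = q)
    (h : toC u * z = 1) : Glue μ (branch s u (t / u)) (branchEnd t z : Pre N q) := by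
  have g := Glue.branch (N := N) (μ := μ) s u (t / u) (fst_ne_zero_of_toC_mul h)
  have e : (nearE' ((s : ℕ) + 1) (u * (t / u)) u⁻¹ : Pre N q) = branchEnd t z := by
    rw [nearE', dif_neg (by omega), mul_comm u, polar_div_mul_of_fst ht, toC_eq_inv h]
  rw [← e]
  exact g

theorem mk_branchEnd_eq_mk_branch (ht : t.1 = 0) {z : ℂ} {s : Fin q} {u : Polar}
    (hp : InChart R μ (branchEnd t z : Pre N q)) (hp' : InChart R μ (branch s u (t / u) : Pre N q))
    (h : shift 0 z = level t.2 (q - s - 1) u) :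
    (BlowUp.mk ⟨_, hp⟩ : BlowUp R N q μ) = BlowUp.mk ⟨_, hp'⟩ := by
  obtain ⟨h1, -, h3⟩ := shift_zero_eq_level h
  exact (BlowUp.mk_eq _ _ (glue_branch_branchEnd ht (by have := s.2; omega) h3)).symm

theorem onBranch_injective (h : PolarPart R N q μ) (ht : t.1 = 0) {ζ ζ' : BlowUp R N q μ}
    (hζ : OnBranch R N q μ t ζ) (hζ' : OnBranch R N q μ t ζ')
    (he : BlowUp.psi' h ζ = BlowUp.psi' h ζ') : ζ = ζ' := by
  rcases hζ with ⟨z, hp, rfl⟩ | ⟨s, u, hp, rfl⟩ <;>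
  rcases hζ' with ⟨z', hp', rfl⟩ | ⟨s', u', hp', rfl⟩
  · rw [psi'_branchEnd h ht, psi'_branchEnd h ht] at he
    obtain rfl := shift_inj (.inl rfl) (.inl rfl) he
    rfl
  · rw [psi'_branchEnd h ht, psi'_branch h ht] at he
    exact mk_branchEnd_eq_mk_branch ht hp hp' he
  · rw [psi'_branchEnd h ht, psi'_branch h ht] at he
    exact (mk_branchEnd_eq_mk_branch ht hp' hp he.symm).symm
  · rw [psi'_branch h ht, psi'_branch h ht] at he
    obtain ⟨h1, rfl⟩ := level_inj he
    obtain rfl : s = s' := by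
      have := s.2
      have := s'.2
      exact Fin.ext (by omega)
    rfl

/-- The pair of `psi` and `psi'` is injective on every fibre over `t = 0`. -/
theorem fibre_injective (h : PolarPart R N q μ) (ht : t.1 = 0) {ζ ζ' : BlowUp R N q μ}
    (hζ : ζ.proj = t) (hζ' : ζ'.proj = t) (he : BlowUp.psi h ζ = BlowUp.psi h ζ')
    (he' : BlowUp.psi' h ζ = BlowUp.psi' h ζ') : ζ = ζ' := by
  rcases onMain_or_onBranch h ht hζ with h1 | h1 <;> rcases onMain_or_onBranch h ht hζ' with h2 | h2
  · exact onMain_injective h ht h1 h2 he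
  · obtain ⟨hq, h3, -⟩ := onBranch_values h ht h2
    exact absurd (he.trans h3) (psi_onMain_ne h ht hq h1)
  · obtain ⟨hq, h3, -⟩ := onBranch_values h ht h1
    exact absurd (he.symm.trans h3) (psi_onMain_ne h ht hq h2)
  · exact onBranch_injective h ht h1 h2 he'

theorem proj_nearE (ht : t.1 = 0) {j : ℕ} {v : Polar}
    (hp : InChart R μ (nearE j t v : Pre N q)) :
    (BlowUp.mk ⟨_, hp⟩ : BlowUp R N q μ).proj = t := by
  change tPolar (nearE j t v : Pre N q) = t
  unfold nearE
  split_ifs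
  · exact polar_div_mul_of_fst ht v
  · rfl

theorem exists_psi_eq (h : PolarPart R N q μ) (ht : t.1 = 0) {z : ℂ} (hz : ‖z‖ ≤ N + 1)
    (hz' : 1 ≤ q → z ≠ shift q (μ 0 * ((t.2 : ℂ)⁻¹) ^ q)) :
    ∃ ζ : BlowUp R N q μ, ζ.proj = t ∧ BlowUp.psi h ζ = z := by
  rcases exists_level t.2 z with ⟨x, hx, -⟩ | ⟨j, v, hv, h1, h2, h3⟩
  · exact ⟨BlowUp.mk ⟨base t x, inChart_base h ht x⟩, rfl, (psi_base h ht _).trans hx⟩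
  · have hj : j ≤ N := by
      have : (j : ℝ) < N + 1 := by linarith
      norm_cast at this
      omega
    have hp : InChart R μ (nearE j t v : Pre N q) := by
      refine inChart_nearE h ht hj ?_
      rintro hq rfl h4
      have h5 := fst_ne_zero_of_toC_mul h4
      rw [level_eq_shift _ _ h5, toC_eq_inv h4] at hv
      exact hz' hq hv.symm
    exact ⟨BlowUp.mk ⟨_, hp⟩, proj_nearE ht hp, (psi_nearE h ht hj hp).trans hv⟩

theorem exists_psi'_eq (h : PolarPart R N q μ) (ht : t.1 = 0) (hq : 1 ≤ q) {z : ℂ} (hz : ‖z‖ ≤ q) :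
    ∃ ζ : BlowUp R N q μ, ζ.proj = t ∧ BlowUp.psi h ζ = shift q (μ 0 * ((t.2 : ℂ)⁻¹) ^ q) ∧
      BlowUp.psi' h ζ = z := by
  rcases exists_level t.2 z with ⟨x, hx, -⟩ | ⟨j, v, hv, h1, h2, h3⟩
  · exact ⟨BlowUp.mk ⟨branchEnd t x, inChart_branchEnd h ht hq x⟩, rfl, psi_branchEnd h ht _,
      (psi'_branchEnd h ht _).trans hx⟩
  · have hj : j < q := by
      have : (j : ℝ) < q := by linarith
      exact_mod_cast this
    have hs : q - 1 - j < q := by omega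
    have hp := inChart_branch h ht (N := N) ⟨q - 1 - j, hs⟩ v
    refine ⟨BlowUp.mk ⟨_, hp⟩, ?_, psi_branch h ht hp, ?_⟩
    · change v * (t / v) = t
      rw [mul_comm, polar_div_mul_of_fst ht]
    · rw [psi'_branch h ht hp, ← hv]
      congr 1
      change q - (q - 1 - j) - 1 = j
      omega

end fibre

/-! ### Compactness of the fibres -/

section compact

variable {R : ℝ} {N q : ℕ} {μ : ℂ → ℂ} {t : Polar}

theorem isCompact_mk {α : Type*} [TopologicalSpace α] {K : Set α} (hK : IsCompact K)
    {g : α → Pre N q} (hg : Continuous g) (hin : ∀ a ∈ K, InChart R μ (g a)) :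
    IsCompact {ζ : BlowUp R N q μ | ∃ a ∈ K, ∃ hp, ζ = BlowUp.mk ⟨g a, hp⟩} := by
  have := isCompact_iff_compactSpace.1 hK
  have hc : Continuous fun a : K => (BlowUp.mk ⟨g a, hin a a.2⟩ : BlowUp R N q μ) :=
    BlowUp.continuous_mk.comp ((hg.comp continuous_subtype_val).subtype_mk _)
  convert isCompact_range hc using 1
  ext ζ
  constructor
  · rintro ⟨a, ha, hp, rfl⟩
    exact ⟨⟨a, ha⟩, rfl⟩
  · rintro ⟨a, rfl⟩
    exact ⟨a, a.2, hin a a.2, rfl⟩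

theorem isCompact_polar_le (r : ℝ≥0) : IsCompact {v : Polar | v.1 ≤ r} := by
  have : {v : Polar | v.1 ≤ r} = Set.Icc 0 r ×ˢ Set.univ := by
    ext v
    simp
  rw [this]
  exact isCompact_Icc.prod isCompact_univ

theorem continuous_const_div (ht : t.1 = 0) : Continuous fun v : Polar => t / v := by
  have : (fun v : Polar => t / v) = fun v => (0, t.2 / v.2) := by
    ext v
    · simp [ht]
    · rfl
  rw [this]
  fun_prop

theorem continuous_crossing {α : Type*} [TopologicalSpace α] (k : Fin N) {u v : α → Polar}
    (hu : Continuous u) (hv : Continuous v) :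
    Continuous fun a => (crossing k (u a) (v a) : Pre N q) :=
  continuous_inr.comp (continuous_inl.comp (continuous_const.prodMk (hu.prodMk hv)))

theorem continuous_endChart {α : Type*} [TopologicalSpace α] {u v : α → Polar}
    (hu : Continuous u) (hv : Continuous v) :
    Continuous fun a => (endChart (u a) (v a) : Pre N q) :=
  continuous_inr.comp (continuous_inr.comp (continuous_inl.comp (hu.prodMk hv)))

theorem continuous_branch {α : Type*} [TopologicalSpace α] (s : Fin q) {u v : α → Polar}
    (hu : Continuous u) (hv : Continuous v) :
    Continuous fun a => (branch s (u a) (v a) : Pre N q) :=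
  continuous_inr.comp (continuous_inr.comp (continuous_inr.comp (continuous_inl.comp
    (continuous_const.prodMk (hu.prodMk hv)))))

theorem continuous_base (t : Polar) : Continuous fun x => (base t x : Pre N q) :=
  continuous_inl.comp (continuous_const.prodMk continuous_id)

theorem continuous_branchEnd (t : Polar) : Continuous fun z => (branchEnd t z : Pre N q) :=
  continuous_inr.comp (continuous_inr.comp (continuous_inr.comp (continuous_inr.comp
    (continuous_const.prodMk continuous_id))))

theorem continuous_nearE (ht : t.1 = 0) (j : ℕ) :
    Continuous fun v => (nearE j t v : Pre N q) := by
  unfold nearE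
  split_ifs with h
  · exact continuous_crossing _ (continuous_const_div ht) continuous_id
  · exact continuous_endChart continuous_const continuous_id

/-- Finitely many continuous images of compact sets cover the closed fibre: in each chart bounded
coordinates suffice, because larger ones are inverted by passing to the next chart. The main charts
omit the centre on `E q`; a neighbourhood of it is left to the first branch chart. -/
theorem isCompact_fibre (h : PolarPart R N q μ) (ϑ : Circle) : IsCompact (fibre R N q μ ϑ) := by
  obtain ⟨t, ht, htϑ⟩ : ∃ t : Polar, t.1 = 0 ∧ t = (0, ϑ) := ⟨_, rfl, rfl⟩
  have hcl : IsClosed (fibre R N q μ ϑ) := isClosed_singleton.preimage BlowUp.continuous_proj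
  have hcont := continuous_toC
  have c1 := isCompact_mk (R := R) (μ := μ) (isCompact_closedBall (0 : ℂ) 1)
    (continuous_base (N := N) (q := q) t) (fun x _ => inChart_base h ht x)
  have c2 : IsCompact {ζ : BlowUp R N q μ | ∃ z ∈ Metric.closedBall (0 : ℂ) 1, ∃ hp,
      ζ = BlowUp.mk ⟨branchEnd t z, hp⟩} := by
    by_cases hq : 1 ≤ q
    · exact isCompact_mk (isCompact_closedBall (0 : ℂ) 1) (continuous_branchEnd t)
        (fun x _ => inChart_branchEnd h ht hq x)
    · convert isCompact_empty
      ext ζ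
      simp only [Set.mem_ofPred_eq, Set.mem_empty_iff_false, iff_false]
      rintro ⟨z, -, hp, -⟩
      exact hq hp.1
  -- The extra condition says that `1 / v` has distance at least `‖μ 0‖ / 2` from `μ 0`, multiplied
  -- by `‖v‖` so that it is closed and makes sense at `v = 0`.
  have c3 : IsCompact (⋃ j : Fin (N + 1), {ζ : BlowUp R N q μ | ∃ v ∈ {v : Polar | v.1 ≤ 1} ∩
      {v : Polar | 1 ≤ q → (j : ℕ) = q → ‖μ 0‖ / 2 * v.1 ≤ ‖1 - toC v * μ 0‖}, ∃ hp,
      ζ = BlowUp.mk ⟨nearE j t v, hp⟩}) := by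
    refine isCompact_iUnion fun j => isCompact_mk ?_ (continuous_nearE ht j) ?_
    · refine (isCompact_polar_le 1).inter_right ?_
      simp only [Set.ofPred_forall]
      refine isClosed_iInter fun _ => isClosed_iInter fun _ => isClosed_le ?_ ?_ <;> fun_prop
    · rintro v ⟨-, hv⟩
      refine inChart_nearE h ht (by omega) fun hq hj h1 => ?_
      have h2 := hv hq hj
      have h3 := norm_pos_iff.2 (h.ne_zero (by omega))
      have h4 : (0 : ℝ) < v.1 := NNReal.coe_pos.2 (pos_iff_ne_zero.2 (fst_ne_zero_of_toC_mul h1))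
      rw [h1, sub_self, norm_zero] at h2
      have : 0 < ‖μ 0‖ / 2 * v.1 := by positivity
      linarith
  have c4 : IsCompact (⋃ k : Fin N, {ζ : BlowUp R N q μ | ∃ u ∈ {u : Polar | u.1 ≤ 1} ∩
      {u : Polar | 1 ≤ q → (k : ℕ) + 1 = q → ‖μ 0‖ / 2 ≤ ‖toC u - μ 0‖}, ∃ hp,
      ζ = BlowUp.mk ⟨crossing k u (t / u), hp⟩}) := by
    refine isCompact_iUnion fun k => isCompact_mk ?_
      (continuous_crossing k continuous_id (continuous_const_div ht)) ?_
    · refine (isCompact_polar_le 1).inter_right ?_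
      simp only [Set.ofPred_forall]
      refine isClosed_iInter fun _ => isClosed_iInter fun _ => isClosed_le ?_ ?_ <;> fun_prop
    · rintro u ⟨-, hu⟩
      refine ⟨?_, ?_, ?_⟩
      · rw [div_fst_eq_zero ht, mul_zero]
        exact h.pos
      · rintro ⟨hq, hk, -, h1⟩
        have h2 := hu hq hk
        rw [h1, sub_self, norm_zero] at h2
        have h3 := norm_pos_iff.2 (h.ne_zero (by omega))
        linarith
      · rintro ⟨-, -, -, h1⟩
        rw [toC_eq_zero.2 (div_fst_eq_zero ht _), zero_mul] at h1
        exact zero_ne_one h1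
  have c5 : IsCompact (⋃ s : Fin q, {ζ : BlowUp R N q μ | ∃ u ∈ {u : Polar | u.1 ≤ 1}, ∃ hp,
      ζ = BlowUp.mk ⟨branch s u (t / u), hp⟩}) :=
    isCompact_iUnion fun s => isCompact_mk (isCompact_polar_le 1)
      (continuous_branch s continuous_id (continuous_const_div ht)) fun u _ =>
        inChart_branch h ht s u
  -- For `s = 0` one has `w = μ 0 + v` on the divisor `u = 0`; the bound `‖μ 0‖ / 2` keeps this away
  -- from `0`.
  have c6 : IsCompact (⋃ s : Fin q, {ζ : BlowUp R N q μ | ∃ v ∈ {v : Polar |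
      v.1 ≤ if (s : ℕ) = 0 then ‖μ 0‖₊ / 2 else 1}, ∃ hp,
      ζ = BlowUp.mk ⟨branch s (t / v) v, hp⟩}) := by
    refine isCompact_iUnion fun s => isCompact_mk (isCompact_polar_le _)
      (continuous_branch s (continuous_const_div ht) continuous_id) ?_
    intro v hv
    have hm := h.ne_zero (by have := s.2; omega)
    refine ⟨?_, ?_⟩
    · rw [div_fst_eq_zero ht, zero_mul]
      exact h.pos
    · rw [toC_mul, toC_eq_zero.2 (div_fst_eq_zero ht _), zero_mul]
      by_cases hs : (s : ℕ) = 0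
      · rw [Set.mem_ofPred_eq, if_pos hs] at hv
        rw [hs, pow_zero, one_mul, zero_add, pow_one]
        intro h1
        have h2 : ‖toC v‖ = ‖μ 0‖ := by
          rw [← norm_neg, ← eq_neg_of_add_eq_zero_left h1]
        have h3 := norm_pos_iff.2 hm
        have h4 : (v.1 : ℝ) ≤ ‖μ 0‖ / 2 := by exact_mod_cast hv
        rw [norm_toC] at h2
        linarith
      · rw [zero_pow hs, zero_mul, add_zero]
        exact hm
  refine (((((c1.union c2).union c3).union c4).union c5).union c6).of_isClosed_subset hcl ?_
  intro ζ hζ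
  replace hζ : ζ.proj = t := by rw [htϑ]; exact hζ
  simp only [Set.mem_union, Set.mem_iUnion]
  rcases onMain_or_onBranch h ht hζ with hζ | hζ
  · rcases hζ with ⟨x, hp, rfl⟩ | ⟨j, hj, v, hp, rfl⟩
    · rcases le_or_gt ‖x‖ 1 with hx | hx
      · exact .inl (.inl (.inl (.inl (.inl ⟨x, mem_closedBall_zero_iff.2 hx, hp, rfl⟩))))
      · obtain ⟨v, hv⟩ := exists_toC x⁻¹
        have hx0 : x ≠ 0 := norm_pos_iff.1 (by linarith)
        have hv1 : toC v * x = 1 := by rw [hv, inv_mul_cancel₀ hx0]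
        have hq : ¬ (1 ≤ q ∧ 0 = q) := by omega
        have hp' : InChart R μ (nearE 0 t v : Pre N q) :=
          inChart_nearE h ht (Nat.zero_le _) fun h1 h2 => absurd ⟨h1, h2⟩ hq
        refine .inl (.inl (.inl (.inr ⟨0, v, ⟨?_, fun h1 h2 => absurd ⟨h1, h2⟩ hq⟩, hp',
          BlowUp.mk_eq _ _ (Glue.base t x v hv1)⟩)))
        rw [Set.mem_ofPred_eq, ← NNReal.coe_le_coe, ← norm_toC, hv, norm_inv]
        exact inv_le_one_of_one_le₀ hx.le
    · by_cases hn : 1 ≤ q ∧ j = q ∧ v.1 ≠ 0 ∧ ‖toC v⁻¹ - μ 0‖ < ‖μ 0‖ / 2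
      · obtain ⟨hq, rfl, hv, hn⟩ := hn
        -- On `E q` one has `w = 1 / v`, so `w - μ 0` is the coordinate in the first branch chart.
        obtain ⟨z, hz⟩ := exists_toC (toC v⁻¹ - μ 0)
        have hv' := toC_ne_zero.2 hv
        have hz0 : toC z ≠ 0 := by
          rw [hz, sub_ne_zero, toC_inv]
          intro h1
          apply hp.nearE_q ht hq hj
          rw [← h1, mul_inv_cancel₀ hv']
        have hz1 : toC v * (μ 0 + toC z) = 1 := by
          rw [hz, add_sub_cancel, toC_inv, mul_inv_cancel₀ hv']
        have hg := Glue.branch_main (N := N) (μ := μ) ⟨0, hq⟩ (t / z) z v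
          (.inr (by simpa using hz0)) (by
            rw [polar_div_mul_of_fst ht, toC_eq_zero.2 ht]
            simpa using hz1)
        have hp' : InChart R μ (branch ⟨0, hq⟩ (t / z) z : Pre N j) := by
          refine ⟨?_, ?_⟩
          · rw [div_fst_eq_zero ht, zero_mul]
            exact h.pos
          · rw [polar_div_mul_of_fst ht, toC_eq_zero.2 ht, pow_zero, one_mul, zero_add, pow_one]
            exact right_ne_zero_of_mul (hz1.trans_ne one_ne_zero)
        rw [polar_div_mul_of_fst ht] at hg
        refine .inr ⟨⟨0, hq⟩, z, ?_, hp', (BlowUp.mk_eq hp' hp hg).symm⟩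
        rw [if_pos rfl, Set.mem_ofPred_eq, ← NNReal.coe_le_coe, ← norm_toC, hz]
        exact hn.le
      · have hn' : 1 ≤ q → j = q → v.1 ≠ 0 → ‖μ 0‖ / 2 ≤ ‖toC v⁻¹ - μ 0‖ :=
          fun h1 h2 h3 => not_lt.1 fun h4 => hn ⟨h1, h2, h3, h4⟩
        rcases le_or_gt v.1 1 with hv | hv
        · refine .inl (.inl (.inl (.inr ⟨⟨j, by omega⟩, v, ⟨hv, fun h1 h2 => ?_⟩, hp, rfl⟩)))
          by_cases hv0 : v.1 = 0
          · rw [hv0, NNReal.coe_zero, mul_zero]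
            exact norm_nonneg _
          · have e : 1 - toC v * μ 0 = (toC v⁻¹ - μ 0) * toC v := by
              rw [sub_mul, toC_inv, inv_mul_cancel₀ (toC_ne_zero.2 hv0), mul_comm (μ 0)]
            rw [e, norm_mul, norm_toC]
            exact mul_le_mul_of_nonneg_right (hn' h1 h2 hv0) v.1.coe_nonneg
        · have hv0 : v.1 ≠ 0 := (zero_lt_one.trans hv).ne'
          have hv0' : (v⁻¹ : Polar).1 ≠ 0 := inv_ne_zero hv0
          have hv1 : (v⁻¹ : Polar).1 ≤ 1 := inv_le_one_of_one_le₀ hv.le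
          rcases Nat.eq_zero_or_eq_succ_pred j with rfl | hk
          · refine .inl (.inl (.inl (.inl (.inl ⟨toC v⁻¹, ?_, inChart_base h ht _,
              (BlowUp.mk_eq _ hp (Glue.base t (toC v⁻¹) v ?_)).symm⟩))))
            · rw [mem_closedBall_zero_iff, norm_toC]
              exact_mod_cast hv1
            · rw [← toC_mul, polar_mul_inv hv0, toC_one]
          · obtain ⟨k, rfl⟩ : ∃ k, j = k + 1 := ⟨_, hk⟩
            have hk : k < N := by omega
            have hg := Glue.crossing (q := q) (μ := μ) ⟨k, hk⟩ v⁻¹ (t / v⁻¹) hv0'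
            rw [mul_comm v⁻¹, polar_div_mul_of_fst ht, inv_inv] at hg
            have hp' : InChart R μ (crossing ⟨k, hk⟩ v⁻¹ (t / v⁻¹) : Pre N q) := by
              refine ⟨?_, ?_, ?_⟩
              · rw [div_fst_eq_zero ht, mul_zero]
                exact h.pos
              · rintro ⟨hq, hk, -, h1⟩
                have h2 := hn' hq hk hv0
                rw [h1, sub_self, norm_zero] at h2
                have h3 := norm_pos_iff.2 (h.ne_zero (by omega))
                linarith
              · rintro ⟨-, -, h1, -⟩
                exact hv0' h1
            exact .inl (.inl (.inr ⟨⟨k, hk⟩, v⁻¹, ⟨hv1, fun h1 h2 => hn' h1 h2 hv0⟩, hp',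
              (BlowUp.mk_eq hp' hp hg).symm⟩))
  · rcases hζ with ⟨z, hp, rfl⟩ | ⟨s, u, hp, rfl⟩
    · rcases le_or_gt ‖z‖ 1 with hz | hz
      · exact .inl (.inl (.inl (.inl (.inr ⟨z, mem_closedBall_zero_iff.2 hz, hp, rfl⟩))))
      · obtain ⟨u, hu⟩ := exists_toC z⁻¹
        have hz0 : z ≠ 0 := norm_pos_iff.1 (by linarith)
        have hu1 : toC u * z = 1 := by rw [hu, inv_mul_cancel₀ hz0]
        have hq := hp.1
        have hs : q - 1 < q := by omega
        have hp' := inChart_branch h ht (N := N) ⟨q - 1, hs⟩ u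
        refine .inl (.inr ⟨⟨q - 1, hs⟩, u, ?_, hp', (BlowUp.mk_eq hp' hp
          (glue_branch_branchEnd ht (Nat.sub_add_cancel hq) hu1)).symm⟩)
        rw [Set.mem_ofPred_eq, ← NNReal.coe_le_coe, ← norm_toC, hu, norm_inv]
        exact inv_le_one_of_one_le₀ hz.le
    · rcases le_or_gt u.1 1 with hu | hu
      · exact .inl (.inr ⟨s, u, hu, hp, rfl⟩)
      · have hu0 : u.1 ≠ 0 := (zero_lt_one.trans hu).ne'
        have hu1 : (u⁻¹ : Polar).1 ≤ 1 := inv_le_one_of_one_le₀ hu.le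
        by_cases hs : (s : ℕ) + 1 < q
        · have hg := Glue.branch (N := N) (μ := μ) s u (t / u) hu0
          rw [nearE', dif_pos hs, mul_comm u, polar_div_mul_of_fst ht] at hg
          have hp' : InChart R μ (branch ⟨(s : ℕ) + 1, hs⟩ (t / u⁻¹) u⁻¹ : Pre N q) := by
            refine ⟨?_, ?_⟩
            · rw [div_fst_eq_zero ht, zero_mul]
              exact h.pos
            · rw [polar_div_mul_of_fst ht, toC_eq_zero.2 ht,
                toC_eq_zero.2 (div_fst_eq_zero ht _), zero_pow (Nat.succ_ne_zero _), zero_mul,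
                add_zero]
              exact h.ne_zero (by omega)
          refine .inr ⟨⟨(s : ℕ) + 1, hs⟩, u⁻¹, ?_, hp', BlowUp.mk_eq hp hp' hg⟩
          rw [if_neg (Nat.succ_ne_zero _)]
          exact hu1
        · have hs' : (s : ℕ) + 1 = q := by have := s.2; omega
          have hz : toC u * toC u⁻¹ = 1 := by rw [← toC_mul, polar_mul_inv hu0, toC_one]
          refine .inl (.inl (.inl (.inl (.inr ⟨toC u⁻¹, ?_, inChart_branchEnd h ht (by omega) _,
            BlowUp.mk_eq hp _ (glue_branch_branchEnd ht hs' hz)⟩))))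
          rw [mem_closedBall_zero_iff, norm_toC]
          exact_mod_cast hu1

end compact

/-! ### Failure of moderate growth -/

section moderate

variable {R : ℝ} {N q : ℕ} {μ : ℂ → ℂ}

theorem th_one_injective {z w : ℂ} (h : th z 1 = th w 1) : z = w := by
  have e : ∀ z : ℂ, th z 1 = shift 0 z := by
    intro z
    rw [th_eq_inv, shift]
    by_cases hz : z = 0
    · simp [hz]
    · have : (‖z‖ : ℂ) ≠ 0 := by exact_mod_cast norm_ne_zero_iff.2 hz
      have h2 : (1 : ℂ) + (‖z‖ : ℂ) ≠ 0 := by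
        have : (0 : ℝ) < 1 + ‖z‖ := by positivity
        exact_mod_cast this.ne'
      have h3 : (‖z‖ : ℂ) + 1 ≠ 0 := by rwa [add_comm]
      simp only [Prod.snd_one, Prod.fst_one, NNReal.coe_one, Circle.coe_one]
      push_cast
      field_simp
      ring
  rw [e, e] at h
  exact shift_inj (.inl rfl) (.inl rfl) h

theorem norm_th_lt_one (A : ℂ) {B : Polar} (hB : B.1 ≠ 0) : ‖th A B‖ < 1 := by
  have h1 : (0 : ℝ) < B.1 := NNReal.coe_pos.2 (pos_iff_ne_zero.2 hB)
  rw [norm_th, div_lt_one (by positivity)]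
  linarith

theorem div_toC (z : ℂ) (u : Polar) : z / toC u = z * (u.2 : ℂ)⁻¹ / ((u.1 : ℝ) : ℂ) := by
  rw [toC, div_mul_eq_div_div_swap, div_eq_mul_inv z]

theorem th_one_re (z : ℂ) : (th z 1).re = z.re / (‖z‖ + 1) := by
  rw [th_eq_inv]
  simp only [Prod.snd_one, Prod.fst_one, NNReal.coe_one, Circle.coe_one, inv_one, mul_one]
  exact Complex.div_ofReal_re _ _

/-- A non-zero imaginary number gets positive real part by a small rotation in the right sense, and
`n ≠ 0` turns a rotation of the coordinate into one of the value. This shows that the boundary case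
of real part `0` is not moderate. -/
theorem frequently_rotation_re_pos {z : ℂ} (hz : z ≠ 0) (hre : 0 ≤ z.re) {n : ℕ} (hn : n ≠ 0) :
    ∃ᶠ c : Circle in 𝓝 1, 0 < (z * ((c : ℂ) ^ n)⁻¹).re := by
  rcases hre.lt_or_eq with h | h
  · refine Filter.Eventually.frequently ?_
    have hc : ContinuousAt (fun c : Circle => (z * ((c : ℂ) ^ n)⁻¹).re) 1 := by
      refine Complex.continuous_re.continuousAt.comp (continuousAt_const.mul ?_)
      have h1 : ContinuousAt (fun c : Circle => (c : ℂ) ^ n) 1 := by fun_prop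
      exact h1.inv₀ (pow_ne_zero _ (Circle.coe_ne_zero _))
    refine hc.eventually (lt_mem_nhds ?_)
    simpa using h
  · have him : z.im ≠ 0 := fun h0 => hz (Complex.ext h.symm h0)
    have hval : ∀ θ : ℝ, (z * (((Circle.exp θ : Circle) : ℂ) ^ n)⁻¹).re = z.im * Real.sin (n * θ) := by
      intro θ
      rw [← Circle.coe_pow, ← Circle.coe_inv, ← Circle.exp_natCast_mul, ← Circle.exp_neg,
        Circle.coe_exp, Complex.exp_mul_I, ← Complex.ofReal_cos, ← Complex.ofReal_sin,
        Complex.mul_re, ← h, zero_mul, zero_sub, Real.cos_neg, Real.sin_neg]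
      generalize Real.cos (n * θ) = x
      generalize Real.sin (n * θ) = y
      simp
    -- The angle `x * z.im` with `x > 0` has the sign of `z.im`, which is the right sense of
    -- rotation.
    have htend : Filter.Tendsto (fun x : ℝ => Circle.exp (x * z.im)) (𝓝[>] 0) (𝓝 1) := by
      have h1 : Continuous fun x : ℝ => Circle.exp (x * z.im) := by fun_prop
      have h2 := h1.tendsto 0
      rw [zero_mul, Circle.exp_zero] at h2
      exact h2.mono_left nhdsWithin_le_nhds
    refine htend.frequently (Filter.Eventually.frequently ?_)
    have h3 : ∀ᶠ x : ℝ in 𝓝[>] 0, n * (x * |z.im|) < Real.pi := by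
      have h1 : Continuous fun x : ℝ => n * (x * |z.im|) := by fun_prop
      have h2 := h1.tendsto 0
      rw [zero_mul, mul_zero] at h2
      exact (h2.mono_left nhdsWithin_le_nhds).eventually (gt_mem_nhds Real.pi_pos)
    filter_upwards [h3, self_mem_nhdsWithin] with x hx hx0
    have hx0 : 0 < x := hx0
    rw [hval]
    have hn' : (0 : ℝ) < n := by exact_mod_cast Nat.pos_of_ne_zero hn
    rcases him.lt_or_gt with hi | hi
    · rw [abs_of_neg hi] at hx
      refine mul_pos_of_neg_of_neg hi (Real.sin_neg_of_neg_of_neg_pi_lt ?_ ?_)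
      · have : 0 < n * (x * -z.im) := by
          have := neg_pos.2 hi
          positivity
        linarith
      · linarith
    · rw [abs_of_pos hi] at hx
      exact mul_pos hi (Real.sin_pos_of_pos_of_lt_pi (by positivity) hx)

theorem exists_pow_lt_exp {η : ℝ} (hη : 0 < η) (C : ℝ) (M : ℕ) :
    ∀ᶠ r in 𝓝[>] (0 : ℝ), C * (r⁻¹) ^ M < Real.exp (η / r) := by
  have h1 := (isLittleO_pow_exp_pos_mul_atTop M hη).def (c := (|C| + 1)⁻¹) (by positivity)
  have h2 := tendsto_inv_nhdsGT_zero.eventually h1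
  filter_upwards [h2, self_mem_nhdsWithin] with r hr hr0
  have hr0 : 0 < r := hr0
  rw [Real.norm_of_nonneg (by positivity), Real.norm_of_nonneg (by positivity), ← div_eq_inv_mul,
    le_div_iff₀ (by positivity)] at hr
  rw [div_eq_mul_inv]
  refine lt_of_lt_of_le ?_ hr
  rw [mul_comm]
  have : 0 < r⁻¹ ^ M := by positivity
  gcongr
  linarith [le_abs_self C]

/-- The exponential of `x - μ t / t ^ q` is not of moderate growth near a point of a chart at which
this function tends to infinity in a direction with non-negative real part. -/
theorem not_moderate_of_chart (hq : q ≤ N) {f : Polar → Polar → Pre N q}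
    (hf : Continuous (Function.uncurry f)) {A : ℂ → ℂ → ℂ} {a b : Polar}
    (hA : ContinuousAt (Function.uncurry A) (toC a, toC b)) {n m : ℕ} (hn : n ≠ 0) (ha : a.1 = 0)
    (hx : ∀ a' b', xPow' μ 0 (f a' b') = th (A (toC a') (toC b')) (a' ^ n * b' ^ m))
    (hdiv : ∀ a' b', (b.1 ≠ 0 → b' = b) → divisorEq (f a' b') = a'.1 * b'.1)
    (h1 : ‖xPow' μ 0 (f a b)‖ = 1) (hre : 0 ≤ (xPow' μ 0 (f a b)).re) (C : ℝ) (M : ℕ) :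
    ¬ ∀ᶠ p in 𝓝 (f a b), divisorEq p ≠ 0 →
      ‖Complex.exp (xCoord μ p - μ (tCoord p) / tCoord p ^ q)‖ ≤
        C * ((divisorEq p : ℝ)⁻¹) ^ M := by
  intro hev
  rw [hx] at h1 hre
  have hB0 : (a ^ n * b ^ m).1 = 0 := by rw [mul_fst, Prod.pow_fst, ha, zero_pow hn, zero_mul]
  have hA0 : A (toC a) (toC b) ≠ 0 := by
    intro h0
    rw [h0] at h1
    simp [th] at h1
  rw [th_eq_inv, hB0, NNReal.coe_zero, add_zero, Complex.div_ofReal_re] at hre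
  have hpos := norm_pos_iff.2 hA0
  have hre' : 0 ≤ (A (toC a) (toC b) * ((a ^ n * b ^ m).2 : ℂ)⁻¹).re := by
    rw [← div_mul_cancel₀ (A (toC a) (toC b) * ((a ^ n * b ^ m).2 : ℂ)⁻¹).re hpos.ne']
    positivity
  have hne : A (toC a) (toC b) * ((a ^ n * b ^ m).2 : ℂ)⁻¹ ≠ 0 :=
    mul_ne_zero hA0 (inv_ne_zero (Circle.coe_ne_zero _))
  -- The estimate holds on a neighbourhood, hence with the same `C` and `M` near the points where
  -- the direction of `a` is slightly turned.
  have hrot : ∀ᶠ c : Circle in 𝓝 1, ∀ᶠ p in 𝓝 (f (0, a.2 * c) b), divisorEq p ≠ 0 →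
      ‖Complex.exp (xCoord μ p - μ (tCoord p) / tCoord p ^ q)‖ ≤
        C * ((divisorEq p : ℝ)⁻¹) ^ M := by
    have hc : Continuous fun c : Circle => f (0, a.2 * c) b :=
      hf.comp (g := Function.uncurry f) (f := fun c : Circle => (((0, a.2 * c) : Polar), b))
        (by fun_prop)
    have h2 := hc.tendsto 1
    have e : ((0, a.2 * 1) : Polar) = a := by
      ext
      · exact congrArg _ ha.symm
      · simp
    rw [e] at h2
    exact h2.eventually (eventually_eventually_nhds.2 hev)
  obtain ⟨c, hcpos, hc⟩ := ((frequently_rotation_re_pos hne hre' hn).and_eventually hrot).exists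
  -- The divisor is approached along fixed directions. The second radius stays fixed unless it
  -- vanishes at the limit point, in which case it also equals `r`.
  obtain ⟨ar, har⟩ : ∃ ar : ℝ≥0 → Polar, ar = fun r => (r, a.2 * c) := ⟨_, rfl⟩
  obtain ⟨br, hbr⟩ : ∃ br : ℝ≥0 → Polar, br = fun r => (if b.1 = 0 then r else b.1, b.2) := ⟨_, rfl⟩
  have har_c : Continuous ar := by rw [har]; fun_prop
  have hbr_c : Continuous br := by
    rw [hbr]
    by_cases hb : b.1 = 0
    · simp only [if_pos hb]
      fun_prop
    · simp only [if_neg hb]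
      fun_prop
  have hbr0 : br 0 = b := by
    rw [hbr]
    ext
    · by_cases hb : b.1 = 0 <;> simp [hb]
    · rfl
  have hbr1 : ∀ r, b.1 ≠ 0 → br r = b := by
    intro r hb
    rw [hbr]
    ext
    · simp [hb]
    · rfl
  have hbr2 : ∀ r, (br r).2 = b.2 := fun r => by rw [hbr]
  have har1 : ∀ r, (ar r).1 = r := fun r => by rw [har]
  have har2 : ∀ r, (ar r).2 = a.2 * c := fun r => by rw [har]
  have har0 : toC (ar 0) = toC a := by rw [toC_eq_zero.2 ha, toC_eq_zero.2 (har1 0)]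
  obtain ⟨k, hk, hkdiv⟩ : ∃ k : ℝ, 0 < k ∧ ∀ r : ℝ≥0, r ≤ 1 → k * r ≤ (br r).1 := by
    by_cases hb : b.1 = 0
    · exact ⟨1, one_pos, fun r _ => by rw [hbr]; simp [hb]⟩
    · have hb' : (0 : ℝ) < b.1 := NNReal.coe_pos.2 (pos_iff_ne_zero.2 hb)
      refine ⟨b.1, hb', fun r hr => ?_⟩
      rw [hbr1 r hb]
      have : (r : ℝ) ≤ 1 := by exact_mod_cast hr
      nlinarith
  obtain ⟨K, hK, hKle⟩ : ∃ K : ℝ, 0 < K ∧ ∀ r : ℝ≥0, r ≤ 1 → ((br r).1 : ℝ) ^ m ≤ K := by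
    refine ⟨(max b.1 1 : ℝ) ^ m, by positivity, fun r hr => ?_⟩
    refine pow_le_pow_left₀ (NNReal.coe_nonneg _) ?_ m
    rw [hbr]
    by_cases hb : b.1 = 0
    · simp only [if_pos hb]
      exact le_max_of_le_right (by exact_mod_cast hr)
    · simp only [if_neg hb]
      exact le_max_left _ _
  have hangle : ∀ r, ((ar r ^ n * br r ^ m).2 : ℂ)⁻¹ =
      ((a ^ n * b ^ m).2 : ℂ)⁻¹ * ((c : ℂ) ^ n)⁻¹ := by
    intro r
    rw [Prod.snd_mul, Prod.pow_snd, Prod.pow_snd, har2, hbr2, ← mul_inv, ← Circle.coe_pow,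
      ← Circle.coe_mul, Prod.snd_mul, Prod.pow_snd, Prod.pow_snd, mul_pow, mul_right_comm]
  obtain ⟨η, hη⟩ : ∃ η : ℝ, η = (A (toC a) (toC b) * ((a ^ n * b ^ m).2 : ℂ)⁻¹ * ((c : ℂ) ^ n)⁻¹).re :=
    ⟨_, rfl⟩
  rw [← hη] at hcpos
  have hlim : ∀ᶠ r in 𝓝 (0 : ℝ≥0), η / 2 <
      (A (toC (ar r)) (toC (br r)) * ((ar r ^ n * br r ^ m).2 : ℂ)⁻¹).re := by
    have hc1 : ContinuousAt (fun r => A (toC (ar r)) (toC (br r))) 0 := by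
      refine ContinuousAt.comp (g := Function.uncurry A)
        (f := fun r => (toC (ar r), toC (br r))) ?_ ?_
      · rw [har0, hbr0]
        exact hA
      · have := continuous_toC
        exact (Continuous.prodMk (this.comp har_c) (this.comp hbr_c)).continuousAt
    have hc2 : ContinuousAt (fun r => (A (toC (ar r)) (toC (br r)) *
        (((a ^ n * b ^ m).2 : ℂ)⁻¹ * ((c : ℂ) ^ n)⁻¹)).re) 0 :=
      Complex.continuous_re.continuousAt.comp (hc1.mul continuousAt_const)
    simp only [hangle]
    have h0 : η / 2 < (A (toC (ar 0)) (toC (br 0)) *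
        (((a ^ n * b ^ m).2 : ℂ)⁻¹ * ((c : ℂ) ^ n)⁻¹)).re := by
      rw [har0, hbr0, ← mul_assoc, ← hη]
      linarith
    exact hc2.eventually (lt_mem_nhds h0)
  have hmod : ∀ᶠ r in 𝓝 (0 : ℝ≥0), divisorEq (f (ar r) (br r)) ≠ 0 →
      ‖Complex.exp (xCoord μ (f (ar r) (br r)) - μ (tCoord (f (ar r) (br r))) /
        tCoord (f (ar r) (br r)) ^ q)‖ ≤ C * ((divisorEq (f (ar r) (br r)) : ℝ)⁻¹) ^ M := by
    have h2 : Continuous fun r => f (ar r) (br r) :=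
      hf.comp (g := Function.uncurry f) (har_c.prodMk hbr_c)
    have h3 := h2.tendsto 0
    rw [hbr0, har] at h3
    rw [har]
    exact h3.eventually hc
  -- Along the path the equation of the divisor is at least `k * r ^ 2`, which explains the exponent
  -- `2 * M`, while the real part of `x'` is at least `η / 2 / K / r`.
  have hexp := exists_pow_lt_exp (η := η / 2 / K) (by positivity) (|C| * (k⁻¹) ^ M) (2 * M)
  have hle : ∀ᶠ r : ℝ≥0 in 𝓝 0, r ≤ 1 := by
    filter_upwards [gt_mem_nhds (zero_lt_one (α := ℝ≥0))] with r hr using hr.le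
  have hcomb := (hlim.and (hmod.and hle))
  have hto : Filter.Tendsto Real.toNNReal (𝓝[>] 0) (𝓝 0) := by
    have := continuous_real_toNNReal.tendsto 0
    rw [Real.toNNReal_zero] at this
    exact this.mono_left nhdsWithin_le_nhds
  obtain ⟨x, ⟨hlim, hmod, hle⟩, hexp, hx0⟩ :=
    ((hto.eventually hcomb).and (hexp.and self_mem_nhdsWithin)).exists
  have hx0 : 0 < x := hx0
  obtain ⟨r, hr⟩ : ∃ r : ℝ≥0, Real.toNNReal x = r := ⟨_, rfl⟩
  have hxr : x = r := by rw [← hr, Real.coe_toNNReal _ hx0.le]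
  rw [hr] at hlim hmod hle
  rw [hxr] at hexp hx0
  have hbpos : (0 : ℝ) < (br r).1 := lt_of_lt_of_le (by positivity) (hkdiv r hle)
  have hdr : (divisorEq (f (ar r) (br r)) : ℝ) = r * (br r).1 := by
    rw [hdiv _ _ (hbr1 r), har1, NNReal.coe_mul]
  have hdne : divisorEq (f (ar r) (br r)) ≠ 0 := by
    rw [← NNReal.coe_ne_zero, hdr]
    positivity
  have hbound := hmod hdne
  have hBr : (((ar r ^ n * br r ^ m).1 : ℝ≥0) : ℝ) = r ^ n * ((br r).1 : ℝ) ^ m := by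
    rw [mul_fst, Prod.pow_fst, Prod.pow_fst, har1]
    push_cast
    rfl
  have hBne : (ar r ^ n * br r ^ m).1 ≠ 0 := by
    rw [← NNReal.coe_ne_zero, hBr]
    positivity
  have hval := xPow'_off (μ := μ) (k := 0) hq hdne
  rw [hx, th_div hBne, pow_zero, mul_one] at hval
  rw [← th_one_injective hval, Complex.norm_exp, hdr] at hbound
  have hre2 : η / 2 / K / r ≤ (A (toC (ar r)) (toC (br r)) / toC (ar r ^ n * br r ^ m)).re := by
    rw [div_toC, Complex.div_ofReal_re, hBr]
    have hr1 : (r : ℝ) ≤ 1 := by exact_mod_cast hle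
    have h5 : (r : ℝ) ^ n * ((br r).1 : ℝ) ^ m ≤ r * K := by
      refine mul_le_mul ?_ (hKle r hle) (by positivity) hx0.le
      exact pow_le_of_le_one hx0.le hr1 hn
    rw [div_div, mul_comm K]
    refine div_le_div₀ (by linarith) hlim.le (by positivity) h5
  have h6 := (Real.exp_le_exp.2 hre2).trans hbound
  have h7 : C * (((r : ℝ) * (br r).1)⁻¹) ^ M ≤ |C| * k⁻¹ ^ M * ((r : ℝ)⁻¹) ^ (2 * M) := by
    have h8 : ((r : ℝ) * (br r).1)⁻¹ ≤ k⁻¹ * (r : ℝ)⁻¹ ^ 2 := by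
      rw [inv_pow, ← mul_inv]
      refine inv_anti₀ (by positivity) ?_
      have := hkdiv r hle
      nlinarith
    rw [pow_mul, mul_assoc, ← mul_pow]
    refine mul_le_mul (le_abs_self C) (pow_le_pow_left₀ (by positivity) h8 M) (by positivity)
      (abs_nonneg _)
  linarith

end moderate

/-! ### Moderate growth near infinite points of negative real part -/

section moderate

variable {R : ℝ} {N q : ℕ} {μ : ℂ → ℂ}

theorem eventually_chart {P : Pre N q → Prop} {p : Pre N q}
    (h : match p with
      | .inl a => ∀ᶠ a' : Polar × ℂ in 𝓝 a, P (.inl a')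
      | .inr (.inl (j, a)) => ∀ᶠ a' : Polar × Polar in 𝓝 a, P (.inr (.inl (j, a')))
      | .inr (.inr (.inl a)) => ∀ᶠ a' : Polar × Polar in 𝓝 a, P (.inr (.inr (.inl a')))
      | .inr (.inr (.inr (.inl (s, a)))) =>
          ∀ᶠ a' : Polar × Polar in 𝓝 a, P (.inr (.inr (.inr (.inl (s, a')))))
      | .inr (.inr (.inr (.inr a))) =>
          ∀ᶠ a' : Polar × ℂ in 𝓝 a, P (.inr (.inr (.inr (.inr a'))))) :
    ∀ᶠ p' in 𝓝 p, P p' := by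
  rcases p with a | ⟨j, a⟩ | a | ⟨s, a⟩ | a
  · rw [← IsOpenEmbedding.inl.map_nhds_eq]
    exact h
  · rw [← IsOpenEmbedding.inr.map_nhds_eq, ← IsOpenEmbedding.inl.map_nhds_eq, nhds_prod_eq,
      nhds_discrete, Filter.pure_prod]
    exact h
  · rw [← IsOpenEmbedding.inr.map_nhds_eq, ← IsOpenEmbedding.inr.map_nhds_eq,
      ← IsOpenEmbedding.inl.map_nhds_eq]
    exact h
  · rw [← IsOpenEmbedding.inr.map_nhds_eq, ← IsOpenEmbedding.inr.map_nhds_eq,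
      ← IsOpenEmbedding.inr.map_nhds_eq, ← IsOpenEmbedding.inl.map_nhds_eq, nhds_prod_eq,
      nhds_discrete, Filter.pure_prod]
    exact h
  · rw [← IsOpenEmbedding.inr.map_nhds_eq, ← IsOpenEmbedding.inr.map_nhds_eq,
      ← IsOpenEmbedding.inr.map_nhds_eq, ← IsOpenEmbedding.inr.map_nhds_eq]
    exact h

theorem eventually_not_and {α : Type*} [TopologicalSpace α] {a : α} {u : α → ℝ≥0} {z : α → ℂ}
    {w : ℂ} (hu : ContinuousAt u a) (hz : ContinuousAt z a) {P Q : Prop}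
    (h : ¬ (P ∧ Q ∧ u a = 0 ∧ z a = w)) : ∀ᶠ x in 𝓝 a, ¬ (P ∧ Q ∧ u x = 0 ∧ z x = w) := by
  by_cases hP : P
  · by_cases hQ : Q
    · by_cases h0 : u a = 0
      · filter_upwards [hz.eventually_ne fun h1 => h ⟨hP, hQ, h0, h1⟩] with x hx h2
        exact hx h2.2.2.2
      · filter_upwards [hu.eventually_ne h0] with x hx h2
        exact hx h2.2.2.1
    · exact Filter.Eventually.of_forall fun x h2 => hQ h2.2.1
  · exact Filter.Eventually.of_forall fun x h2 => hP h2.1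

/-- Needed to turn neighbourhoods inside the chart domains into neighbourhoods in `Pre`, where the
approach to the divisor is constructed. -/
theorem isOpen_inChart (h : PolarPart R N q μ) : IsOpen {p : Pre N q | InChart R μ p} := by
  have hc := continuous_toC
  refine isOpen_iff_eventually.2 fun p hp => eventually_chart ?_
  have hlt : ∀ {α : Type} [TopologicalSpace α] {a : α} {f : α → ℝ≥0}, Continuous f →
      (f a : ℝ) < R → ∀ᶠ x in 𝓝 a, (f x : ℝ) < R := fun hf h1 =>
    ((NNReal.continuous_coe.comp hf).tendsto _).eventually (gt_mem_nhds h1)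
  rcases p with ⟨t, x⟩ | ⟨j, u, v⟩ | ⟨t, v⟩ | ⟨s, u, v⟩ | ⟨t, z⟩
  · exact hlt (f := fun a : Polar × ℂ => a.1.1) (by fun_prop) hp
  · refine (hlt (f := fun a : Polar × Polar => a.1.1 * a.2.1) (by fun_prop) hp.1).and
      (Filter.Eventually.and ?_ ?_)
    · exact eventually_not_and (u := fun a : Polar × Polar => a.2.1) (z := fun a => toC a.1)
        (by fun_prop) (by fun_prop) hp.2.1
    · exact eventually_not_and (u := fun a : Polar × Polar => a.1.1)
        (z := fun a => toC a.2 * μ 0) (by fun_prop) (by fun_prop) hp.2.2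
  · refine (hlt (f := fun a : Polar × Polar => a.1.1) (by fun_prop) hp.1).and ?_
    exact eventually_not_and (u := fun a : Polar × Polar => a.1.1)
      (z := fun a => toC a.2 * μ 0) (by fun_prop) (by fun_prop) hp.2
  · refine (hlt (f := fun a : Polar × Polar => a.1.1 * a.2.1) (by fun_prop) hp.1).and ?_
    have h1 := h.continuousAt_comp (t := fun a : Polar × Polar => a.1 * a.2) (a := (u, v))
      (by fun_prop) hp.1
    exact ContinuousAt.eventually_ne (g := fun a : Polar × Polar =>
      μ (toC (a.1 * a.2)) + toC a.1 ^ (s : ℕ) * toC a.2 ^ ((s : ℕ) + 1)) (h1.add (by fun_prop)) hp.2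
  · have h1 := h.continuousAt_comp (t := fun a : Polar × ℂ => a.1) (a := (t, z))
      (by fun_prop) hp.2.1
    refine (Filter.Eventually.of_forall fun _ => hp.1).and
      ((hlt (f := fun a : Polar × ℂ => a.1.1) (by fun_prop) hp.2.1).and ?_)
    exact ContinuousAt.eventually_ne (g := fun a : Polar × ℂ => μ (toC a.1) + toC a.1 ^ q * a.2)
      (h1.add (by fun_prop)) hp.2.2

theorem thW_eq_thN_one (n k : ℕ) (A : ℂ) (t : Polar) : thW n k A t = thN n k A t 1 := by
  rw [thN_eq_thW (by exact one_ne_zero), inv_one, toC_one, mul_one]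

theorem exists_thE_eq_thN {j : ℕ} (A : ℂ) (u v : Polar) :
    ∃ i ≤ j + 1, ∃ w, ∀ k, thE j k A u v = thN i k A (u * v) w := by
  by_cases hu : u.1 = 0
  · exact ⟨j, Nat.le_succ j, v, fun k => thE_eq_thN_of_fst hu⟩
  · exact ⟨j + 1, le_rfl, u⁻¹, fun k => thE_eq_thN_left hu⟩

/-- The form of the functions `x' t ^ k` on the divisor, where `x' = x - μ t / t ^ q`. -/
theorem xPow'_on_divisor (h : PolarPart R N q μ) {p : Pre N q} (hp : InChart R μ p)
    (ht : (tPolar p).1 = 0) :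
    (∃ z, ∀ k, xPow' μ k p = thW 0 k z (tPolar p)) ∨
      ∃ j ≤ N, ∃ A ≠ 0, ∃ v, ∀ k, xPow' μ k p = thN j k A (tPolar p) v := by
  have hqN := h.le
  rcases p with ⟨t, x⟩ | ⟨j, u, v⟩ | ⟨t, v⟩ | ⟨s, u, v⟩ | ⟨t, z⟩
  · rcases eq_or_ne q 0 with rfl | hq
    · exact .inl ⟨_, fun k => rfl⟩
    · exact .inr ⟨q, hqN, _, h.base_ne_zero hq ht x, 1, fun k => thW_eq_thN_one _ _ _ _⟩
  · have huv := mul_eq_zero.1 ht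
    right
    by_cases hj : q ≤ j
    · obtain ⟨i, hi, w, hw⟩ := exists_thE_eq_thN (j := j)
        (1 - μ (toC (u * v)) * toC (u ^ (j - q : ℕ) * v ^ (j + 1 - q : ℕ))) u v
      refine ⟨i, by have := j.2; omega, _, h.crossing_ne_zero hj hp huv, w, fun k => ?_⟩
      exact (if_pos hj).trans (hw k)
    · refine ⟨q, hqN, _, h.crossing_ne_zero' hj hp huv, 1, fun k => ?_⟩
      exact (if_neg hj).trans (thW_eq_thN_one _ _ _ _)
  · exact .inr ⟨N, le_rfl, _, h.end_ne_zero hp (.inl ht), v, fun k => rfl⟩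
  · right
    obtain ⟨i, hi, w, hw⟩ := exists_thE_eq_thN (j := q - s - 1) 1 v u
    refine ⟨i, by omega, 1, one_ne_zero, w, fun k => ?_⟩
    rw [mul_comm v u] at hw
    exact hw k
  · exact .inl ⟨z, fun k => rfl⟩

theorem norm_xPow'_zero_le (h : PolarPart R N q μ) {p : Pre N q} (hp : InChart R μ p)
    (ht : (tPolar p).1 = 0) : ‖xPow' μ 0 p‖ ≤ 1 := by
  rcases xPow'_on_divisor h hp ht with ⟨z, hz⟩ | ⟨j, -, A, -, v, hv⟩
  · rw [hz]
    exact norm_th_le _ _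
  · rw [hv, thN_of_le (Nat.zero_le _)]
    exact norm_th_le _ _

/-- The term `k = 0` is the compactified `x'`. It equals `psi'` if `j = 0`. If `j > 0`, it is an
infinite point and `psi'` is a multiple of it by a real number at least `1`, so neither value lies
in the open disc and the signs of the real parts agree. -/
theorem psi'_mem_discHalf_iff (h : PolarPart R N q μ) (p : {p : Pre N q // InChart R μ p})
    (ht : (tPolar p.1).1 = 0) :
    BlowUp.psi' h (BlowUp.mk p) ∈ discHalf ↔ xPow' μ 0 p.1 ∈ discHalf := by
  rw [BlowUp.psi'_mk]
  rcases xPow'_on_divisor h p.2 ht with ⟨z, hz⟩ | ⟨j, hj, A, hA, v, hv⟩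
  · simp only [hz]
    rw [sumPow_thW (Nat.zero_le _) (.inl rfl) ht]
    refine iff_of_true (.inl ?_) (.inl (norm_th_lt_one _ one_ne_zero))
    have := norm_shift_lt (n := 0) (X := z * ((tPolar p.1).2 : ℂ)⁻¹ ^ 0) (.inl rfl)
    simpa using this
  · simp only [hv]
    rw [sumPow_thN hj hA ht]
    rcases Nat.eq_zero_or_pos j with rfl | hj0
    · rw [thN_of_le le_rfl, th_eq_inv]
      have hA' : (‖A‖ : ℂ) ≠ 0 := by exact_mod_cast norm_ne_zero_iff.2 hA
      have e : A / (‖A‖ : ℂ) * (((tPolar p.1).2 : ℂ) ^ 0 * (v.2 : ℂ))⁻¹ *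
          (((0 : ℕ) + ‖A‖ / (‖A‖ + v.1) : ℝ) : ℂ) = A * ((((tPolar p.1) ^ (0 - 0) * v).2 : Circle) : ℂ)⁻¹ /
            ((‖A‖ + (((tPolar p.1) ^ (0 - 0) * v).1 : ℝ≥0) : ℝ) : ℂ) := by
        rw [Nat.sub_zero, pow_zero, pow_zero, one_mul, one_mul]
        push_cast
        field_simp
        ring
      rw [e]
    · have h0 := thN_eq_of_lt hj0 ht (A := A) v
      rw [pow_zero, one_mul] at h0
      rw [← h0]
      have h1 : ‖thN j 0 A (tPolar p.1) v‖ = 1 := by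
        rw [h0, norm_mul, norm_inv, norm_mul, norm_pow, Circle.norm_coe, Circle.norm_coe, one_pow,
          mul_one, inv_one, mul_one, norm_div, Complex.norm_real, norm_norm,
          div_self (norm_ne_zero_iff.2 hA)]
      generalize thN j 0 A (tPolar p.1) v = w at h1
      have hpos : (1 : ℝ) ≤ j + ‖A‖ / (‖A‖ + v.1) := by
        have : (1 : ℝ) ≤ j := by exact_mod_cast hj0
        have : 0 ≤ ‖A‖ / (‖A‖ + v.1) := by positivity
        linarith
      generalize (j + ‖A‖ / (‖A‖ + v.1) : ℝ) = r at hpos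
      have h2 : ¬ ‖w * (r : ℂ)‖ < 1 := by
        rw [norm_mul, h1, one_mul, Complex.norm_real, Real.norm_of_nonneg (by linarith)]
        linarith
      simp only [discHalf, Set.mem_ofPred_eq, h2, h1, lt_irrefl, false_or, Complex.re_mul_ofReal]
      constructor <;> intro h3 <;> nlinarith

/-- Near a finite value `x'` is bounded, and near an infinite point of negative real part `x'` has
negative real part. Either way `exp x'` is bounded, so `M = 0` works. -/
theorem moderateAt_of_mem (h : PolarPart R N q μ) (p : {p : Pre N q // InChart R μ p})
    (hp : xPow' μ 0 p.1 ∈ discHalf) : ModerateAt R N q μ (BlowUp.mk p) := by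
  have hc : ContinuousAt (fun p' : {p : Pre N q // InChart R μ p} => xPow' μ 0 p'.1) p :=
    (continuousAt_xPow' h (Nat.zero_le _) p.2).comp continuous_subtype_val.continuousAt
  have hval : ∀ p' : {p : Pre N q // InChart R μ p}, divisorEq p'.1 ≠ 0 →
      xPow' μ 0 p'.1 = th (xCoord μ p'.1 - μ (tCoord p'.1) / tCoord p'.1 ^ q) 1 := by
    intro p' hp'
    rw [xPow'_off h.le hp', pow_zero, mul_one]
  refine ⟨p, rfl, ?_⟩
  rcases hp with hp | hp
  · obtain ⟨r, hr0, hr1⟩ := exists_between hp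
    -- A compactified value of norm less than `r` comes from a number of norm less than `r / (1 -
    -- r)`.
    refine ⟨Real.exp (r / (1 - r)), 0, ?_⟩
    filter_upwards [hc.norm.eventually (gt_mem_nhds hr0)] with p' hp' hd
    rw [hval p' hd, norm_th] at hp'
    rw [pow_zero, mul_one, Complex.norm_exp]
    refine Real.exp_le_exp.2 ((Complex.re_le_norm _).trans ?_)
    generalize xCoord μ p'.1 - μ (tCoord p'.1) / tCoord p'.1 ^ q = z at hp'
    simp only [Prod.fst_one, NNReal.coe_one] at hp'
    rw [div_lt_iff₀ (by positivity)] at hp'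
    rw [le_div_iff₀ (by linarith)]
    linarith
  · refine ⟨1, 0, ?_⟩
    filter_upwards [(Complex.continuous_re.continuousAt.comp hc).eventually (gt_mem_nhds hp)]
      with p' hp' hd
    have hp' : (xPow' μ 0 p'.1).re < 0 := hp'
    rw [hval p' hd, th_one_re] at hp'
    rw [pow_zero, mul_one, Complex.norm_exp, Real.exp_le_one_iff]
    by_contra hcon
    have : 0 ≤ (xCoord μ p'.1 - μ (tCoord p'.1) / tCoord p'.1 ^ q).re /
        (‖xCoord μ p'.1 - μ (tCoord p'.1) / tCoord p'.1 ^ q‖ + 1) :=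
      div_nonneg (not_le.1 hcon).le (by positivity)
    linarith

end moderate

/-! ### The moderate growth criterion -/

section moderate

variable {R : ℝ} {N q : ℕ} {μ : ℂ → ℂ}

theorem thE_zero (j : ℕ) (A : ℂ) (u v : Polar) : thE j 0 A u v = th A (u ^ j * v ^ (j + 1)) :=
  if_pos (Nat.zero_le _)

theorem norm_thW_zero_zero (A : ℂ) (t : Polar) : ‖thW 0 0 A t‖ < 1 :=
  norm_th_lt_one _ one_ne_zero

theorem thW_zero {n : ℕ} (hn : n ≠ 0) (A : ℂ) (t : Polar) : thW n 0 A t = th A (t ^ n) :=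
  if_pos (Nat.pos_of_ne_zero hn)

/-- In every chart some coordinate of radius `0` occurs with non-zero exponent in the denominator of
`x'`; otherwise the compactified value would have norm less than `1`. This coordinate takes the role
of `a` in `not_moderate_of_chart`. -/
theorem not_moderate_chart (h : PolarPart R N q μ) {p : Pre N q} (hp : InChart R μ p)
    (ht : (tPolar p).1 = 0) (h1 : ‖xPow' μ 0 p‖ = 1) (hre : 0 ≤ (xPow' μ 0 p).re) (C : ℝ) (M : ℕ) :
    ¬ ∀ᶠ p' in 𝓝 p, divisorEq p' ≠ 0 →
      ‖Complex.exp (xCoord μ p' - μ (tCoord p') / tCoord p' ^ q)‖ ≤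
        C * ((divisorEq p' : ℝ)⁻¹) ^ M := by
  have hμ : ContinuousAt μ 0 := h.cont.continuousAt (Metric.ball_mem_nhds 0 h.pos)
  have hμ1 : ∀ w : ℂ × ℂ, w.1 = 0 → ContinuousAt (fun w : ℂ × ℂ => μ w.1) w := fun w hw =>
    ContinuousAt.comp (f := fun w : ℂ × ℂ => w.1) (by rw [hw]; exact hμ) continuous_fst.continuousAt
  have hμ2 : ∀ w : ℂ × ℂ, w.1 * w.2 = 0 → ContinuousAt (fun w : ℂ × ℂ => μ (w.1 * w.2)) w :=
    fun w hw => ContinuousAt.comp (f := fun w : ℂ × ℂ => w.1 * w.2) (by rw [hw]; exact hμ)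
      (by fun_prop)
  rcases p with ⟨t, x⟩ | ⟨j, u, v⟩ | ⟨t, v⟩ | ⟨s, u, v⟩ | ⟨t, z⟩
  · have ht : t.1 = 0 := ht
    have hq : q ≠ 0 := by
      rintro rfl
      exact (norm_thW_zero_zero _ _).ne h1
    -- The base chart has one polar coordinate only; the second one is a dummy, kept at `1`.
    refine not_moderate_of_chart h.le (f := fun a b => base a x) (a := t) (b := 1) (n := q) (m := 0)
      (A := fun w _ => x * w ^ q - μ w) ?_ ?_ hq ht ?_ ?_ h1 hre C M
    · exact continuous_inl.comp (by fun_prop)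
    · exact ContinuousAt.sub (by fun_prop) (hμ1 _ (toC_eq_zero.2 ht))
    · intro a b
      refine (thW_zero hq _ _).trans ?_
      rw [toC_pow, pow_zero, mul_one]
    · intro a b hb
      rw [hb one_ne_zero]
      exact (mul_one _).symm
  · have huv : u.1 = 0 ∨ v.1 = 0 := mul_eq_zero.1 ht
    have hw : toC u * toC v = 0 := by rw [← toC_mul]; exact toC_eq_zero.2 ht
    have hw' : toC v * toC u = 0 := by rw [mul_comm]; exact hw
    by_cases hj : q ≤ j
    · have hx : ∀ a b, xPow' μ 0 (crossing j a b : Pre N q) =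
          th (1 - μ (toC a * toC b) * (toC a ^ (j - q : ℕ) * toC b ^ (j + 1 - q : ℕ)))
            (a ^ (j : ℕ) * b ^ ((j : ℕ) + 1)) := by
        intro a b
        refine (if_pos hj).trans ((thE_zero _ _ _ _).trans ?_)
        rw [toC_mul, toC_mul, toC_pow, toC_pow]
      by_cases hv : v.1 = 0
      · refine not_moderate_of_chart h.le (f := fun a b => crossing j b a) (a := v) (b := u)
          (n := j + 1) (m := j)
          (A := fun a b => 1 - μ (a * b) * (b ^ (j - q : ℕ) * a ^ (j + 1 - q : ℕ))) ?_ ?_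
          (Nat.succ_ne_zero _) hv ?_ ?_ h1 hre C M
        · exact continuous_crossing j continuous_snd continuous_fst
        · exact continuousAt_const.sub ((hμ2 _ hw').mul (by fun_prop))
        · intro a b
          rw [hx, mul_comm (toC b), mul_comm (b ^ (j : ℕ))]
        · intro a b _
          exact mul_comm _ _
      · have hj0 : (j : ℕ) ≠ 0 := by
          intro h0
          have h2 := hx u v
          rw [h0, pow_zero, one_mul, zero_add, pow_one] at h2
          have h3 := congrArg norm h2
          exact (norm_th_lt_one _ hv).ne (h3.symm.trans h1)
        refine not_moderate_of_chart h.le (f := fun a b => crossing j a b) (a := u) (b := v)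
          (n := j) (m := j + 1)
          (A := fun a b => 1 - μ (a * b) * (a ^ (j - q : ℕ) * b ^ (j + 1 - q : ℕ))) ?_ ?_
          hj0 (huv.resolve_right hv) hx (fun _ _ _ => rfl) h1 hre C M
        · exact continuous_crossing j continuous_fst continuous_snd
        · exact continuousAt_const.sub ((hμ2 _ hw).mul (by fun_prop))
    · have hq : q ≠ 0 := by omega
      have hx : ∀ a b, xPow' μ 0 (crossing j a b : Pre N q) =
          th (toC a ^ (q - j : ℕ) * toC b ^ (q - j - 1 : ℕ) - μ (toC a * toC b))
            (a ^ q * b ^ q) := by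
        intro a b
        refine (if_neg hj).trans ((thW_zero hq _ _).trans ?_)
        rw [toC_mul, toC_mul, toC_pow, toC_pow, mul_pow]
      by_cases hv : v.1 = 0
      · refine not_moderate_of_chart h.le (f := fun a b => crossing j b a) (a := v) (b := u)
          (n := q) (m := q)
          (A := fun a b => b ^ (q - j : ℕ) * a ^ (q - j - 1 : ℕ) - μ (a * b)) ?_ ?_
          hq hv ?_ ?_ h1 hre C M
        · exact continuous_crossing j continuous_snd continuous_fst
        · exact ContinuousAt.sub (by fun_prop) (hμ2 _ hw')
        · intro a b
          rw [hx, mul_comm (b ^ q), mul_comm (toC b) (toC a)]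
        · intro a b _
          exact mul_comm _ _
      · refine not_moderate_of_chart h.le (f := fun a b => crossing j a b) (a := u) (b := v)
          (n := q) (m := q)
          (A := fun a b => a ^ (q - j : ℕ) * b ^ (q - j - 1 : ℕ) - μ (a * b)) ?_ ?_
          hq (huv.resolve_right hv) hx (fun _ _ _ => rfl) h1 hre C M
        · exact continuous_crossing j continuous_fst continuous_snd
        · exact ContinuousAt.sub (by fun_prop) (hμ2 _ hw)
  · have ht : t.1 = 0 := ht
    have hx : ∀ a b, xPow' μ 0 (endChart a b : Pre N q) =
        th (1 - μ (toC a) * (toC a ^ (N - q) * toC b)) (a ^ N * b ^ 1) := by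
      intro a b
      refine (thN_of_le (Nat.zero_le _) _ _ _).trans ?_
      rw [toC_mul, toC_pow, Nat.sub_zero, pow_one]
    by_cases hv : v.1 = 0
    · refine not_moderate_of_chart h.le (f := fun a b => endChart b a) (a := v) (b := t)
        (n := 1) (m := N) (A := fun a b => 1 - μ b * (b ^ (N - q) * a)) ?_ ?_ one_ne_zero hv ?_ ?_
        h1 hre C M
      · exact continuous_endChart continuous_snd continuous_fst
      · refine continuousAt_const.sub (ContinuousAt.mul ?_ (by fun_prop))
        exact ContinuousAt.comp (f := fun w : ℂ × ℂ => w.2)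
          (by rw [toC_eq_zero.2 ht]; exact hμ) continuous_snd.continuousAt
      · intro a b
        rw [hx, mul_comm (b ^ N)]
      · intro a b _
        exact mul_comm _ _
    · have hN : N ≠ 0 := by
        intro h0
        have h2 := hx t v
        have e : t ^ N = 1 := by rw [h0, pow_zero]
        rw [e, one_mul, pow_one] at h2
        exact (norm_th_lt_one _ hv).ne ((congrArg norm h2).symm.trans h1)
      refine not_moderate_of_chart h.le (f := fun a b => endChart a b) (a := t) (b := v)
        (n := N) (m := 1) (A := fun a b => 1 - μ a * (a ^ (N - q) * b)) ?_ ?_ hN ht hx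
        (fun _ _ _ => rfl) h1 hre C M
      · exact continuous_endChart continuous_fst continuous_snd
      · exact continuousAt_const.sub ((hμ1 _ (toC_eq_zero.2 ht)).mul (by fun_prop))
  · have huv : u.1 = 0 ∨ v.1 = 0 := mul_eq_zero.1 ht
    have hx : ∀ a b, xPow' μ 0 (branch s a b : Pre N q) =
        th 1 (b ^ (q - s - 1 : ℕ) * a ^ (q - s - 1 + 1 : ℕ)) := fun a b => thE_zero _ _ _ _
    by_cases hu : u.1 = 0
    · refine not_moderate_of_chart h.le (f := fun a b => branch s a b) (a := u) (b := v)
        (n := q - s - 1 + 1) (m := q - s - 1) (A := fun _ _ => 1) ?_ continuousAt_const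
        (Nat.succ_ne_zero _) hu ?_ (fun _ _ _ => rfl) h1 hre C M
      · exact continuous_branch s continuous_fst continuous_snd
      · intro a b
        rw [hx, mul_comm (b ^ _)]
    · have hs : q - (s : ℕ) - 1 ≠ 0 := by
        intro h0
        have h2 := hx u v
        rw [h0, pow_zero, one_mul, zero_add, pow_one] at h2
        exact (norm_th_lt_one _ hu).ne ((congrArg norm h2).symm.trans h1)
      refine not_moderate_of_chart h.le (f := fun a b => branch s b a) (a := v) (b := u)
        (n := q - s - 1) (m := q - s - 1 + 1) (A := fun _ _ => 1) ?_ continuousAt_const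
        hs (huv.resolve_left hu) (fun a b => hx b a) (fun _ _ _ => mul_comm _ _) h1 hre C M
      exact continuous_branch s continuous_snd continuous_fst
  · exact absurd h1 (norm_thW_zero_zero _ _).ne

/-- The right-hand side is expressed by `psi'`, so the chart chosen in `ModerateAt` does not matter.
-/
theorem mem_moderateSet_iff (h : PolarPart R N q μ) {ϑ : Circle} {ζ : BlowUp R N q μ} :
    ζ ∈ moderateSet R N q μ ϑ ↔ ζ ∈ fibre R N q μ ϑ ∧ BlowUp.psi' h ζ ∈ discHalf := by
  refine and_congr_right fun hζ => ?_
  have hζ : ζ.proj = (0, ϑ) := hζ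
  constructor
  · rintro ⟨p, rfl, C, M, hev⟩
    have ht : (tPolar p.1).1 = 0 := by
      have : tPolar p.1 = (0, ϑ) := hζ
      rw [this]
    rw [psi'_mem_discHalf_iff h p ht]
    by_contra hcon
    rw [discHalf, Set.mem_ofPred_eq, not_or, not_lt, not_lt] at hcon
    refine not_moderate_chart h p.2 ht
      (le_antisymm (norm_xPow'_zero_le h p.2 ht) hcon.1) hcon.2 C M ?_
    have hm := (isOpen_inChart h).isOpenEmbedding_subtypeVal.map_nhds_eq p
    have h2 : ∀ᶠ p' in Filter.map Subtype.val (𝓝 p), divisorEq p' ≠ 0 →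
      ‖Complex.exp (xCoord μ p' - μ (tCoord p') / tCoord p' ^ q)‖ ≤
        C * ((divisorEq p' : ℝ)⁻¹) ^ M := hev
    have h3 : Filter.map Subtype.val (𝓝 p) = 𝓝 p.1 := hm
    rwa [h3] at h2
  · intro hmem
    induction ζ using Quot.ind with | mk p
    have ht : (tPolar p.1).1 = 0 := by
      have : tPolar p.1 = (0, ϑ) := hζ
      rw [this]
    exact moderateAt_of_mem h p ((psi'_mem_discHalf_iff h p ht).1 hmem)

end moderate

/-! ### The marked points -/

section curves

variable {R : ℝ} {N q : ℕ} {μ : ℂ → ℂ}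

theorem continuousAt_sumPow {α : Type*} [TopologicalSpace α] {t : α → Polar} {f : ℕ → α → ℂ} {a : α}
    (ht : ContinuousAt t a) (hf : ∀ k ≤ N, ContinuousAt (f k) a) :
    ContinuousAt (fun a => sumPow (t a) N (fun k => f k a)) a := by
  unfold sumPow
  refine tendsto_finsetSum _ fun k hk => ?_
  have hk := hf k (by simpa [Nat.lt_succ_iff] using hk)
  have hc : ContinuousAt (fun a => ((t a).2 : ℂ)) a := by fun_prop
  exact ((hc.inv₀ (Circle.coe_ne_zero _)).pow k).mul hk

theorem tPolar_ne_zero {p : Pre N q} (hp : divisorEq p ≠ 0) : (tPolar p).1 ≠ 0 := by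
  rcases p with ⟨t, x⟩ | ⟨j, u, v⟩ | ⟨t, v⟩ | ⟨s, u, v⟩ | ⟨t, z⟩
  · exact hp
  · exact hp
  · exact left_ne_zero_of_mul hp
  · exact hp
  · exact hp

theorem sumPow_off {t : Polar} (ht : t.1 ≠ 0) (n : ℕ) (A : ℂ) :
    sumPow t N (fun k => th (A / toC t ^ n * toC t ^ k) 1) = sumPow t N (fun k => thW n k A t) := by
  congr 1
  ext k
  rw [thW_off _ _ _ ht]

/-- A continuous function which is equal off the divisor to the compactification of `A t / t ^ n`
along a set has the corresponding limit at points of the closure of this set. -/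
theorem eq_shift_of_mem_closure {E : Set (BlowUp R N q μ)} {f : BlowUp R N q μ → ℂ}
    (hf : Continuous f) {n : ℕ} (hn : n ≤ N) {A : ℂ → ℂ} (hA : ContinuousAt A 0)
    (hA0 : n = 0 ∨ A 0 ≠ 0) {X : ℂ → ℂ}
    (hX : ∀ᶠ t in 𝓝 (0 : ℂ), t ≠ 0 → X t = A t / t ^ n)
    (hE : ∀ ζ ∈ E, ζ.proj.1 ≠ 0 ∧
      f ζ = sumPow ζ.proj N (fun k => th (X (toC ζ.proj) * toC ζ.proj ^ k) 1))
    {ζ : BlowUp R N q μ} (hζ : ζ ∈ closure E) {ϑ : Circle} (hζϑ : ζ ∈ fibre R N q μ ϑ) :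
    f ζ = shift n (A 0 * ((ϑ : ℂ)⁻¹) ^ n) := by
  have hζϑ : ζ.proj = (0, ϑ) := hζϑ
  have h0 : toC (0, ϑ) = 0 := toC_eq_zero.2 rfl
  have hproj : ContinuousAt (BlowUp.proj : BlowUp R N q μ → Polar) ζ :=
    BlowUp.continuous_proj.continuousAt
  have hG : ContinuousAt (fun t : Polar => sumPow t N (fun k => thW n k (A (toC t)) t)) (0, ϑ) := by
    refine continuousAt_sumPow continuousAt_id fun k _ => continuousAt_thW ?_ continuousAt_id ?_
    · refine ContinuousAt.comp (f := toC) ?_ continuous_toC.continuousAt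
      rw [h0]
      exact hA
    · rcases hA0 with h1 | h1
      · exact .inl (h1 ▸ Nat.zero_le k)
      · refine .inr (.inl ?_)
        rw [h0]
        exact h1
  have hGp : Filter.Tendsto (fun ζ' : BlowUp R N q μ =>
      sumPow ζ'.proj N (fun k => thW n k (A (toC ζ'.proj)) ζ'.proj)) (𝓝 ζ)
      (𝓝 (sumPow (0, ϑ) N (fun k => thW n k (A (toC (0, ϑ))) (0, ϑ)))) := by
    rw [← hζϑ] at hG ⊢
    exact hG.tendsto.comp hproj
  rw [sumPow_thW hn (by rw [h0]; exact hA0) rfl, h0] at hGp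
  have : (𝓝[E] ζ).NeBot := mem_closure_iff_nhdsWithin_neBot.1 hζ
  refine tendsto_nhds_unique (l := 𝓝[E] ζ) (hf.continuousAt.tendsto.mono_left nhdsWithin_le_nhds)
    ((hGp.mono_left nhdsWithin_le_nhds).congr' ?_)
  have htoC : Filter.Tendsto (fun ζ' : BlowUp R N q μ => toC ζ'.proj) (𝓝 ζ) (𝓝 0) := by
    have h1 := (continuous_toC.tendsto (BlowUp.proj ζ)).comp hproj.tendsto
    rw [hζϑ, h0] at h1
    exact h1
  filter_upwards [self_mem_nhdsWithin, nhdsWithin_le_nhds (htoC.eventually hX)] with ζ' hζ' hX'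
  obtain ⟨h1, h2⟩ := hE ζ' hζ'
  rw [h2, hX' (toC_ne_zero.2 h1), sumPow_off h1]

/-- The points off the divisor of the curve with the equation `S t x`. -/
def curve (R : ℝ) (N q : ℕ) (μ : ℂ → ℂ) (S : ℂ → ℂ → Prop) : Set (BlowUp R N q μ) :=
  {ζ | ∃ p : {p : Pre N q // InChart R μ p}, BlowUp.mk p = ζ ∧ divisorEq p.1 ≠ 0 ∧
    S (tCoord p.1) (xCoord μ p.1)}

theorem psi_strictTransform (h : PolarPart R N q μ) {S : ℂ → ℂ → Prop} {X A : ℂ → ℂ} {n : ℕ}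
    (hS : ∀ t x, t ≠ 0 → S t x → x = X t) (hn : n ≤ N) (hA : ContinuousAt A 0)
    (hA0 : n = 0 ∨ A 0 ≠ 0) (hX : ∀ᶠ t in 𝓝 (0 : ℂ), t ≠ 0 → X t = A t / t ^ n)
    {ζ : BlowUp R N q μ} {ϑ : Circle} (hζ : ζ ∈ strictTransform R N q μ S)
    (hζϑ : ζ ∈ fibre R N q μ ϑ) : BlowUp.psi h ζ = shift n (A 0 * ((ϑ : ℂ)⁻¹) ^ n) := by
  refine eq_shift_of_mem_closure (E := curve R N q μ S) (BlowUp.continuous_psi h) hn hA hA0 hX ?_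
    hζ hζϑ
  rintro _ ⟨p, rfl, hp, hpS⟩
  have ht := tPolar_ne_zero hp
  refine ⟨ht, ?_⟩
  rw [BlowUp.psi_mk]
  simp only [xPow_off hp, hS _ _ (toC_ne_zero.2 ht) hpS]
  rfl

theorem psi'_strictTransform (h : PolarPart R N q μ) {S : ℂ → ℂ → Prop} {X A : ℂ → ℂ} {n : ℕ}
    (hS : ∀ t x, t ≠ 0 → S t x → x - μ t / t ^ q = X t) (hn : n ≤ N) (hA : ContinuousAt A 0)
    (hA0 : n = 0 ∨ A 0 ≠ 0) (hX : ∀ᶠ t in 𝓝 (0 : ℂ), t ≠ 0 → X t = A t / t ^ n)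
    {ζ : BlowUp R N q μ} {ϑ : Circle} (hζ : ζ ∈ strictTransform R N q μ S)
    (hζϑ : ζ ∈ fibre R N q μ ϑ) : BlowUp.psi' h ζ = shift n (A 0 * ((ϑ : ℂ)⁻¹) ^ n) := by
  refine eq_shift_of_mem_closure (E := curve R N q μ S) (BlowUp.continuous_psi' h) hn hA hA0 hX ?_
    hζ hζϑ
  rintro _ ⟨p, rfl, hp, hpS⟩
  have ht := tPolar_ne_zero hp
  refine ⟨ht, ?_⟩
  rw [BlowUp.psi'_mk]
  simp only [xPow'_off h.le hp, hS (tCoord p.1) _ (toC_ne_zero.2 ht) hpS]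
  rfl

/-- Along a curve with the pole order of `ψ`, leading terms in `x - ψ` may cancel; `n` is the order
of the pole that is left, or `0` if none is. -/
theorem exists_reduced_fraction {g : ℂ → ℂ} (hg : AnalyticAt ℂ g 0) (q : ℕ) :
    ∃ n ≤ q, ∃ A : ℂ → ℂ, ContinuousAt A 0 ∧ (n = 0 ∨ A 0 ≠ 0) ∧
      ∀ᶠ t in 𝓝 (0 : ℂ), t ≠ 0 → g t / t ^ q = A t / t ^ n := by
  by_cases h0 : ∀ᶠ t in 𝓝 (0 : ℂ), g t = 0
  · refine ⟨0, Nat.zero_le _, fun _ => 0, continuousAt_const, .inl rfl, ?_⟩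
    filter_upwards [h0] with t ht _
    rw [ht, zero_div, zero_div]
  · obtain ⟨n, ν, hν, hν0, he⟩ := hg.exists_eventuallyEq_pow_smul_nonzero_iff.2 h0
    rcases le_total q n with hn | hn
    · obtain ⟨k, rfl⟩ := Nat.exists_eq_add_of_le hn
      refine ⟨0, Nat.zero_le _, fun t => t ^ k * ν t, ?_, .inl rfl, ?_⟩
      · exact (continuousAt_id.pow k).mul hν.continuousAt
      · filter_upwards [he] with t ht ht0
        rw [ht, sub_zero, smul_eq_mul]
        field_simp
        ring
    · obtain ⟨k, rfl⟩ := Nat.exists_eq_add_of_le hn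
      refine ⟨k, Nat.le_add_left _ _, ν, hν.continuousAt, .inr hν0, ?_⟩
      filter_upwards [he] with t ht ht0
      rw [ht, sub_zero, smul_eq_mul]
      field_simp
      ring

theorem shift_eq_shift {n q : ℕ} {X Y : ℂ} (hX : n = 0 ∨ X ≠ 0) (hY : q = 0 ∨ Y ≠ 0)
    (h : shift n X = shift q Y) : n = q ∧ X = Y := by
  have h1 := norm_shift_lt hX
  have h2 := norm_shift_lt hY
  have h3 := le_norm_shift hX
  have h4 := le_norm_shift hY
  rw [h] at h1 h3
  have h5 : (n : ℝ) < q + 1 := by linarith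
  have h6 : (q : ℝ) < n + 1 := by linarith
  norm_cast at h5 h6
  obtain rfl : n = q := by omega
  exact ⟨rfl, shift_inj hX hY h⟩

/-- Off the one value to which the branch collapses, `psi` alone separates points. -/
theorem fibre_eq_of_psi_eq (h : PolarPart R N q μ) {ϑ : Circle} {ζ ζ' : BlowUp R N q μ}
    (hζ : ζ ∈ fibre R N q μ ϑ) (hζ' : ζ' ∈ fibre R N q μ ϑ)
    (he : BlowUp.psi h ζ = BlowUp.psi h ζ')
    (hne : 1 ≤ q → BlowUp.psi h ζ ≠ shift q (μ 0 * ((ϑ : ℂ)⁻¹) ^ q)) : ζ = ζ' := by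
  have hmain : ∀ ζ'' : BlowUp R N q μ, ζ'' ∈ fibre R N q μ ϑ → BlowUp.psi h ζ = BlowUp.psi h ζ'' →
      OnMain R N q μ (0, ϑ) ζ'' := by
    intro ζ'' h1 h2
    refine (onMain_or_onBranch h rfl h1).resolve_right fun hb => ?_
    obtain ⟨hq, h3, -⟩ := onBranch_values h rfl hb
    exact hne hq (h2.trans h3)
  exact onMain_injective h rfl (hmain ζ hζ rfl) (hmain ζ' hζ' he) he

/-- The value of `psi` is forced by the leading term of the curve, and it determines the point
unless it is the value taken on the branch. In that case `d = q`, and the leading term of `(m - μ) /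
t ^ q` forces the value of `psi'` as well. As `d ≤ N`, the point stays inside the outer circle of
radius `N + 1`. -/
theorem fibre_inter_strictTransform_pole (h : PolarPart R N q μ)
    (hμ : AnalyticAt ℂ μ 0) {d : ℕ} (hd : d ≤ N) {m : ℂ → ℂ}
    (hm : AnalyticAt ℂ m 0) (hm0 : m 0 ≠ 0) (ϑ : Circle) :
    (fibre R N q μ ϑ ∩ strictTransform R N q μ (fun t x => m t = t ^ d * x)).Subsingleton ∧
      ∀ ζ ∈ fibre R N q μ ϑ ∩ strictTransform R N q μ (fun t x => m t = t ^ d * x),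
        ‖BlowUp.psi h ζ‖ < N + 1 := by
  have hval : ∀ ζ ∈ fibre R N q μ ϑ ∩ strictTransform R N q μ (fun t x => m t = t ^ d * x),
      BlowUp.psi h ζ = shift d (m 0 * ((ϑ : ℂ)⁻¹) ^ d) := by
    rintro ζ ⟨h1, h2⟩
    refine psi_strictTransform h (X := fun t => m t / t ^ d) (fun t x ht hx => ?_) hd hm.continuousAt
      (.inr hm0) (Filter.Eventually.of_forall fun _ _ => rfl) h2 h1
    rw [hx, mul_div_cancel_left₀ _ (pow_ne_zero _ ht)]
  have hmϑ : m 0 * ((ϑ : ℂ)⁻¹) ^ d ≠ 0 := mul_ne_zero hm0 (direction_ne_zero _ _)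
  constructor
  · intro ζ hζ ζ' hζ'
    by_cases hc : 1 ≤ q ∧ BlowUp.psi h ζ = shift q (μ 0 * ((ϑ : ℂ)⁻¹) ^ q)
    · obtain ⟨hq, hc⟩ := hc
      obtain ⟨n, hn, A, hA, hA0, hX⟩ := exists_reduced_fraction (hm.sub hμ) q
      rw [hval ζ hζ] at hc
      obtain ⟨rfl, -⟩ := shift_eq_shift (.inr hmϑ)
        (.inr (mul_ne_zero (h.ne_zero (by omega)) (direction_ne_zero _ _))) hc
      have hval' : ∀ ζ ∈ fibre R N d μ ϑ ∩ strictTransform R N d μ (fun t x => m t = t ^ d * x),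
          BlowUp.psi' h ζ = shift n (A 0 * ((ϑ : ℂ)⁻¹) ^ n) := by
        rintro ζ ⟨h1, h2⟩
        refine psi'_strictTransform h (fun t x ht hx => ?_) (hn.trans hd) hA hA0 hX h2 h1
        rw [Pi.sub_apply, hx, sub_div, mul_div_cancel_left₀ _ (pow_ne_zero _ ht)]
      exact fibre_injective h (t := (0, ϑ)) rfl hζ.1 hζ'.1
        ((hval ζ hζ).trans (hval ζ' hζ').symm) ((hval' ζ hζ).trans (hval' ζ' hζ').symm)
    · exact fibre_eq_of_psi_eq h hζ.1 hζ'.1 ((hval ζ hζ).trans (hval ζ' hζ').symm)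
        fun hq he => hc ⟨hq, he⟩
  · intro ζ hζ
    rw [hval ζ hζ]
    have h1 := norm_shift_lt (n := d) (.inr hmϑ)
    have h2 : (d : ℝ) ≤ N := by exact_mod_cast hd
    linarith

theorem fibre_inter_strictTransform_graph (h : PolarPart R N q μ) {m : ℂ → ℂ}
    (hm : ContinuousAt m 0) (ϑ : Circle) :
    (fibre R N q μ ϑ ∩ strictTransform R N q μ (fun t x => x = m t)).Subsingleton ∧
      ∀ ζ ∈ fibre R N q μ ϑ ∩ strictTransform R N q μ (fun t x => x = m t),
        ‖BlowUp.psi h ζ‖ < N + 1 := by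
  have hval : ∀ ζ ∈ fibre R N q μ ϑ ∩ strictTransform R N q μ (fun t x => x = m t),
      BlowUp.psi h ζ = shift 0 (m 0 * ((ϑ : ℂ)⁻¹) ^ 0) := by
    rintro ζ ⟨h1, h2⟩
    refine psi_strictTransform h (X := m) (fun t x ht hx => hx) (Nat.zero_le _) hm
      (.inl rfl) (Filter.Eventually.of_forall fun t _ => ?_) h2 h1
    rw [pow_zero, div_one]
  constructor
  · intro ζ hζ ζ' hζ'
    refine fibre_eq_of_psi_eq h hζ.1 hζ'.1 ((hval ζ hζ).trans (hval ζ' hζ').symm) fun hq he => ?_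
    rw [hval ζ hζ] at he
    have h1 := (shift_eq_shift (.inl rfl)
      (.inr (mul_ne_zero (h.ne_zero (by omega)) (direction_ne_zero _ _))) he).1
    omega
  · intro ζ hζ
    rw [hval ζ hζ]
    have h1 := norm_shift_lt (n := 0) (X := m 0 * ((ϑ : ℂ)⁻¹) ^ 0) (.inl rfl)
    have h2 : (0 : ℝ) ≤ N := Nat.cast_nonneg N
    push_cast at h1
    linarith

theorem markedPoints_finite (h : PolarPart R N q μ) (hμ : AnalyticAt ℂ μ 0)
    {I J : Type*} [Finite I] [Finite J] {d : I → ℕ} {m : I → ℂ → ℂ} {g : J → ℂ → ℂ}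
    (hd : ∀ i, d i ≤ N) (hm : ∀ i, AnalyticAt ℂ (m i) 0)
    (hm0 : ∀ i, m i 0 ≠ 0) (hg : ∀ j, ContinuousAt (g j) 0) (ϑ : Circle) :
    (markedPoints R N q μ d m g ϑ).Finite ∧
      ∀ ζ ∈ markedPoints R N q μ d m g ϑ, ‖BlowUp.psi h ζ‖ < N + 1 := by
  unfold markedPoints
  rw [Set.inter_union_distrib_left, Set.inter_iUnion, Set.inter_iUnion]
  constructor
  · refine Set.Finite.union (Set.finite_iUnion fun i => ?_) (Set.finite_iUnion fun j => ?_)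
    · exact (fibre_inter_strictTransform_pole h hμ (hd i) (hm i) (hm0 i) ϑ).1.finite
    · exact (fibre_inter_strictTransform_graph h (hg j) ϑ).1.finite
  · rintro ζ (hζ | hζ) <;> obtain ⟨i, hi⟩ := Set.mem_iUnion.1 hζ
    · exact (fibre_inter_strictTransform_pole h hμ (hd i) (hm i) (hm0 i) ϑ).2 ζ hi
    · exact (fibre_inter_strictTransform_graph h (hg i) ϑ).2 ζ hi

end curves

/-- A closed part of `F` has compact, hence closed, image in `ℂ`. As `B` is a full preimage in `F`,
the restriction of `f` to `B \ P` is a closed bijection onto its image and so a homeomorphism. No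
separation property of `X` is needed. The bound on `P` makes the removed points interior. -/
theorem isFreeSpace_of_compact {X : Type*} [TopologicalSpace X] {F B P : Set X} (hF : IsCompact F)
    {f : X → ℂ} (hf : ContinuousOn f F) (hB : B = F ∩ f ⁻¹' discHalf) (hinj : Set.InjOn f B)
    {K : ℝ} (hK : 1 ≤ K) (himg : f '' B = discHalf ∩ Metric.closedBall 0 K) (hP : P.Finite)
    (hPB : P ⊆ B) (hPK : ∀ x ∈ P, ‖f x‖ < K) : IsFreeSpace ↥(B \ P) (Fin P.ncard) := by
  have hBF : B ⊆ F := hB ▸ Set.inter_subset_left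
  have hBd : ∀ x ∈ B, f x ∈ discHalf := fun x hx => by
    rw [hB] at hx
    exact hx.2
  obtain ⟨S, hS⟩ : ∃ S, S = (discHalf ∩ Metric.closedBall 0 K) \ (f '' P) := ⟨_, rfl⟩
  have hmem : ∀ x ∈ B \ P, f x ∈ S := by
    rintro x ⟨hx, hxP⟩
    rw [hS, ← himg]
    refine ⟨⟨x, hx, rfl⟩, ?_⟩
    rintro ⟨y, hy, hyx⟩
    exact hxP (hinj (hPB hy) hx hyx ▸ hy)
  obtain ⟨φ, hφ⟩ : ∃ φ : ↥(B \ P) → S, ∀ x, (φ x : ℂ) = f x :=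
    ⟨fun x => ⟨f x, hmem x x.2⟩, fun _ => rfl⟩
  have hφc : Continuous φ := by
    rw [continuous_induced_rng]
    have e : Subtype.val ∘ φ = fun x : ↥(B \ P) => f x := funext hφ
    rw [e]
    exact (hf.mono (Set.sdiff_subset.trans hBF)).comp_continuous continuous_subtype_val fun x => x.2
  have hφcl : IsClosedMap φ := by
    intro C hC
    obtain ⟨C0, hC0, rfl⟩ := isClosed_induced_iff.1 hC
    have hcomp : IsClosed (f '' (F ∩ C0)) :=
      ((hF.inter_right hC0).image_of_continuousOn (hf.mono Set.inter_subset_left)).isClosed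
    refine isClosed_induced_iff.2 ⟨_, hcomp, ?_⟩
    ext s
    constructor
    · rintro ⟨x, ⟨hxF, hxC⟩, hxs⟩
      have hs := s.2
      rw [← hxs, hS] at hs
      have hxB : x ∈ B := hB ▸ ⟨hxF, hs.1.1⟩
      exact ⟨⟨x, hxB, fun hxP => hs.2 ⟨x, hxP, rfl⟩⟩, hxC, Subtype.ext ((hφ _).trans hxs)⟩
    · rintro ⟨x, hx, rfl⟩
      exact ⟨x, ⟨hBF x.2.1, hx⟩, (hφ x).symm⟩
  have hφb : Function.Bijective φ := by
    constructor
    · intro x y hxy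
      have h1 := congrArg Subtype.val hxy
      rw [hφ, hφ] at h1
      exact Subtype.ext (hinj x.2.1 y.2.1 h1)
    · intro s
      have hs : (s : ℂ) ∈ (f '' B) \ (f '' P) := by
        rw [himg, ← hS]
        exact s.2
      obtain ⟨⟨x, hx, hxs⟩, hsP⟩ := hs
      exact ⟨⟨x, hx, fun hxP => hsP ⟨x, hxP, hxs⟩⟩, Subtype.ext ((hφ _).trans hxs)⟩
  have hhom : IsHomeomorph φ := isHomeomorph_iff_continuous_isClosedMap_bijective.2 ⟨hφc, hφcl, hφb⟩
  have hfP : f '' P ⊆ discHalf ∩ Metric.ball 0 K := by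
    rintro _ ⟨x, hx, rfl⟩
    exact ⟨hBd x (hPB hx), mem_ball_zero_iff.2 (hPK x hx)⟩
  have hfree := isFreeSpace_discHalf hK (hP.image f) hfP
  rw [← hS] at hfree
  have hcard : (f '' P).ncard = P.ncard := (hinj.mono hPB).ncard_image
  have : Finite ↥(f '' P) := hP.image f
  refine hfree.of_homeomorph hhom.homeomorph (Finite.equivFinOfCardEq ?_)
  exact hcard

/-! ### Injectivity and surjectivity of `psi'` -/

section fibre

variable {R : ℝ} {N q : ℕ} {μ : ℂ → ℂ} {ϑ : Circle} {m : ℂ}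

theorem shift_mem_discHalf (hq : 1 ≤ q) {X : ℂ} (hX : X ≠ 0) : shift q X ∈ discHalf ↔ X.re < 0 := by
  have h1 := lt_norm_shift (n := q) hX
  have h2 : (1 : ℝ) ≤ q := by exact_mod_cast hq
  rw [discHalf, Set.mem_ofPred_eq, shift_re_neg hX, or_iff_right (by linarith)]

theorem exists_shift_eq (hq : 1 ≤ q) {z : ℂ} (h1 : q < ‖z‖) (h2 : ‖z‖ < q + 1) :
    ∃ V, V ≠ 0 ∧ z = shift q V := by
  have hq' : (1 : ℝ) ≤ q := by exact_mod_cast hq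
  rcases exists_level 1 z with ⟨x, -, hx⟩ | ⟨j, v, rfl, h3, h4, h5⟩
  · linarith
  · have h6 : (j : ℝ) < q + 1 := by linarith
    have h7 : (q : ℝ) < j + 1 := by linarith
    norm_cast at h6 h7
    obtain rfl : j = q := by omega
    have hv : v.1 ≠ 0 := fun h0 => by linarith [h5.1 h0]
    have hv' : toC v⁻¹ ≠ 0 := toC_ne_zero.2 (inv_ne_zero hv)
    exact ⟨_, mul_ne_zero hv' (direction_ne_zero _ _), level_eq_shift 1 j hv⟩

theorem continuousAt_shift (n : ℕ) {X : ℂ} (hX : X ≠ 0) : ContinuousAt (shift n) X := by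
  have h1 : (‖X‖ : ℂ) ≠ 0 := by exact_mod_cast norm_ne_zero_iff.2 hX
  have h2 : ContinuousAt (fun X : ℂ => (‖X‖ : ℂ)) X := by fun_prop
  have h3 : ContinuousAt (fun X : ℂ => (n : ℝ) + ‖X‖ / (1 + ‖X‖)) X := by
    refine continuousAt_const.add (ContinuousAt.div (by fun_prop) (by fun_prop) ?_)
    positivity
  exact (continuousAt_id.div h2 h1).mul (Complex.continuous_ofReal.continuousAt.comp h3)

theorem valueKind_fibre (h : PolarPart R N q μ) (hq : 1 ≤ q) (hm : m = μ 0 * ((ϑ : ℂ)⁻¹) ^ q)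
    {ζ : BlowUp R N q μ} (hζ : ζ ∈ fibre R N q μ ϑ) :
    ValueKind N q m (BlowUp.psi h ζ) (BlowUp.psi' h ζ) := by
  rw [hm]
  exact valueKind h (t := (0, ϑ)) rfl hq hζ

theorem PolarPart.angle_ne_zero (h : PolarPart R N q μ) (hq : 1 ≤ q)
    (hm : m = μ 0 * ((ϑ : ℂ)⁻¹) ^ q) : m ≠ 0 := by
  rw [hm]
  exact mul_ne_zero (h.ne_zero (by omega)) (direction_ne_zero _ _)

theorem norm_psi'_le (h : PolarPart R N q μ) (hq : 1 ≤ q) (hm : m = μ 0 * ((ϑ : ℂ)⁻¹) ^ q)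
    {ζ : BlowUp R N q μ} (hζ : ζ ∈ fibre R N q μ ϑ) : ‖BlowUp.psi' h ζ‖ ≤ N + 1 ∧
      (‖BlowUp.psi h ζ‖ < N + 1 → ‖BlowUp.psi' h ζ‖ < N + 1) := by
  have hm0 := h.angle_ne_zero hq hm
  have hqN : (q : ℝ) ≤ N := by exact_mod_cast h.le
  rcases valueKind_fibre h hq hm hζ with ⟨h1, h2⟩ | ⟨W, h0, h1, h2, h3⟩ | ⟨h1, h2, h3⟩ | ⟨h1, h2⟩
  · rw [h2]
    have := norm_shift_lt (n := q) (.inr (neg_ne_zero.2 hm0))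
    constructor
    · linarith
    · intro _
      linarith
  · rw [h3]
    have := norm_shift_lt (n := q) (.inr (sub_ne_zero.2 h1))
    constructor
    · linarith
    · intro _
      linarith
  · rw [h3]
    exact ⟨h2, id⟩
  · constructor
    · linarith
    · intro _
      linarith

/-- Apart from the collapsed part below `E q`, the norm of `psi'` is at most `q` on the branch,
strictly between `q` and `q + 1` on the common part, and at least `q + 1` beyond it. Within each
kind `psi'` determines `psi`, and then the pair determines the point. -/
theorem fibre_eq_of_psi'_eq (h : PolarPart R N q μ) (hq : 1 ≤ q) (hm : m = μ 0 * ((ϑ : ℂ)⁻¹) ^ q)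
    {ζ ζ' : BlowUp R N q μ} (hζ : ζ ∈ fibre R N q μ ϑ) (hζ' : ζ' ∈ fibre R N q μ ϑ)
    (h1 : BlowUp.psi' h ζ ≠ shift q (-m)) (he : BlowUp.psi' h ζ = BlowUp.psi' h ζ') : ζ = ζ' := by
  refine fibre_injective h (t := (0, ϑ)) rfl hζ hζ' ?_ he
  rcases valueKind_fibre h hq hm hζ with ⟨a1, a2⟩ | ⟨W, a0, a1, a2, a3⟩ | ⟨a1, a2, a3⟩ | ⟨a1, a2⟩ <;>
  rcases valueKind_fibre h hq hm hζ' with ⟨b1, b2⟩ | ⟨W', b0, b1, b2, b3⟩ | ⟨b1, b2, b3⟩ | ⟨b1, b2⟩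
  all_goals first
    | exact absurd a2 h1
    | exact absurd (he.trans b2) h1
    | skip
  · rw [a3, b3] at he
    have := shift_inj (.inr (sub_ne_zero.2 a1)) (.inr (sub_ne_zero.2 b1)) he
    rw [a2, b2, sub_left_injective this]
  · have := norm_shift_lt (n := q) (.inr (sub_ne_zero.2 a1))
    rw [← a3, he, b3] at this
    linarith
  · have := lt_norm_shift (n := q) (sub_ne_zero.2 a1)
    rw [← a3, he] at this
    linarith
  · have := norm_shift_lt (n := q) (.inr (sub_ne_zero.2 b1))
    rw [← b3, ← he, a3] at this
    linarith
  · rw [← a3, ← b3, he]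
  · rw [← a3, he] at a1
    linarith
  · have := lt_norm_shift (n := q) (sub_ne_zero.2 b1)
    rw [← b3, ← he] at this
    linarith
  · rw [← b3, ← he] at b1
    linarith
  · rw [a1, b1]

theorem exists_fibre_mid (h : PolarPart R N q μ) (hq : 1 ≤ q) (hm : m = μ 0 * ((ϑ : ℂ)⁻¹) ^ q)
    {V : ℂ} (hV : V ≠ 0) (hVm : V + m ≠ 0) : ∃ ζ ∈ fibre R N q μ ϑ,
      BlowUp.psi h ζ = shift q (V + m) ∧ BlowUp.psi' h ζ = shift q V := by
  have hm0 := h.angle_ne_zero hq hm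
  have hqN : (q : ℝ) ≤ N := by exact_mod_cast h.le
  have hlt := norm_shift_lt (n := q) (.inr hVm)
  have hgt := lt_norm_shift (n := q) hVm
  have hne : shift q (V + m) ≠ shift q m := fun he => hV (by
    simpa using shift_inj (.inr hVm) (.inr hm0) he)
  obtain ⟨ζ, hζ, hψ⟩ := exists_psi_eq h (t := (0, ϑ)) rfl (z := shift q (V + m)) (by linarith)
    (fun _ => by rw [← hm]; exact hne)
  refine ⟨ζ, hζ, hψ, ?_⟩
  rcases valueKind_fibre h hq hm hζ with ⟨h1, h2⟩ | ⟨W, h0, h1, h2, h3⟩ | ⟨h1, h2, h3⟩ | ⟨h1, h2⟩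
  · rw [hψ] at h1
    linarith
  · rw [hψ] at h2
    rw [h3, ← shift_inj (.inr hVm) (.inr h0) h2, add_sub_cancel_right]
  · rw [hψ] at h1
    linarith
  · rw [hψ] at h1
    exact absurd h1 hne

theorem exists_fibre_high (h : PolarPart R N q μ) (hq : 1 ≤ q) (hm : m = μ 0 * ((ϑ : ℂ)⁻¹) ^ q)
    {z : ℂ} (hz : (q : ℝ) + 1 ≤ ‖z‖) (hz' : ‖z‖ ≤ N + 1) : ∃ ζ ∈ fibre R N q μ ϑ,
      BlowUp.psi h ζ = z ∧ BlowUp.psi' h ζ = z := by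
  have hm0 := h.angle_ne_zero hq hm
  have hne : z ≠ shift q m := fun he => by
    have := norm_shift_lt (n := q) (.inr hm0)
    rw [← he] at this
    linarith
  obtain ⟨ζ, hζ, hψ⟩ := exists_psi_eq h (t := (0, ϑ)) rfl hz' (fun _ => by rw [← hm]; exact hne)
  refine ⟨ζ, hζ, hψ, ?_⟩
  rcases valueKind_fibre h hq hm hζ with ⟨h1, h2⟩ | ⟨W, h0, h1, h2, h3⟩ | ⟨h1, h2, h3⟩ | ⟨h1, h2⟩
  · rw [hψ] at h1
    linarith
  · have := norm_shift_lt (n := q) (.inr h0)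
    rw [← h2, hψ] at this
    linarith
  · rw [h3, hψ]
  · rw [hψ] at h1
    exact absurd h1 hne

end fibre

/-! ### The three cases for the sign of `m.re` -/

section fibre

variable {R : ℝ} {N q : ℕ} {μ : ℂ → ℂ} {ϑ : Circle} {m : ℂ}

/-- Without `ψ` there is no branch, the two maps agree, and `psi` carries `B` onto the model region.
-/
theorem isFreeSpace_of_eq_zero (h : PolarPart R N q μ) (hq : q = 0) {P : Set (BlowUp R N q μ)}
    (hP : P.Finite) (hPB : P ⊆ moderateSet R N q μ ϑ) (hPN : ∀ ζ ∈ P, ‖BlowUp.psi h ζ‖ < N + 1) :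
    IsFreeSpace ↥(moderateSet R N q μ ϑ \ P) (Fin P.ncard) := by
  have hval : ∀ ζ ∈ fibre R N q μ ϑ, BlowUp.psi' h ζ = BlowUp.psi h ζ ∧
      ‖BlowUp.psi h ζ‖ ≤ N + 1 := fun ζ hζ => values_of_eq_zero h (t := (0, ϑ)) rfl hq hζ
  have hB : moderateSet R N q μ ϑ = fibre R N q μ ϑ ∩ BlowUp.psi h ⁻¹' discHalf := by
    ext ζ
    rw [mem_moderateSet_iff h]
    refine and_congr_right fun hζ => ?_
    rw [(hval ζ hζ).1]
    rfl
  have hN : (0 : ℝ) ≤ N := Nat.cast_nonneg N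
  refine isFreeSpace_of_compact (isCompact_fibre h ϑ) (BlowUp.continuous_psi h).continuousOn hB ?_
    (K := N + 1) (by linarith) ?_ hP hPB hPN
  · intro ζ hζ ζ' hζ' he
    rw [hB] at hζ hζ'
    exact fibre_eq_of_psi_eq h hζ.1 hζ'.1 he fun hq' => by omega
  · ext z
    constructor
    · rintro ⟨ζ, hζ, rfl⟩
      rw [hB] at hζ
      exact ⟨hζ.2, mem_closedBall_zero_iff.2 (hval ζ hζ.1).2⟩
    · rintro ⟨hz, hzN⟩
      obtain ⟨ζ, hζ, rfl⟩ := exists_psi_eq h (t := (0, ϑ)) rfl (mem_closedBall_zero_iff.1 hzN)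
        fun hq' => by omega
      refine ⟨ζ, ?_, rfl⟩
      rw [hB]
      exact ⟨hζ, hz⟩

/-- The part collapsed by `psi'` has the value `shift q (-m)`, of norm greater than `1` and with
non-negative real part. It lies outside `B`, so `psi'` is injective on `B`. -/
theorem isFreeSpace_of_re_le (h : PolarPart R N q μ) (hq : 1 ≤ q) (hm : m = μ 0 * ((ϑ : ℂ)⁻¹) ^ q)
    (hre : m.re ≤ 0) {P : Set (BlowUp R N q μ)}
    (hP : P.Finite) (hPB : P ⊆ moderateSet R N q μ ϑ) (hPN : ∀ ζ ∈ P, ‖BlowUp.psi h ζ‖ < N + 1) :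
    IsFreeSpace ↥(moderateSet R N q μ ϑ \ P) (Fin P.ncard) := by
  have hm0 := h.angle_ne_zero hq hm
  have hlow : shift q (-m) ∉ discHalf := by
    rw [shift_mem_discHalf hq (neg_ne_zero.2 hm0), Complex.neg_re]
    linarith
  have hB : moderateSet R N q μ ϑ = fibre R N q μ ϑ ∩ BlowUp.psi' h ⁻¹' discHalf := by
    ext ζ
    exact mem_moderateSet_iff h
  have hN : (0 : ℝ) ≤ N := Nat.cast_nonneg N
  refine isFreeSpace_of_compact (isCompact_fibre h ϑ) (BlowUp.continuous_psi' h).continuousOn hB ?_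
    (K := N + 1) (by linarith) ?_ hP hPB
    fun ζ hζ => (norm_psi'_le h hq hm (hPB hζ).1).2 (hPN ζ hζ)
  · intro ζ hζ ζ' hζ' he
    rw [hB] at hζ hζ'
    refine fibre_eq_of_psi'_eq h hq hm hζ.1 hζ'.1 (fun h1 => hlow ?_) he
    rw [← h1]
    exact hζ.2
  · ext z
    constructor
    · rintro ⟨ζ, hζ, rfl⟩
      rw [hB] at hζ
      exact ⟨hζ.2, mem_closedBall_zero_iff.2 (norm_psi'_le h hq hm hζ.1).1⟩
    · rintro ⟨hz, hzN⟩
      have hzN := mem_closedBall_zero_iff.1 hzN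
      suffices hs : ∃ ζ ∈ fibre R N q μ ϑ, BlowUp.psi' h ζ = z by
        obtain ⟨ζ, hζ, rfl⟩ := hs
        refine ⟨ζ, ?_, rfl⟩
        rw [hB]
        exact ⟨hζ, hz⟩
      rcases le_or_gt ‖z‖ q with h1 | h1
      · obtain ⟨ζ, hζ, -, h2⟩ := exists_psi'_eq h (t := (0, ϑ)) rfl hq h1
        exact ⟨ζ, hζ, h2⟩
      · rcases lt_or_ge ‖z‖ (q + 1) with h2 | h2
        · obtain ⟨V, hV, rfl⟩ := exists_shift_eq hq h1 h2
          obtain ⟨ζ, hζ, -, h3⟩ := exists_fibre_mid h hq hm hV fun h4 => hlow (by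
            rwa [← eq_neg_of_add_eq_zero_left h4])
          exact ⟨ζ, hζ, h3⟩
        · obtain ⟨ζ, hζ, -, h3⟩ := exists_fibre_high h hq hm h2 hzN
          exact ⟨ζ, hζ, h3⟩

theorem frac_lt_frac {a b : ℝ} (ha : 0 ≤ a) (h : a < b) : a / (1 + a) < b / (1 + b) := by
  have hb := ha.trans h.le
  rw [div_lt_div_iff₀ (by positivity) (by positivity)]
  nlinarith

/-- Now the collapsed part lies in `B`, and `psi'` alone is not injective. In the coordinate of `E
q`, the disc `‖psi‖ ≤ ρ` is the collapsed part together with the punctured disc `‖W‖ ≤ δ`. The map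
`f` scales this whole disc linearly onto the disc of radius `δ` and then applies `shift q (· - m)`,
so the puncture is filled by the disc. Elsewhere `f` is `psi'`. -/
theorem isFreeSpace_of_re_pos (h : PolarPart R N q μ) (hq : 1 ≤ q) (hm : m = μ 0 * ((ϑ : ℂ)⁻¹) ^ q)
    (hre : 0 < m.re) {P : Set (BlowUp R N q μ)}
    (hP : P.Finite) (hPB : P ⊆ moderateSet R N q μ ϑ) (hPN : ∀ ζ ∈ P, ‖BlowUp.psi h ζ‖ < N + 1) :
    IsFreeSpace ↥(moderateSet R N q μ ϑ \ P) (Fin P.ncard) := by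
  classical
  have hm0 := h.angle_ne_zero hq hm
  have hq' : (1 : ℝ) ≤ q := by exact_mod_cast hq
  have hqN : (q : ℝ) ≤ N := by exact_mod_cast h.le
  -- With `δ < m.re`, the disc of radius `δ` around `-m` lies in the open left half plane, so its
  -- image lies in `discHalf`; moreover the branch point `m` is not affected.
  obtain ⟨δ, hδ, hδm⟩ := exists_between hre
  have hmδ : δ < ‖m‖ := hδm.trans_le (Complex.re_le_norm m)
  -- The norm of `shift q W` for `‖W‖ = δ`.
  obtain ⟨ρ, hρ⟩ : ∃ ρ : ℝ, ρ = q + δ / (1 + δ) := ⟨_, rfl⟩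
  have hρq : q < ρ := by
    have : 0 < δ / (1 + δ) := by positivity
    linarith
  have hρq1 : ρ < q + 1 := by linarith [frac_lt_one hδ.le]
  have hρ0 : 0 < ρ := by linarith
  have hWρ : ∀ W : ℂ, W ≠ 0 → (‖shift q W‖ ≤ ρ ↔ ‖W‖ ≤ δ) := by
    intro W hW
    rw [norm_shift (.inr hW), hρ, add_le_add_iff_left]
    constructor
    · intro h1
      by_contra h2
      linarith [frac_lt_frac hδ.le (not_le.1 h2)]
    · exact frac_mono (norm_nonneg _)
  have hmρ : ρ < ‖shift q m‖ := not_le.1 fun h1 => by linarith [(hWρ m hm0).1 h1]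
  -- the map which is used near the point where `psi` vanishes
  obtain ⟨g, hg⟩ : ∃ g : ℂ → ℂ, ∀ X, g X = ((δ / ρ : ℝ) : ℂ) * X := ⟨_, fun _ => rfl⟩
  have hgn : ∀ X, ‖X‖ ≤ ρ → ‖g X‖ ≤ δ := by
    intro X hX
    rw [hg, norm_mul, Complex.norm_real, Real.norm_of_nonneg (by positivity), div_mul_eq_mul_div,
      div_le_iff₀ hρ0]
    gcongr
  have hgc : Continuous g := by
    have : g = fun X => ((δ / ρ : ℝ) : ℂ) * X := funext hg
    rw [this]
    fun_prop
  have hre_sub : ∀ W : ℂ, ‖W‖ ≤ δ → (W - m).re < 0 := by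
    intro W hW
    rw [Complex.sub_re]
    linarith [Complex.re_le_norm W]
  have hsub0 : ∀ W : ℂ, ‖W‖ ≤ δ → W - m ≠ 0 := fun W hW h0 => by
    have := hre_sub W hW
    rw [h0] at this
    simp at this
  obtain ⟨f, hf⟩ : ∃ f : BlowUp R N q μ → ℂ, f = fun ζ => if ‖BlowUp.psi h ζ‖ ≤ ρ then
      shift q (g (BlowUp.psi h ζ) - m) else BlowUp.psi' h ζ := ⟨_, rfl⟩
  have hf1 : ∀ ζ, ‖BlowUp.psi h ζ‖ ≤ ρ → f ζ = shift q (g (BlowUp.psi h ζ) - m) := by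
    intro ζ hζ
    rw [hf]
    exact if_pos hζ
  have hf2 : ∀ ζ, ρ < ‖BlowUp.psi h ζ‖ → f ζ = BlowUp.psi' h ζ := by
    intro ζ hζ
    rw [hf]
    exact if_neg (not_le.2 hζ)
  have hfc : ContinuousOn f (fibre R N q μ ϑ) := by
    rw [continuousOn_iff_continuous_domRestrict]
    have e : (fibre R N q μ ϑ).domRestrict f = fun ζ : fibre R N q μ ϑ =>
        if ‖BlowUp.psi h ζ‖ ≤ ρ then shift q (g (BlowUp.psi h ζ) - m) else BlowUp.psi' h ζ := by
      ext ζ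
      rw [Set.domRestrict_apply, hf]
    rw [e]
    have hψ : Continuous fun ζ : fibre R N q μ ϑ => BlowUp.psi h ζ :=
      (BlowUp.continuous_psi h).comp continuous_subtype_val
    refine continuous_if_le hψ.norm continuous_const ?_
      ((BlowUp.continuous_psi' h).comp continuous_subtype_val).continuousOn ?_
    · intro ζ hζ
      refine ContinuousAt.continuousWithinAt ?_
      refine ContinuousAt.comp (g := shift q)
        (continuousAt_shift q (hsub0 _ (hgn _ hζ))) ?_
      exact ((hgc.comp hψ).sub continuous_const).continuousAt
    · intro ζ hζ
      rcases valueKind_fibre h hq hm ζ.2 with ⟨h1, h2⟩ | ⟨W, h0, h1, h2, h3⟩ | ⟨h1, h2, h3⟩ | ⟨h1, h2⟩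
      · linarith
      · have hn := hζ
        rw [h2, norm_shift (.inr h0), hρ, add_right_inj] at hn
        have hWδ := frac_inj (norm_nonneg W) hδ.le hn
        rw [h3, h2]
        congr 2
        have hρc : (ρ : ℂ) ≠ 0 := by exact_mod_cast hρ0.ne'
        have hδc : (δ : ℂ) ≠ 0 := by exact_mod_cast hδ.ne'
        -- On the seam `psi = (ρ / δ) * W`, so `g` returns `W` and both definitions give `shift q (W
        -- - m)`.
        rw [hg, shift, hWδ, ← hρ, Complex.ofReal_div]
        field_simp
      · linarith
      · rw [h1] at hζ
        linarith
  have hB : moderateSet R N q μ ϑ = fibre R N q μ ϑ ∩ f ⁻¹' discHalf := by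
    ext ζ
    rw [mem_moderateSet_iff h]
    refine and_congr_right fun hζ => ?_
    rw [Set.mem_preimage]
    rcases le_or_gt ‖BlowUp.psi h ζ‖ ρ with hle | hgt
    · rw [hf1 ζ hle]
      have hg1 := hgn _ hle
      refine iff_of_true ?_ ((shift_mem_discHalf hq (hsub0 _ hg1)).2 (hre_sub _ hg1))
      rcases valueKind_fibre h hq hm hζ with ⟨h1, h2⟩ | ⟨W, h0, h1, h2, h3⟩ | ⟨h1, h2, h3⟩ | ⟨h1, h2⟩
      · rw [h2, shift_mem_discHalf hq (neg_ne_zero.2 hm0), Complex.neg_re]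
        linarith
      · rw [h2, hWρ W h0] at hle
        rw [h3, shift_mem_discHalf hq (sub_ne_zero.2 h1)]
        exact hre_sub W hle
      · linarith
      · rw [h1] at hle
        linarith
    · rw [hf2 ζ hgt]
  -- A common value would be `shift q (W - m)` with `‖W‖ ≤ δ` on one side and `‖W‖ > δ` on the
  -- other.
  have hmixed : ∀ ζ ζ', ζ' ∈ fibre R N q μ ϑ → ‖BlowUp.psi h ζ‖ ≤ ρ → ρ < ‖BlowUp.psi h ζ'‖ →
      f ζ ≠ f ζ' := by
    intro ζ ζ' hζ' hle hgt he
    rw [hf1 ζ hle, hf2 ζ' hgt] at he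
    have hg1 := hgn _ hle
    have hlt := norm_shift_lt (n := q) (.inr (hsub0 _ hg1))
    have hlt' := lt_norm_shift (n := q) (hsub0 _ hg1)
    rcases valueKind_fibre h hq hm hζ' with ⟨h1, h2⟩ | ⟨W, h0, h1, h2, h3⟩ | ⟨h1, h2, h3⟩ | ⟨h1, h2⟩
    · linarith
    · rw [h3] at he
      have hW := sub_left_injective (shift_inj (.inr (hsub0 _ hg1)) (.inr (sub_ne_zero.2 h1)) he)
      rw [hW] at hg1
      rw [h2] at hgt
      linarith [(hWρ W h0).2 hg1]
    · rw [he, h3] at hlt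
      linarith
    · rw [he] at hlt'
      linarith
  have hnorm : ∀ ζ ∈ fibre R N q μ ϑ, ‖f ζ‖ ≤ N + 1 ∧ (‖BlowUp.psi h ζ‖ < N + 1 → ‖f ζ‖ < N + 1) := by
    intro ζ hζ
    rcases le_or_gt ‖BlowUp.psi h ζ‖ ρ with hle | hgt
    · rw [hf1 ζ hle]
      have hlt := norm_shift_lt (n := q) (.inr (hsub0 _ (hgn _ hle)))
      constructor
      · linarith
      · intro _
        linarith
    · rw [hf2 ζ hgt]
      exact norm_psi'_le h hq hm hζ
  refine isFreeSpace_of_compact (isCompact_fibre h ϑ) hfc hB ?_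
    (K := N + 1) (by linarith) ?_ hP hPB fun ζ hζ => (hnorm ζ (hPB hζ).1).2 (hPN ζ hζ)
  · intro ζ hζ ζ' hζ' he
    have hζ := hζ.1
    have hζ' := hζ'.1
    rcases le_or_gt ‖BlowUp.psi h ζ‖ ρ with h1 | h1 <;>
    rcases le_or_gt ‖BlowUp.psi h ζ'‖ ρ with h2 | h2
    · rw [hf1 ζ h1, hf1 ζ' h2] at he
      have h3 := sub_left_injective
        (shift_inj (.inr (hsub0 _ (hgn _ h1))) (.inr (hsub0 _ (hgn _ h2))) he)
      rw [hg, hg] at h3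
      have hc : ((δ / ρ : ℝ) : ℂ) ≠ 0 := by
        rw [Complex.ofReal_ne_zero]
        positivity
      refine fibre_eq_of_psi_eq h hζ hζ' (mul_left_cancel₀ hc h3) fun _ h4 => ?_
      rw [h4, ← hm] at h1
      linarith
    · exact absurd he (hmixed ζ ζ' hζ' h1 h2)
    · exact absurd he.symm (hmixed ζ' ζ hζ h2 h1)
    · rw [hf2 ζ h1, hf2 ζ' h2] at he
      rcases valueKind_fibre h hq hm hζ with ⟨a1, a2⟩ | ⟨W, a0, a1, a2, a3⟩ | ⟨a1, a2, a3⟩ | ⟨a1, a2⟩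
      · linarith
      · refine fibre_eq_of_psi'_eq h hq hm hζ hζ' (fun h4 => a0 ?_) he
        rw [a3] at h4
        have := shift_inj (.inr (sub_ne_zero.2 a1)) (.inr (neg_ne_zero.2 hm0)) h4
        linear_combination this
      · refine fibre_eq_of_psi'_eq h hq hm hζ hζ' (fun h4 => ?_) he
        have := norm_shift_lt (n := q) (.inr (neg_ne_zero.2 hm0))
        rw [← h4, a3] at this
        linarith
      · refine fibre_eq_of_psi'_eq h hq hm hζ hζ' (fun h4 => ?_) he
        have := lt_norm_shift (n := q) (neg_ne_zero.2 hm0)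
        rw [← h4] at this
        linarith
  · ext z
    constructor
    · rintro ⟨ζ, hζ, rfl⟩
      rw [hB] at hζ
      exact ⟨hζ.2, mem_closedBall_zero_iff.2 (hnorm ζ hζ.1).1⟩
    · rintro ⟨hz, hzN⟩
      have hzN := mem_closedBall_zero_iff.1 hzN
      suffices hs : ∃ ζ ∈ fibre R N q μ ϑ, f ζ = z by
        obtain ⟨ζ, hζ, rfl⟩ := hs
        refine ⟨ζ, ?_, rfl⟩
        rw [hB]
        exact ⟨hζ, hz⟩
      rcases le_or_gt ‖z‖ q with h1 | h1
      · obtain ⟨ζ, hζ, h3, h2⟩ := exists_psi'_eq h (t := (0, ϑ)) rfl hq h1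
        refine ⟨ζ, hζ, ?_⟩
        rw [hf2 ζ (by rw [h3, ← hm]; exact hmρ), h2]
      · rcases lt_or_ge ‖z‖ (q + 1) with h2 | h2
        · obtain ⟨V, hV, rfl⟩ := exists_shift_eq hq h1 h2
          rcases le_or_gt ‖V + m‖ δ with hVm | hVm
          · have hc : ((δ / ρ : ℝ) : ℂ) ≠ 0 := by
              rw [Complex.ofReal_ne_zero]
              positivity
            have hXn : ‖(V + m) / ((δ / ρ : ℝ) : ℂ)‖ ≤ ρ := by
              rw [norm_div, Complex.norm_real, Real.norm_of_nonneg (by positivity),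
                div_le_iff₀ (by positivity), mul_div_cancel₀ _ hρ0.ne']
              exact hVm
            obtain ⟨ζ, hζ, h3⟩ := exists_psi_eq h (t := (0, ϑ)) rfl
              (z := (V + m) / ((δ / ρ : ℝ) : ℂ)) (by linarith) fun _ h4 => by
                rw [← hm] at h4
                rw [h4] at hXn
                linarith
            refine ⟨ζ, hζ, ?_⟩
            rw [hf1 ζ (by rw [h3]; exact hXn), h3, hg, mul_div_cancel₀ _ hc, add_sub_cancel_right]
          · have h0 : V + m ≠ 0 := norm_pos_iff.1 (by linarith)
            obtain ⟨ζ, hζ, h4, h3⟩ := exists_fibre_mid h hq hm hV h0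
            refine ⟨ζ, hζ, ?_⟩
            rw [hf2 ζ ?_, h3]
            rw [h4]
            exact not_le.1 fun h5 => by linarith [(hWρ _ h0).1 h5]
        · obtain ⟨ζ, hζ, h4, h3⟩ := exists_fibre_high h hq hm h2 hzN
          refine ⟨ζ, hζ, ?_⟩
          rw [hf2 ζ (by rw [h4]; linarith), h3]

theorem isFreeSpace_moderateSet (h : PolarPart R N q μ) {P : Set (BlowUp R N q μ)}
    (hP : P.Finite) (hPB : P ⊆ moderateSet R N q μ ϑ) (hPN : ∀ ζ ∈ P, ‖BlowUp.psi h ζ‖ < N + 1) :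
    IsFreeSpace ↥(moderateSet R N q μ ϑ \ P) (Fin P.ncard) := by
  rcases Nat.eq_zero_or_pos q with hq | hq
  · exact isFreeSpace_of_eq_zero h hq hP hPB hPN
  · rcases le_or_gt (μ 0 * ((ϑ : ℂ)⁻¹) ^ q).re 0 with hre | hre
    · exact isFreeSpace_of_re_le h hq rfl hre hP hPB hPN
    · exact isFreeSpace_of_re_pos h hq rfl hre hP hPB hPN

end fibre

end StokesFibre

/-! ### The theorem -/

theorem mainTheorem6 {I J : Type*} [Fintype I] [Fintype J] (R : ℝ) (hR : 0 < R)
    (d : I → ℕ) (m : I → ℂ → ℂ) (hd : ∀ i, 1 ≤ d i)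
    (hm : ∀ i, DifferentiableOn ℂ (m i) (Metric.ball 0 R)) (hm0 : ∀ i, m i 0 ≠ 0)
    (hdm : ∀ i i', i ≠ i' → d i ≠ d i' ∨ m i 0 ≠ m i' 0)
    (h : J → ℂ → ℂ) (hh : ∀ j, DifferentiableOn ℂ (h j) (Metric.ball 0 R))
    (hh0 : ∀ j j', j ≠ j' → h j 0 ≠ h j' 0)
    (q : ℕ) (μ : ℂ → ℂ)
    (hψ : (q = 0 ∧ μ = 0) ∨
      (1 ≤ q ∧ DifferentiableOn ℂ μ (Metric.ball 0 R) ∧ μ 0 ≠ 0))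
    (N : ℕ) (hN : N = max q (Finset.univ.sup d)) (ϑ : Circle)
    (B P : Set (StokesFibre.BlowUp R N q μ))
    (hB : B = StokesFibre.moderateSet R N q μ ϑ)
    (hP : P = StokesFibre.markedPoints R N q μ d m h ϑ ∩ B) :
    P.Finite ∧ PathConnectedSpace ↥(B \ P) ∧
      ∀ b : ↥(B \ P), Nonempty (FundamentalGroup ↥(B \ P) b ≃* FreeGroup (Fin P.ncard)) := by
  have hball : Metric.ball (0 : ℂ) R ∈ 𝓝 0 := Metric.ball_mem_nhds 0 hR
  have hμ : DifferentiableOn ℂ μ (Metric.ball 0 R) := by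
    rcases hψ with ⟨-, rfl⟩ | ⟨-, hμ, -⟩
    · exact differentiableOn_const 0
    · exact hμ
  have hpp : StokesFibre.PolarPart R N q μ :=
    ⟨hR, hN ▸ le_max_left _ _, hμ.continuousOn, hψ.imp id fun h1 => ⟨h1.1, h1.2.2⟩⟩
  have hdN : ∀ i, d i ≤ N := fun i =>
    (Finset.le_sup (Finset.mem_univ i)).trans (hN ▸ le_max_right _ _)
  obtain ⟨hfin, hnorm⟩ := StokesFibre.markedPoints_finite hpp (hμ.analyticAt hball) hdN
    (fun i => (hm i).analyticAt hball) hm0 (fun j => ((hh j).differentiableAt hball).continuousAt) ϑ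
  subst hP hB
  have hPfin := hfin.inter_of_left (StokesFibre.moderateSet R N q μ ϑ)
  exact ⟨hPfin, StokesFibre.isFreeSpace_moderateSet hpp hPfin Set.inter_subset_right
    fun ζ hζ => hnorm ζ hζ.1⟩
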